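/- A *knot projection* $P$ is a generic immersed spherical curve, that is, (the image of) a smooth immersion of the circle into the 2-sphere whose only multiple points are finitely many transverse double points. Its *chord diagram* $CD_P$ is the circle in which, for every double point of $P$, the two preimages are joined by a chord. For a chord diagram $x$, let $x(P)$ be the number of sub-chord diagrams of $CD_P$ (subsets of the set of chords, with their endpoints on the circle) that are of type $x$. Consider the following five types of chord diagrams, given by the cyclic words in which the endpoints of the chords are met on the circle (equal letters are the two ends of one chord): - $\otimes$: two crossing chords, $0101$; - $\mathrm{tr}$: three mutually crossing chords, $012012$; - $H$: two parallel chords and one chord crossing both, $012021$; - $III$: three parallel chords and one chord crossing all three, $01230321$; - $HH$: two parallel chords and two further parallel chords, each of which crosses the first two, $01231032$. A *flype* is the following local replacement in a disc on the sphere. Before, the disc contains, from left to right, a crossing of two strands, a tangle $T$ (the part of the projection in a smaller disc whose boundary it meets in four points, none of them a double point), and two parallel strands: the two strands of the crossing enter the disc on its left and attach to the two left ends of $T$, and the two parallel strands run from the two right ends of $T$ to the right of the disc. After, the disc contains two parallel strands, the tangle $T$ rotated by the angle $\pi$ about the horizontal axis (so that its projection is reflected in that axis), and a crossing of two strands to the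 right of it. The boundary of the disc is met in four points, none of them a double point, and outside the disc nothing changes. Knot projections are considered up to homeomorphisms of the sphere. **Theorem.** If a knot projection $P'$ is obtained from a knot projection $P$ by a flype, then $$\otimes(P)=\otimes(P'),\quad \mathrm{tr}(P)=\mathrm{tr}(P'),\quad H(P)=H(P'),\quad III(P)=III(P'),\quad HH(P)=HH(P').$$ -/

import Mathlib

open scoped ContDiff
open Topology

/-- The round two-dimensional sphere. -/
abbrev Sphere2 : Type := Metric.sphere (0 : EuclideanSpace ℝ (Fin 3)) 1

/-- A chord diagram on the circle `ℝ / ℤ`: a finite set of unordered pairs of distinct points of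
the circle, no two of which share a point. -/
structure ChordDiagram where
  chords : Set (Sym2 UnitAddCircle)
  finite : chords.Finite
  not_isDiag : ∀ c ∈ chords, ¬ c.IsDiag
  disjoint : ∀ c ∈ chords, ∀ d ∈ chords, ∀ x, x ∈ c → x ∈ d → c = d

/-- The set `S` of chords is a chord diagram of the type given by the cyclic word `w`:
going once around the circle one meets the endpoints of the chords at the successive times
`t 0 < t 1 < ⋯ < t (m - 1) < t 0 + 1`, and the `i`-th and the `j`-th endpoint (`i ≠ j`)
are joined by a chord exactly if the `i`-th and the `j`-th letter of `w` agree. -/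
def IsOfType {m : ℕ} (w : Fin m → ℕ) (S : Set (Sym2 UnitAddCircle)) : Prop :=
  ∃ t : Fin m → ℝ, StrictMono t ∧ (∀ i j, t i < t j + 1) ∧
    S = {c | ∃ i j, i ≠ j ∧ w i = w j ∧ c = s((t i : UnitAddCircle), (t j : UnitAddCircle))}

/-- The number of sub-chord diagrams of type `w` in the chord diagram `D`. -/
noncomputable def ChordDiagram.count (D : ChordDiagram) {m : ℕ} (w : Fin m → ℕ) : ℕ :=
  {S : Set (Sym2 UnitAddCircle) | S ⊆ D.chords ∧ IsOfType w S}.ncard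

/-- The cross chord `⊗`: two crossing chords. -/
def crossChord : Fin 4 → ℕ := ![0, 1, 0, 1]

/-- The triple chord `tr`: three mutually crossing chords. -/
def tripleChord : Fin 6 → ℕ := ![0, 1, 2, 0, 1, 2]

/-- The H-chord: two parallel chords (`1` and `2`) and one chord (`0`) crossing both. -/
def hChord : Fin 6 → ℕ := ![0, 1, 2, 0, 2, 1]

/-- The III-chord: three parallel chords (`1`, `2` and `3`) and one chord (`0`) crossing all
of them. -/
def threeChord : Fin 8 → ℕ := ![0, 1, 2, 3, 0, 3, 2, 1]

/-- The HH-chord: two parallel chords (`0` and `1`) and two further parallel chords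
(`2` and `3`), each of which crosses `0` and `1`. -/
def hhChord : Fin 8 → ℕ := ![0, 1, 2, 3, 1, 0, 3, 2]

/-- A knot projection: a generic immersed spherical curve, i.e. a smooth immersion of the circle
`ℝ / ℤ` into the sphere whose only multiple points are finitely many transverse double points. -/
structure KnotProjection where
  toFun : UnitAddCircle → Sphere2
  smooth : ContDiff ℝ ∞ (fun t : ℝ => (toFun (t : UnitAddCircle) : EuclideanSpace ℝ (Fin 3)))
  immersed : ∀ t : ℝ,
    deriv (fun t : ℝ => (toFun (t : UnitAddCircle) : EuclideanSpace ℝ (Fin 3))) t ≠ 0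
  transverse : ∀ s t : ℝ, (s : UnitAddCircle) ≠ (t : UnitAddCircle) →
    toFun (s : UnitAddCircle) = toFun (t : UnitAddCircle) →
    LinearIndependent ℝ
      ![deriv (fun t : ℝ => (toFun (t : UnitAddCircle) : EuclideanSpace ℝ (Fin 3))) s,
        deriv (fun t : ℝ => (toFun (t : UnitAddCircle) : EuclideanSpace ℝ (Fin 3))) t]
  no_triple : ∀ a b c : UnitAddCircle, a ≠ b → toFun a = toFun b → toFun a = toFun c →
    c = a ∨ c = b
  finite_double : {p : Sphere2 | ∃ a b, a ≠ b ∧ toFun a = p ∧ toFun b = p}.Finite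

namespace KnotProjection

/-- The image of a knot projection on the sphere. -/
def image (P : KnotProjection) : Set Sphere2 := Set.range P.toFun

/-- The double points of a knot projection. -/
def doublePoints (P : KnotProjection) : Set Sphere2 :=
  {p | ∃ a b, a ≠ b ∧ P.toFun a = p ∧ P.toFun b = p}

/-- The chord diagram `CD_P` of a knot projection: the two preimages of every double point are
joined by a chord. -/
def chordDiagram (P : KnotProjection) : ChordDiagram where
  chords := {c | ∃ a b, a ≠ b ∧ P.toFun a = P.toFun b ∧ c = s(a, b)}
  finite := by
    have h : {c | ∃ a b, a ≠ b ∧ P.toFun a = P.toFun b ∧ c = s(a, b)} ⊆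
        ⋃ p ∈ P.doublePoints,
          {c | ∃ a b, a ≠ b ∧ P.toFun a = p ∧ P.toFun b = p ∧ c = s(a, b)} := by
      rintro c ⟨a, b, hab, hf, rfl⟩
      simp only [Set.mem_iUnion]
      exact ⟨P.toFun b, ⟨a, b, hab, hf, rfl⟩, a, b, hab, hf, rfl, rfl⟩
    refine (Set.Finite.biUnion P.finite_double ?_).subset h
    intro p _
    refine Set.Subsingleton.finite ?_
    rintro c ⟨a, b, hab, ha, hb, rfl⟩ d ⟨a', b', hab', ha', hb', rfl⟩
    have h1 := P.no_triple a b a' hab (ha.trans hb.symm) (ha.trans ha'.symm)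
    have h2 := P.no_triple a b b' hab (ha.trans hb.symm) (ha.trans hb'.symm)
    rw [Sym2.eq_iff]
    grind
  not_isDiag := by
    rintro c ⟨a, b, hab, -, rfl⟩
    simpa using hab
  disjoint := by
    rintro c ⟨a, b, hab, hf, rfl⟩ d ⟨a', b', hab', hf', rfl⟩ x hx hx'
    rw [Sym2.mem_iff] at hx hx'
    have h1 := P.no_triple a b a' hab hf
    have h2 := P.no_triple a b b' hab hf
    rw [Sym2.eq_iff]
    grind

/-- The number `⊗(P)`. -/
noncomputable def cross (P : KnotProjection) : ℕ := P.chordDiagram.count crossChord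

/-- The number `tr(P)`. -/
noncomputable def triple (P : KnotProjection) : ℕ := P.chordDiagram.count tripleChord

/-- The number `H(P)`. -/
noncomputable def h (P : KnotProjection) : ℕ := P.chordDiagram.count hChord

/-- The number `III(P)`. -/
noncomputable def three (P : KnotProjection) : ℕ := P.chordDiagram.count threeChord

/-- The number `HH(P)`. -/
noncomputable def hh (P : KnotProjection) : ℕ := P.chordDiagram.count hhChord

end KnotProjection

/-- The box of the picture in which the local replacement takes place. -/
def flypeBox : Set (ℝ × ℝ) := Set.Icc (-3) 3 ×ˢ Set.Icc (-3) 3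

/-- The box that carries the tangle. -/
def tangleBox : Set (ℝ × ℝ) := Set.Icc (-1) 1 ×ˢ Set.Icc (-2) 2

/-- Two straight strands crossing at `(-2, 0)` that join the points `(-3, ±1)` to the points
`(-1, ∓1)`. -/
def leftCrossing : Set (ℝ × ℝ) := {p | p.1 ∈ Set.Icc (-3) (-1) ∧ |p.2| = |p.1 + 2|}

/-- Two parallel strands joining the points `(-3, ±1)` to the points `(-1, ±1)`. -/
def leftParallel : Set (ℝ × ℝ) := {p | p.1 ∈ Set.Icc (-3) (-1) ∧ |p.2| = 1}

/-- Two straight strands crossing at `(2, 0)` that join the points `(1, ±1)` to the points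
`(3, ∓1)`. -/
def rightCrossing : Set (ℝ × ℝ) := {p | p.1 ∈ Set.Icc 1 3 ∧ |p.2| = |p.1 - 2|}

/-- Two parallel strands joining the points `(1, ±1)` to the points `(3, ±1)`. -/
def rightParallel : Set (ℝ × ℝ) := {p | p.1 ∈ Set.Icc 1 3 ∧ |p.2| = 1}

/-- The projection of the rotation of the tangle by the angle `π` about the horizontal axis. -/
def tangleFlip (p : ℝ × ℝ) : ℝ × ℝ := (p.1, -p.2)

/-- The four end points of the tangle. -/
def tangleEnds : Set (ℝ × ℝ) := {p | |p.1| = 1 ∧ |p.2| = 1}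

/-- The four end points of the local picture. -/
def boxEnds : Set (ℝ × ℝ) := {p | |p.1| = 3 ∧ |p.2| = 1}

/-- `P'` is obtained from `P` by a flype. Here `e` places the planar picture on the sphere; in the
picture `P` consists of a crossing, a tangle `T` to the right of it, and two parallel strands,
and `P'` consists of two parallel strands, the flipped tangle, and a crossing to the right of it.
Outside the picture `P` and `P'` agree. The four end points of the tangle and of the whole picture
are not double points. Knot projections are considered up to a homeomorphism `φ` of the sphere. -/
def IsFlype (P P' : KnotProjection) : Prop :=
  ∃ (e : ℝ × ℝ → Sphere2) (φ : Sphere2 ≃ₜ Sphere2) (T : Set (ℝ × ℝ)),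
    IsOpenEmbedding e ∧
    T ⊆ tangleBox ∧ T ∩ frontier tangleBox = tangleEnds ∧
    e ⁻¹' P.image ∩ flypeBox = leftCrossing ∪ T ∪ rightParallel ∧
    e ⁻¹' (φ '' P'.image) ∩ flypeBox = leftParallel ∪ tangleFlip '' T ∪ rightCrossing ∧
    P.image \ (e '' flypeBox) = (φ '' P'.image) \ (e '' flypeBox) ∧
    ∀ p ∈ tangleEnds ∪ boxEnds, e p ∉ P.doublePoints ∧ e p ∉ φ '' P'.doublePoints

/-!
The five counts depend only on the intersection graph of the chord diagram: the types are the
induced subgraphs `K₂`, `K₃`, `P₃`, `K₁,₃` and `C₄`, and each of these graphs is the intersection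
graph of only one type of chord diagram (`ChordDiagram.counts_eq_of_bijOn`). So it is enough to
find a bijection between the chords of the two projections that preserves crossing.

A flype moves the tangle from one side of a crossing to the other. All other double points persist,
and the chord `s(a, a')` of the old crossing is replaced by the chord `s(b, b')` of the new one.
Here `b` and `b'` are the parameters of the points of the two parallel strands over which the new
crossing is created. The two chords cross the same other chords. Colour the parameters of the old
curve by whether the curve runs between the vertical lines through the old and the new crossing. The
colour changes exactly at `a`, `a'`, `b` and `b'`, and it depends only on the point of the surface,
so that the two end points of any other chord have the same colour. Hence an even number of the
points `a`, `a'`, `b`, `b'` lies between them, and such a chord crosses `s(a, a')` iff it crosses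
`s(b, b')` (`crosses_iff_crosses_of_colouring`, `IsFlypePicture.crosses_iff_crosses`). No planarity
beyond this local picture is used.

The definition of a flype speaks of images of curves only, so the parametrisation of the new
projection has to be compared with that of the old one. The planar map `(x, y) ↦ (x, k x * y)`, with
`k = flypeFactor`, carries the old picture to the new one. It reflects the tangle, where `k = -1`,
in the horizontal axis, resolves the old crossing by a pole of `k`, and creates the new one
by a zero of `k`. Composing the old curve with this map gives a parametrised curve
`IsFlypePicture.flypeCurve` whose image is that of the new projection. It may have corners, so it is
compared with the new projection as a topological curve. A curve is called generic
(`IsGenericCurve`) if its only multiple points are finitely many double points at which, in a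
topological chart, the two branches are the two coordinate axes. By the inverse function theorem
knot projections are generic curves (`KnotProjection.isGenericCurve`). Two generic curves with the
same image differ by a homeomorphism of the circle (`IsGenericCurve.exists_homeomorph`): a local
homeomorphism of the plane that preserves the union of the axes maps each axis into an axis
(`axes_preserved`), so that the image determines the two branches at a double point. Homeomorphisms
of the circle preserve crossing of chords (`crosses_map_homeomorph`).
-/

/-! ### Crossing chords of the circle -/

theorem coe_unitAddCircle_eq_iff {x y : ℝ} :
    (x : UnitAddCircle) = (y : UnitAddCircle) ↔ ∃ n : ℤ, y = x + n := by
  rw [eq_comm, ← sub_eq_zero, ← AddCircle.coe_sub, AddCircle.coe_eq_zero_iff]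
  simp only [zsmul_eq_mul, mul_one]
  exact exists_congr fun n => ⟨fun h => by linarith, fun h => by linarith⟩

theorem exists_unitAddCircle_lift (r : ℝ) (a : UnitAddCircle) :
    ∃ x : ℝ, r ≤ x ∧ x < r + 1 ∧ (x : UnitAddCircle) = a := by
  have h : a ∈ ((↑) : ℝ → UnitAddCircle) '' Set.Ico r (r + 1) := by
    rw [AddCircle.coe_image_Ico_eq]; trivial
  obtain ⟨x, hx, rfl⟩ := h
  exact ⟨x, hx.1, hx.2, rfl⟩

theorem coe_unitAddCircle_injOn {r x y : ℝ} (hx : r ≤ x) (hx' : x < r + 1) (hy : r ≤ y)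
    (hy' : y < r + 1) (h : (x : UnitAddCircle) = (y : UnitAddCircle)) : x = y :=
  (AddCircle.coe_eq_coe_iff_of_mem_Ico (a := r) ⟨hx, hx'⟩ ⟨hy, hy'⟩).1 h

theorem coe_add_one_unitAddCircle (x : ℝ) : ((x + 1 : ℝ) : UnitAddCircle) = x :=
  AddCircle.coe_add_period 1 x

/-- Two chords of the circle cross: their end points are distinct and alternate. -/
def Crosses (c d : Sym2 UnitAddCircle) : Prop :=
  ∃ a b x y : ℝ, a < x ∧ x < b ∧ b < y ∧ y < a + 1 ∧
    c = s((a : UnitAddCircle), (b : UnitAddCircle)) ∧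
    d = s((x : UnitAddCircle), (y : UnitAddCircle))

theorem Crosses.symm {c d : Sym2 UnitAddCircle} (h : Crosses c d) : Crosses d c := by
  obtain ⟨a, b, x, y, h1, h2, h3, h4, rfl, rfl⟩ := h
  refine ⟨x, y, b, a + 1, h2, h3, h4, by linarith, rfl, ?_⟩
  rw [coe_add_one_unitAddCircle, Sym2.eq_swap]

theorem crosses_comm {c d : Sym2 UnitAddCircle} : Crosses c d ↔ Crosses d c :=
  ⟨Crosses.symm, Crosses.symm⟩

/-- The chords that cross `s(a, b)` have one end point on each of the two arcs. -/
theorem crosses_iff_exists {a b : ℝ} (hab : a < b) (hb : b < a + 1) {d : Sym2 UnitAddCircle} :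
    Crosses s((a : UnitAddCircle), (b : UnitAddCircle)) d ↔
      ∃ x y : ℝ, a < x ∧ x < b ∧ b < y ∧ y < a + 1 ∧
        d = s((x : UnitAddCircle), (y : UnitAddCircle)) := by
  constructor
  · rintro ⟨a', b', x, y, h1, h2, h3, h4, hc, rfl⟩
    have key : ∀ a' b' x y : ℝ, a' < x → x < b' → b' < y → y < a' + 1 →
        (a : UnitAddCircle) = a' → (b : UnitAddCircle) = b' →
        ∃ x' y' : ℝ, a < x' ∧ x' < b ∧ b < y' ∧ y' < a + 1 ∧
          s((x : UnitAddCircle), (y : UnitAddCircle)) =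
            s((x' : UnitAddCircle), (y' : UnitAddCircle)) := by
      intro a' b' x y h1 h2 h3 h4 ha hb'
      obtain ⟨n, hn⟩ := coe_unitAddCircle_eq_iff.1 ha
      have hbb : b' - n = b := by
        refine coe_unitAddCircle_injOn (r := a) (by linarith) (by linarith) (by linarith)
          (by linarith) ?_
        rw [hb']
        exact coe_unitAddCircle_eq_iff.2 ⟨n, by ring⟩
      refine ⟨x - n, y - n, by linarith, by linarith, by linarith, by linarith, ?_⟩
      rw [(coe_unitAddCircle_eq_iff (x := x) (y := x - n)).2 ⟨-n, by push_cast; ring⟩,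
        (coe_unitAddCircle_eq_iff (x := y) (y := y - n)).2 ⟨-n, by push_cast; ring⟩]
    rcases Sym2.eq_iff.1 hc with ⟨ha, hb'⟩ | ⟨ha, hb'⟩
    · exact key a' b' x y h1 h2 h3 h4 ha hb'
    · obtain ⟨x', y', k1, k2, k3, k4, k5⟩ := key b' (a' + 1) y (x + 1) h3 h4 (by linarith)
        (by linarith) ha (by rw [hb', coe_add_one_unitAddCircle])
      refine ⟨x', y', k1, k2, k3, k4, ?_⟩
      rw [← k5, coe_add_one_unitAddCircle, Sym2.eq_swap]
  · rintro ⟨x, y, h1, h2, h3, h4, rfl⟩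
    exact ⟨a, b, x, y, h1, h2, h3, h4, rfl, rfl⟩

/-- Chords whose end points are lifted to one fundamental domain cross exactly if the lifts
interleave. -/
theorem crosses_iff_interleave {r p q p' q' : ℝ} (hp : r ≤ p) (hpq : p < q) (hq : q < r + 1)
    (hp' : r ≤ p') (hpq' : p' < q') (hq' : q' < r + 1) :
    Crosses s((p : UnitAddCircle), (q : UnitAddCircle))
        s((p' : UnitAddCircle), (q' : UnitAddCircle)) ↔
      (p < p' ∧ p' < q ∧ q < q') ∨ (p' < p ∧ p < q' ∧ q' < q) := by
  constructor
  · rw [crosses_iff_exists hpq (by linarith)]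
    rintro ⟨x, y, h1, h2, h3, h4, h5⟩
    have lift : ∀ u v : ℝ, r ≤ u → u < r + 1 → p < v → v < p + 1 →
        (u : UnitAddCircle) = v → (v = u ∨ v = u + 1) := by
      intro u v hu hu' hv hv' huv
      obtain ⟨n, hn⟩ := coe_unitAddCircle_eq_iff.1 huv
      have l1 : (-1 : ℝ) < n := by linarith
      have l2 : (n : ℝ) < 2 := by linarith
      have l1' : -1 < n := by exact_mod_cast l1
      have l2' : n < 2 := by exact_mod_cast l2
      have : n = 0 ∨ n = 1 := by omega
      rcases this with rfl | rfl <;> simp [hn]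
    rcases Sym2.eq_iff.1 h5 with ⟨e1, e2⟩ | ⟨e1, e2⟩
    · rcases lift p' x hp' (by linarith) h1 (by linarith) e1 with f1 | f1 <;>
      rcases lift q' y (by linarith) (by linarith) (by linarith) h4 e2 with f2 | f2
      · left; subst f1 f2; exact ⟨h1, h2, h3⟩
      all_goals exfalso; linarith
    · rcases lift p' y hp' (by linarith) (by linarith) h4 e1 with f1 | f1 <;>
      rcases lift q' x (by linarith) (by linarith) (by linarith) (by linarith) e2 with f2 | f2
      · exfalso; linarith
      · exfalso; linarith
      · right; subst f2; exact ⟨by linarith, h1, h2⟩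
      · exfalso; linarith
  · rintro (⟨h1, h2, h3⟩ | ⟨h1, h2, h3⟩)
    · exact ⟨p, q, p', q', h1, h2, h3, by linarith, rfl, rfl⟩
    · exact Crosses.symm ⟨p', q', p, q, h1, h2, h3, by linarith, rfl, rfl⟩

/-! ### Types of chord diagrams and their intersection graphs -/

/-- The letters of the word `w` are indexed by `Fin k`, and the letter `l` stands exactly at the
positions `p l < q l`. -/
structure IsDoubleOccurrence {m k : ℕ} (w : Fin m → ℕ) (p q : Fin k → Fin m) : Prop where
  lt : ∀ l, p l < q l
  letter : ∀ l, w (p l) = w (q l)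
  cover : ∀ i j, i < j → w i = w j → ∃ l, i = p l ∧ j = q l
  inj : ∀ l l', p l = p l' → l = l'
  ne : ∀ l l', p l ≠ q l'

/-- The letters `l` and `l'` alternate in the word in which they stand at the positions
`p` and `q`. -/
def Interleave {m k : ℕ} (p q : Fin k → Fin m) (l l' : Fin k) : Prop :=
  (p l < p l' ∧ p l' < q l ∧ q l < q l') ∨ (p l' < p l ∧ p l < q l' ∧ q l' < q l)

/-- The chords `f l` are distinct chords of `D` and cross as the letters of a word
with positions `p` and `q` alternate. -/
structure ChordDiagram.Realizes (D : ChordDiagram) {m k : ℕ} (p q : Fin k → Fin m)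
    (f : Fin k → Sym2 UnitAddCircle) : Prop where
  inj : Function.Injective f
  mem : ∀ l, f l ∈ D.chords
  crosses : ∀ l l', l ≠ l' → (Crosses (f l) (f l') ↔ Interleave p q l l')

theorem isOfType_iff_range {m k : ℕ} {w : Fin m → ℕ} {p q : Fin k → Fin m}
    (hw : IsDoubleOccurrence w p q) (S : Set (Sym2 UnitAddCircle)) :
    IsOfType w S ↔ ∃ t : Fin m → ℝ, StrictMono t ∧ (∀ i j, t i < t j + 1) ∧
      S = Set.range fun l => s((t (p l) : UnitAddCircle), (t (q l) : UnitAddCircle)) := by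
  have key : ∀ t : Fin m → ℝ,
      {c | ∃ i j, i ≠ j ∧ w i = w j ∧ c = s((t i : UnitAddCircle), (t j : UnitAddCircle))} =
        Set.range fun l => s((t (p l) : UnitAddCircle), (t (q l) : UnitAddCircle)) := by
    intro t
    ext c
    constructor
    · rintro ⟨i, j, hij, hwij, rfl⟩
      rcases lt_or_gt_of_ne hij with h | h
      · obtain ⟨l, rfl, rfl⟩ := hw.cover i j h hwij
        exact ⟨l, rfl⟩
      · obtain ⟨l, rfl, rfl⟩ := hw.cover j i h hwij.symm
        exact ⟨l, Sym2.eq_swap⟩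
    · rintro ⟨l, rfl⟩
      exact ⟨p l, q l, (hw.lt l).ne, hw.letter l, rfl⟩
  unfold IsOfType
  simp only [key]

/-- Sub-chord diagrams of the type of `w` have the intersection graph of `w`. -/
theorem ChordDiagram.exists_realizes {D : ChordDiagram} {m k : ℕ} {w : Fin m → ℕ}
    {p q : Fin k → Fin m} (hw : IsDoubleOccurrence w p q) {S : Set (Sym2 UnitAddCircle)}
    (hS : S ⊆ D.chords) (h : IsOfType w S) : ∃ f, D.Realizes p q f ∧ Set.range f = S := by
  obtain ⟨t, ht, htt, rfl⟩ := (isOfType_iff_range hw S).1 h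
  refine ⟨_, ⟨?_, fun l => hS ⟨l, rfl⟩, ?_⟩, rfl⟩
  · intro l l' hl
    have hinj : ∀ i j, (t i : UnitAddCircle) = t j → i = j := by
      intro i j hij
      rcases le_total (t i) (t j) with h | h
      · exact ht.injective (coe_unitAddCircle_injOn le_rfl (by linarith) h (htt _ _) hij)
      · exact ht.injective (coe_unitAddCircle_injOn h (htt _ _) le_rfl (by linarith) hij)
    rcases Sym2.eq_iff.1 hl with ⟨h1, -⟩ | ⟨h1, -⟩
    · exact hw.inj _ _ (hinj _ _ h1)
    · exact absurd (hinj _ _ h1) (hw.ne _ _)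
  · intro l l' hl
    have hm : 0 < m := (Nat.zero_le _).trans_lt (p l).2
    have h0 : ∀ i, t ⟨0, hm⟩ ≤ t i := fun i => ht.monotone (Fin.le_def.2 (Nat.zero_le _))
    rw [crosses_iff_interleave (h0 _) (ht (hw.lt l)) (htt _ _) (h0 _) (ht (hw.lt l')) (htt _ _)]
    simp only [ht.lt_iff_lt, Interleave]

/-- If the type of `w` is determined by its intersection graph, then the number of sub-chord
diagrams of this type depends only on the intersection graph of the chord diagram. -/
theorem ChordDiagram.count_eq_of_bijOn {D D' : ChordDiagram}
    {θ : Sym2 UnitAddCircle → Sym2 UnitAddCircle} (hθ : Set.BijOn θ D.chords D'.chords)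
    (hcr : ∀ c ∈ D.chords, ∀ d ∈ D.chords, c ≠ d → (Crosses (θ c) (θ d) ↔ Crosses c d))
    {m k : ℕ} {w : Fin m → ℕ} {p q : Fin k → Fin m} (hw : IsDoubleOccurrence w p q)
    (hreal : ∀ (D : ChordDiagram) f, D.Realizes p q f → IsOfType w (Set.range f)) :
    D.count w = D'.count w := by
  unfold ChordDiagram.count
  have himage : {S | S ⊆ D'.chords ∧ IsOfType w S} =
      (fun S => θ '' S) '' {S | S ⊆ D.chords ∧ IsOfType w S} := by
    ext S
    constructor
    · rintro ⟨hS, hT⟩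
      obtain ⟨f, hf, rfl⟩ := ChordDiagram.exists_realizes hw hS hT
      choose g hg hgf using fun l => hθ.surjOn (hf.mem l)
      have hg' : D.Realizes p q g := by
        refine ⟨fun l l' h => hf.inj ?_, hg, fun l l' h => ?_⟩
        · rw [← hgf l, ← hgf l', h]
        · rw [← hf.crosses l l' h, ← hgf l, ← hgf l', hcr _ (hg l) _ (hg l')]
          intro he
          exact h (hf.inj (by rw [← hgf l, ← hgf l', he]))
      refine ⟨Set.range g, ⟨?_, hreal D g hg'⟩, ?_⟩
      · rintro _ ⟨l, rfl⟩
        exact hg l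
      · dsimp only
        rw [← Set.range_comp]
        exact congrArg Set.range (funext hgf)
    · rintro ⟨S, ⟨hS, hT⟩, rfl⟩
      obtain ⟨f, hf, rfl⟩ := ChordDiagram.exists_realizes hw hS hT
      have hg' : D'.Realizes p q (θ ∘ f) := by
        refine ⟨fun l l' h => hf.inj (hθ.injOn (hf.mem l) (hf.mem l') h),
          fun l => hθ.mapsTo (hf.mem l), fun l l' h => ?_⟩
        rw [← hf.crosses l l' h]
        exact hcr _ (hf.mem l) _ (hf.mem l') (fun he => h (hf.inj he))
      refine ⟨(Set.image_subset_iff).2 fun c hc => hθ.mapsTo (hS hc), ?_⟩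
      dsimp only
      rw [← Set.range_comp]
      exact hreal D' _ hg'
  rw [himage, Set.InjOn.ncard_image]
  rintro S ⟨hS, -⟩ S' ⟨hS', -⟩ h
  exact hθ.injOn.image_eq_image_iff hS hS' |>.1 h

theorem lt_add_one_of_strictMono {m : ℕ} {t : Fin (m + 1) → ℝ} (ht : StrictMono t)
    (h : t (Fin.last m) < t 0 + 1) (i j : Fin (m + 1)) : t i < t j + 1 := by
  have h1 := ht.monotone (Fin.le_last i)
  have h2 := ht.monotone (Fin.zero_le j)
  linarith

theorem ChordDiagram.Realizes.not_mem {D : ChordDiagram} {m k : ℕ} {p q : Fin k → Fin m}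
    {f : Fin k → Sym2 UnitAddCircle} (hf : D.Realizes p q f) {l l' : Fin k} (h : l ≠ l')
    {x : UnitAddCircle} (hx : x ∈ f l) : x ∉ f l' := fun hx' =>
  h (hf.inj (D.disjoint _ (hf.mem l) _ (hf.mem l') x hx hx'))

/-! ### The five types are determined by their intersection graphs -/

theorem isOfType_crossChord {c d : Sym2 UnitAddCircle} (h : Crosses c d) :
    IsOfType crossChord {c, d} := by
  obtain ⟨a, b, x, y, h1, h2, h3, h4, rfl, rfl⟩ := h
  rw [isOfType_iff_range (k := 2) (p := ![0, 1]) (q := ![2, 3])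
    ⟨by decide, by decide, by decide, by decide, by decide⟩]
  have ht : StrictMono ![a, x, b, y] := by
    rw [Fin.strictMono_iff_lt_succ]; simp [Fin.forall_fin_succ, *]
  refine ⟨_, ht, lt_add_one_of_strictMono ht (by simpa using h4), ?_⟩
  ext e
  simp [Fin.exists_fin_succ, eq_comm]

theorem isOfType_tripleChord {c d e : Sym2 UnitAddCircle} (h : Crosses c d) (h' : Crosses c e)
    (h'' : Crosses d e) : IsOfType tripleChord {c, d, e} := by
  -- the case in which the end point of `d` on the first arc of `c` comes first
  have key : ∀ a b x y x' y' : ℝ, a < x → x < b → b < y → y < a + 1 →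
      a < x' → x' < b → b < y' → y' < a + 1 →
      x < x' → y < y' → IsOfType tripleChord {s((a : UnitAddCircle), (b : UnitAddCircle)),
        s((x : UnitAddCircle), (y : UnitAddCircle)),
        s((x' : UnitAddCircle), (y' : UnitAddCircle))} := by
    intro a b x y x' y' h1 h2 h3 h4 k1 k2 k3 k4 l1 l2
    rw [isOfType_iff_range (k := 3) (p := ![0, 1, 2]) (q := ![3, 4, 5])
      ⟨by decide, by decide, by decide, by decide, by decide⟩]
    have ht : StrictMono ![a, x, x', b, y, y'] := by
      rw [Fin.strictMono_iff_lt_succ]; simp [Fin.forall_fin_succ, *]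
    refine ⟨_, ht, lt_add_one_of_strictMono ht (by simpa using k4), ?_⟩
    ext e
    simp [Fin.exists_fin_succ, eq_comm]
  obtain ⟨a, b, x, y, h1, h2, h3, h4, rfl, rfl⟩ := h
  obtain ⟨x', y', k1, k2, k3, k4, rfl⟩ := (crosses_iff_exists (by linarith) (by linarith)).1 h'
  rcases (crosses_iff_interleave (r := a) (by linarith) (by linarith) (by linarith) (by linarith)
    (by linarith) (by linarith)).1 h'' with ⟨l1, -, l2⟩ | ⟨l1, -, l2⟩
  · exact key a b x y x' y' h1 h2 h3 h4 k1 k2 k3 k4 l1 l2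
  · have := key a b x' y' x y k1 k2 k3 k4 h1 h2 h3 h4 l1 l2
    rwa [Set.pair_comm] at this

/-- Two disjoint chords that cross `s(a, b)` but not each other are nested over `b`. -/
theorem lt_of_not_crosses {a b x y x' y' : ℝ} (h1 : a < x) (h3 : b < y)
    (k2 : x' < b) (k4 : y' < a + 1)
    (hn : ¬ Crosses s((x : UnitAddCircle), (y : UnitAddCircle))
      s((x' : UnitAddCircle), (y' : UnitAddCircle)))
    (hy : (y : UnitAddCircle) ≠ y') (hlt : x < x') : y' < y := by
  by_contra hle
  rcases eq_or_lt_of_le (not_lt.1 hle) with h | h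
  · exact hy (by rw [h])
  · exact hn ((crosses_iff_interleave (r := a) (by linarith) (by linarith) (by linarith)
      (by linarith) (by linarith) (by linarith)).2 (Or.inl ⟨hlt, by linarith, h⟩))

theorem isOfType_hChord {c d e : Sym2 UnitAddCircle} (h : Crosses c d) (h' : Crosses c e)
    (h'' : ¬ Crosses d e) (hde : ∀ x, x ∈ d → x ∉ e) : IsOfType hChord {c, d, e} := by
  have key : ∀ a b x y x' y' : ℝ, a < x → x < b → b < y → y < a + 1 →
      a < x' → x' < b → b < y' → y' < a + 1 →
      x < x' → y' < y → IsOfType hChord {s((a : UnitAddCircle), (b : UnitAddCircle)),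
        s((x : UnitAddCircle), (y : UnitAddCircle)),
        s((x' : UnitAddCircle), (y' : UnitAddCircle))} := by
    intro a b x y x' y' h1 h2 h3 h4 k1 k2 k3 k4 l1 l2
    rw [isOfType_iff_range (k := 3) (p := ![0, 1, 2]) (q := ![3, 5, 4])
      ⟨by decide, by decide, by decide, by decide, by decide⟩]
    have ht : StrictMono ![a, x, x', b, y', y] := by
      rw [Fin.strictMono_iff_lt_succ]; simp [Fin.forall_fin_succ, *]
    refine ⟨_, ht, lt_add_one_of_strictMono ht (by simpa using h4), ?_⟩
    ext e
    simp [Fin.exists_fin_succ, eq_comm]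
  obtain ⟨a, b, x, y, h1, h2, h3, h4, rfl, rfl⟩ := h
  obtain ⟨x', y', k1, k2, k3, k4, rfl⟩ := (crosses_iff_exists (by linarith) (by linarith)).1 h'
  have hx : (x : UnitAddCircle) ≠ x' := fun he => hde x (by simp) (by simp [he])
  have hy : (y : UnitAddCircle) ≠ y' := fun he => hde y (by simp) (by simp [he])
  rcases lt_trichotomy x x' with hlt | rfl | hlt
  · exact key a b x y x' y' h1 h2 h3 h4 k1 k2 k3 k4 hlt
      (lt_of_not_crosses h1 h3 k2 k4 h'' hy hlt)
  · exact absurd rfl hx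
  · have := key a b x' y' x y k1 k2 k3 k4 h1 h2 h3 h4 hlt
      (lt_of_not_crosses k1 k3 h2 h4 (fun h => h'' h.symm) hy.symm hlt)
    rwa [Set.pair_comm] at this

theorem isOfType_threeChord {c d e g : Sym2 UnitAddCircle} (hd : Crosses c d) (he : Crosses c e)
    (hg : Crosses c g) (hde : ¬ Crosses d e) (hdg : ¬ Crosses d g) (heg : ¬ Crosses e g)
    (hde' : ∀ x, x ∈ d → x ∉ e) (hdg' : ∀ x, x ∈ d → x ∉ g) (heg' : ∀ x, x ∈ e → x ∉ g) :
    IsOfType threeChord {c, d, e, g} := by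
  obtain ⟨a, b, x₁, y₁, h1, h2, h3, h4, rfl, rfl⟩ := hd
  obtain ⟨x₂, y₂, k1, k2, k3, k4, rfl⟩ := (crosses_iff_exists (by linarith) (by linarith)).1 he
  obtain ⟨x₃, y₃, l1, l2, l3, l4, rfl⟩ := (crosses_iff_exists (by linarith) (by linarith)).1 hg
  have key : ∀ x₁ y₁ x₂ y₂ x₃ y₃ : ℝ, a < x₁ → x₁ < x₂ → x₂ < x₃ → x₃ < b → b < y₃ → y₃ < y₂ →
      y₂ < y₁ → y₁ < a + 1 → IsOfType threeChord {s((a : UnitAddCircle), (b : UnitAddCircle)),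
        s((x₁ : UnitAddCircle), (y₁ : UnitAddCircle)),
        s((x₂ : UnitAddCircle), (y₂ : UnitAddCircle)),
        s((x₃ : UnitAddCircle), (y₃ : UnitAddCircle))} := by
    intro x₁ y₁ x₂ y₂ x₃ y₃ h1 h2 h3 h4 h5 h6 h7 h8
    rw [isOfType_iff_range (k := 4) (p := ![0, 1, 2, 3]) (q := ![4, 7, 6, 5])
      ⟨by decide, by decide, by decide, by decide, by decide⟩]
    have ht : StrictMono ![a, x₁, x₂, x₃, b, y₃, y₂, y₁] := by
      rw [Fin.strictMono_iff_lt_succ]; simp [Fin.forall_fin_succ, *]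
    refine ⟨_, ht, lt_add_one_of_strictMono ht (by simpa using h8), ?_⟩
    ext e
    simp [Fin.exists_fin_succ, eq_comm]
  have n12 : x₁ ≠ x₂ := by rintro rfl; exact hde' x₁ (by simp) (by simp)
  have n13 : x₁ ≠ x₃ := by rintro rfl; exact hdg' x₁ (by simp) (by simp)
  have n23 : x₂ ≠ x₃ := by rintro rfl; exact heg' x₂ (by simp) (by simp)
  have m12 : (y₁ : UnitAddCircle) ≠ y₂ := fun h => hde' y₁ (by simp) (by simp [h])
  have m13 : (y₁ : UnitAddCircle) ≠ y₃ := fun h => hdg' y₁ (by simp) (by simp [h])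
  have m23 : (y₂ : UnitAddCircle) ≠ y₃ := fun h => heg' y₂ (by simp) (by simp [h])
  have f12 := lt_of_not_crosses h1 h3 k2 k4 hde m12
  have f21 := lt_of_not_crosses k1 k3 h2 h4 (fun h => hde h.symm) m12.symm
  have f13 := lt_of_not_crosses h1 h3 l2 l4 hdg m13
  have f31 := lt_of_not_crosses l1 l3 h2 h4 (fun h => hdg h.symm) m13.symm
  have f23 := lt_of_not_crosses k1 k3 l2 l4 heg m23
  have f32 := lt_of_not_crosses l1 l3 k2 k4 (fun h => heg h.symm) m23.symm
  rcases lt_or_gt_of_ne n12 with i | i <;> rcases lt_or_gt_of_ne n13 with j | j <;>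
    rcases lt_or_gt_of_ne n23 with k | k
  · exact key x₁ y₁ x₂ y₂ x₃ y₃ h1 i k l2 l3 (f23 k) (f12 i) h4
  · rw [Set.pair_comm]
    exact key x₁ y₁ x₃ y₃ x₂ y₂ h1 j k k2 k3 (f32 k) (f13 j) h4
  · exfalso; linarith
  · rw [Set.pair_comm, Set.insert_comm s((x₁ : UnitAddCircle), (y₁ : UnitAddCircle))]
    exact key x₃ y₃ x₁ y₁ x₂ y₂ l1 j i k2 k3 (f12 i) (f31 j) l4
  · rw [Set.insert_comm s((x₁ : UnitAddCircle), (y₁ : UnitAddCircle))]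
    exact key x₂ y₂ x₁ y₁ x₃ y₃ k1 i j l2 l3 (f13 j) (f21 i) k4
  · exfalso; linarith
  · rw [Set.insert_comm s((x₁ : UnitAddCircle), (y₁ : UnitAddCircle)),
      Set.pair_comm s((x₁ : UnitAddCircle), (y₁ : UnitAddCircle))]
    exact key x₂ y₂ x₃ y₃ x₁ y₁ k1 k j h2 h3 (f31 j) (f23 k) k4
  · rw [Set.pair_comm, Set.insert_comm s((x₁ : UnitAddCircle), (y₁ : UnitAddCircle)),
      Set.pair_comm s((x₁ : UnitAddCircle), (y₁ : UnitAddCircle))]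
    exact key x₃ y₃ x₂ y₂ x₁ y₁ l1 k i h2 h3 (f21 i) (f32 k) l4

theorem isOfType_hhChord {c d e g : Sym2 UnitAddCircle} (hcd : ¬ Crosses c d) (hce : Crosses c e)
    (hcg : Crosses c g) (hde : Crosses d e) (hdg : Crosses d g) (heg : ¬ Crosses e g)
    (hd : ¬ d.IsDiag) (hcd' : ∀ x, x ∈ c → x ∉ d) (heg' : ∀ x, x ∈ e → x ∉ g) :
    IsOfType hhChord {c, d, e, g} := by
  have key : ∀ a b x y x' y' p q : ℝ, a < p → p < x → x < x' → x' < q → q < b → b < y' → y' < y →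
      y < a + 1 → IsOfType hhChord {s((a : UnitAddCircle), (b : UnitAddCircle)),
        s((p : UnitAddCircle), (q : UnitAddCircle)),
        s((x : UnitAddCircle), (y : UnitAddCircle)),
        s((x' : UnitAddCircle), (y' : UnitAddCircle))} := by
    intro a b x y x' y' p q h1 h2 h3 h4 h5 h6 h7 h8
    rw [isOfType_iff_range (k := 4) (p := ![0, 1, 2, 3]) (q := ![5, 4, 7, 6])
      ⟨by decide, by decide, by decide, by decide, by decide⟩]
    have ht : StrictMono ![a, p, x, x', q, b, y', y] := by
      rw [Fin.strictMono_iff_lt_succ]; simp [Fin.forall_fin_succ, *]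
    refine ⟨_, ht, lt_add_one_of_strictMono ht (by simpa using h8), ?_⟩
    ext e
    simp [Fin.exists_fin_succ, eq_comm]
  -- the case in which both end points of `d` lie on the arc from `a` to `b`
  have nested : ∀ a b p q : ℝ, a < p → p < q → q < b → b < a + 1 →
      c = s((a : UnitAddCircle), (b : UnitAddCircle)) →
      d = s((p : UnitAddCircle), (q : UnitAddCircle)) → IsOfType hhChord {c, d, e, g} := by
    rintro a b p q h1 h2 h3 h4 rfl rfl
    obtain ⟨x, y, k1, k2, k3, k4, rfl⟩ := (crosses_iff_exists (by linarith) (by linarith)).1 hce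
    obtain ⟨x', y', l1, l2, l3, l4, rfl⟩ := (crosses_iff_exists (by linarith) (by linarith)).1 hcg
    have hx : x ≠ x' := by rintro rfl; exact heg' x (by simp) (by simp)
    have hy : (y : UnitAddCircle) ≠ y' := fun h => heg' y (by simp) (by simp [h])
    have i1 := (crosses_iff_interleave (r := a) (by linarith) (by linarith) (by linarith)
      (by linarith) (by linarith) (by linarith)).1 hde
    have i2 := (crosses_iff_interleave (r := a) (by linarith) (by linarith) (by linarith)
      (by linarith) (by linarith) (by linarith)).1 hdg
    have i1' : p < x ∧ x < q := by
      rcases i1 with i | i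
      · exact ⟨i.1, i.2.1⟩
      · exfalso; linarith
    have i2' : p < x' ∧ x' < q := by
      rcases i2 with i | i
      · exact ⟨i.1, i.2.1⟩
      · exfalso; linarith
    rcases lt_or_gt_of_ne hx with i | i
    · exact key a b x y x' y' p q h1 i1'.1 i i2'.2 h3 l3
        (lt_of_not_crosses k1 k3 l2 l4 heg hy i) k4
    · rw [Set.pair_comm]
      exact key a b x' y' x y p q h1 i2'.1 i i1'.2 h3 k3
        (lt_of_not_crosses l1 l3 k2 k4 (fun h => heg h.symm) hy.symm i) l4
  obtain ⟨a, b, x, y, h1, h2, h3, h4, hc, -⟩ := hce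
  obtain ⟨p, q, hp, hpq, hq, hdpq⟩ : ∃ p q : ℝ, a ≤ p ∧ p < q ∧ q < a + 1 ∧
      d = s((p : UnitAddCircle), (q : UnitAddCircle)) := by
    induction d using Sym2.ind with
    | _ u v =>
    have huv : u ≠ v := by simpa using hd
    obtain ⟨p, p1, p2, rfl⟩ := exists_unitAddCircle_lift a u
    obtain ⟨q, q1, q2, rfl⟩ := exists_unitAddCircle_lift a v
    have hpq : p ≠ q := by rintro rfl; exact huv rfl
    rcases lt_or_gt_of_ne hpq with h | h
    · exact ⟨p, q, p1, h, q2, rfl⟩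
    · exact ⟨q, p, q1, h, p2, Sym2.eq_swap⟩
  have e1 : p ≠ a := by rintro rfl; exact hcd' p (by simp [hc]) (by simp [hdpq])
  have e2 : p ≠ b := by rintro rfl; exact hcd' p (by simp [hc]) (by simp [hdpq])
  have e3 : q ≠ b := by rintro rfl; exact hcd' q (by simp [hc]) (by simp [hdpq])
  have e4 : a < p := lt_of_le_of_ne hp e1.symm
  rw [hc, hdpq, crosses_iff_interleave (r := a) le_rfl (by linarith) (by linarith) hp hpq hq]
    at hcd
  push Not at hcd
  rcases lt_or_gt_of_ne e2 with i | i
  · exact nested a b p q e4 hpq (lt_of_le_of_ne (hcd.1 e4 i) e3) (by linarith) hc hdpq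
  · -- both end points of `d` lie on the other arc: the roles of `a` and `b` are exchanged
    exact nested b (a + 1) p q i hpq hq (by linarith)
      (by rw [hc, coe_add_one_unitAddCircle, Sym2.eq_swap]) hdpq

/-- All five counts depend only on the intersection graph of the chord diagram. -/
theorem ChordDiagram.counts_eq_of_bijOn {D D' : ChordDiagram}
    {θ : Sym2 UnitAddCircle → Sym2 UnitAddCircle} (hθ : Set.BijOn θ D.chords D'.chords)
    (hcr : ∀ c ∈ D.chords, ∀ d ∈ D.chords, c ≠ d → (Crosses (θ c) (θ d) ↔ Crosses c d)) :
    D.count crossChord = D'.count crossChord ∧ D.count tripleChord = D'.count tripleChord ∧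
      D.count hChord = D'.count hChord ∧ D.count threeChord = D'.count threeChord ∧
      D.count hhChord = D'.count hhChord := by
  refine ⟨?_, ?_, ?_, ?_, ?_⟩
  · refine ChordDiagram.count_eq_of_bijOn hθ hcr (k := 2) (p := ![0, 1]) (q := ![2, 3])
      ⟨by decide, by decide, by decide, by decide, by decide⟩ fun D f hf => ?_
    have := isOfType_crossChord ((hf.crosses 0 1 (by decide)).2 (by unfold Interleave; decide))
    convert this using 1
    ext e
    simp [Fin.exists_fin_succ, eq_comm]
  · refine ChordDiagram.count_eq_of_bijOn hθ hcr (k := 3) (p := ![0, 1, 2]) (q := ![3, 4, 5])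
      ⟨by decide, by decide, by decide, by decide, by decide⟩ fun D f hf => ?_
    have := isOfType_tripleChord
      ((hf.crosses 0 1 (by decide)).2 (by unfold Interleave; decide))
      ((hf.crosses 0 2 (by decide)).2 (by unfold Interleave; decide))
      ((hf.crosses 1 2 (by decide)).2 (by unfold Interleave; decide))
    convert this using 1
    ext e
    simp [Fin.exists_fin_succ, eq_comm]
  · refine ChordDiagram.count_eq_of_bijOn hθ hcr (k := 3) (p := ![0, 1, 2]) (q := ![3, 5, 4])
      ⟨by decide, by decide, by decide, by decide, by decide⟩ fun D f hf => ?_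
    have := isOfType_hChord
      ((hf.crosses 0 1 (by decide)).2 (by unfold Interleave; decide))
      ((hf.crosses 0 2 (by decide)).2 (by unfold Interleave; decide))
      ((hf.crosses 1 2 (by decide)).not.2 (by unfold Interleave; decide))
      (fun x => hf.not_mem (by decide))
    convert this using 1
    ext e
    simp [Fin.exists_fin_succ, eq_comm]
  · refine ChordDiagram.count_eq_of_bijOn hθ hcr (k := 4) (p := ![0, 1, 2, 3])
      (q := ![4, 7, 6, 5])
      ⟨by decide, by decide, by decide, by decide, by decide⟩ fun D f hf => ?_
    have := isOfType_threeChord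
      ((hf.crosses 0 1 (by decide)).2 (by unfold Interleave; decide))
      ((hf.crosses 0 2 (by decide)).2 (by unfold Interleave; decide))
      ((hf.crosses 0 3 (by decide)).2 (by unfold Interleave; decide))
      ((hf.crosses 1 2 (by decide)).not.2 (by unfold Interleave; decide))
      ((hf.crosses 1 3 (by decide)).not.2 (by unfold Interleave; decide))
      ((hf.crosses 2 3 (by decide)).not.2 (by unfold Interleave; decide))
      (fun x => hf.not_mem (by decide)) (fun x => hf.not_mem (by decide))
      (fun x => hf.not_mem (by decide))
    convert this using 1
    ext e
    simp [Fin.exists_fin_succ, eq_comm]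
  · refine ChordDiagram.count_eq_of_bijOn hθ hcr (k := 4) (p := ![0, 1, 2, 3])
      (q := ![5, 4, 7, 6])
      ⟨by decide, by decide, by decide, by decide, by decide⟩ fun D f hf => ?_
    have := isOfType_hhChord
      ((hf.crosses 0 1 (by decide)).not.2 (by unfold Interleave; decide))
      ((hf.crosses 0 2 (by decide)).2 (by unfold Interleave; decide))
      ((hf.crosses 0 3 (by decide)).2 (by unfold Interleave; decide))
      ((hf.crosses 1 2 (by decide)).2 (by unfold Interleave; decide))
      ((hf.crosses 1 3 (by decide)).2 (by unfold Interleave; decide))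
      ((hf.crosses 2 3 (by decide)).not.2 (by unfold Interleave; decide))
      (D.not_isDiag _ (hf.mem 1))
      (fun x => hf.not_mem (by decide)) (fun x => hf.not_mem (by decide))
    convert this using 1
    ext e
    simp [Fin.exists_fin_succ, eq_comm]

/-! ### Crossing chords and homeomorphisms of the circle -/

/-- The open arc of the circle that is the image of the interval from `a` to `b`. -/
def openArc (a b : ℝ) : Set UnitAddCircle := (fun x : ℝ => (x : UnitAddCircle)) '' Set.Ioo a b

theorem isOpen_openArc (a b : ℝ) : IsOpen (openArc a b) :=
  QuotientAddGroup.isOpenMap_coe _ isOpen_Ioo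

theorem isPreconnected_openArc (a b : ℝ) : IsPreconnected (openArc a b) :=
  isPreconnected_Ioo.image _ (AddCircle.continuous_mk' 1).continuousOn

theorem openArc_add_intCast (a b : ℝ) (n : ℤ) : openArc (a + n) (b + n) = openArc a b := by
  ext x
  constructor
  · rintro ⟨u, hu, rfl⟩
    exact ⟨u - n, ⟨by linarith [hu.1], by linarith [hu.2]⟩,
      coe_unitAddCircle_eq_iff.2 ⟨n, by ring⟩⟩
  · rintro ⟨u, hu, rfl⟩
    exact ⟨u + n, ⟨by linarith [hu.1], by linarith [hu.2]⟩,
      coe_unitAddCircle_eq_iff.2 ⟨-n, by push_cast; ring⟩⟩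

theorem disjoint_openArc {a b : ℝ} (hab : a < b) (hb : b < a + 1) :
    Disjoint (openArc a b) (openArc b (a + 1)) := by
  rw [Set.disjoint_left]
  rintro _ ⟨x, hx, rfl⟩ ⟨y, hy, hxy⟩
  have := coe_unitAddCircle_injOn (r := a) (by linarith [hy.1]) hy.2 hx.1.le
    (by linarith [hx.2]) hxy
  linarith [hx.2, hy.1]

theorem mem_openArc_or {a b : ℝ} {x : UnitAddCircle} (hxa : x ≠ a)
    (hxb : x ≠ b) : x ∈ openArc a b ∨ x ∈ openArc b (a + 1) := by
  obtain ⟨u, h1, h2, rfl⟩ := exists_unitAddCircle_lift a x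
  have h3 : a ≠ u := by rintro rfl; exact hxa rfl
  have h4 : u ≠ b := by rintro rfl; exact hxb rfl
  rcases lt_or_gt_of_ne h4 with h | h
  · exact Or.inl ⟨u, ⟨lt_of_le_of_ne h1 h3, h⟩, rfl⟩
  · exact Or.inr ⟨u, ⟨h, h2⟩, rfl⟩

theorem coe_notMem_openArc {a b : ℝ} (hab : a < b) (hb : b < a + 1) :
    (a : UnitAddCircle) ∉ openArc a b ∧ (b : UnitAddCircle) ∉ openArc a b := by
  constructor
  · rintro ⟨u, hu, h⟩
    have := coe_unitAddCircle_injOn (r := a) hu.1.le (by linarith [hu.2]) le_rfl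
      (by linarith) h
    linarith [hu.1]
  · rintro ⟨u, hu, h⟩
    have := coe_unitAddCircle_injOn (r := a) hu.1.le (by linarith [hu.2]) hab.le hb h
    linarith [hu.2]

/-- Two chords without a common end point cross iff exactly one end point of the second lies
on a given one of the two arcs cut out by the first. -/
theorem crosses_iff_openArc {a b : ℝ} (hab : a < b) (hb : b < a + 1) {x y : UnitAddCircle}
    (hxa : x ≠ a) (hxb : x ≠ b) (hya : y ≠ a) (hyb : y ≠ b) :
    Crosses s((a : UnitAddCircle), (b : UnitAddCircle)) s(x, y) ↔
      ¬ (x ∈ openArc a b ↔ y ∈ openArc a b) := by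
  have hd := Set.disjoint_left.1 (disjoint_openArc hab hb)
  rw [crosses_iff_exists hab hb]
  constructor
  · rintro ⟨u, v, h1, h2, h3, h4, h⟩
    have hu : (u : UnitAddCircle) ∈ openArc a b := ⟨u, ⟨h1, h2⟩, rfl⟩
    have hv : (v : UnitAddCircle) ∉ openArc a b := fun h => hd h ⟨v, ⟨h3, h4⟩, rfl⟩
    rcases Sym2.eq_iff.1 h with ⟨rfl, rfl⟩ | ⟨rfl, rfl⟩ <;> tauto
  · intro h
    rcases mem_openArc_or hxa hxb with hx | hx <;> rcases mem_openArc_or hya hyb with hy | hy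
    · exact absurd (iff_of_true hx hy) h
    · obtain ⟨u, hu, rfl⟩ := hx
      obtain ⟨v, hv, rfl⟩ := hy
      exact ⟨u, v, hu.1, hu.2, hv.1, hv.2, rfl⟩
    · obtain ⟨u, hu, rfl⟩ := hx
      obtain ⟨v, hv, rfl⟩ := hy
      exact ⟨v, u, hv.1, hv.2, hu.1, hu.2, Sym2.eq_swap⟩
    · exact absurd (iff_of_false (fun h => hd h hx) (fun h => hd h hy)) h

theorem exists_chord_lift {a b : UnitAddCircle} (hab : a ≠ b) :
    ∃ a' b' : ℝ, a' < b' ∧ b' < a' + 1 ∧ (a' : UnitAddCircle) = a ∧ (b' : UnitAddCircle) = b := by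
  obtain ⟨a', -, -, rfl⟩ := exists_unitAddCircle_lift 0 a
  obtain ⟨b', h1, h2, rfl⟩ := exists_unitAddCircle_lift a' b
  exact ⟨a', b', lt_of_le_of_ne h1 (by rintro rfl; exact hab rfl), h2, rfl, rfl⟩

/-- Chords without a common end point cross iff the end points of one of them lie in
different components of the complement of the end points of the other. -/
theorem crosses_iff_forall_not_isPreconnected {a b x y : UnitAddCircle} (hab : a ≠ b)
    (hxa : x ≠ a) (hxb : x ≠ b) (hya : y ≠ a) (hyb : y ≠ b) :
    Crosses s(a, b) s(x, y) ↔
      ∀ S : Set UnitAddCircle, IsPreconnected S → a ∉ S → b ∉ S → x ∈ S → y ∉ S := by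
  obtain ⟨a, b, h1, h2, rfl, rfl⟩ := exists_chord_lift hab
  have hd := Set.disjoint_left.1 (disjoint_openArc h1 h2)
  rw [crosses_iff_openArc h1 h2 hxa hxb hya hyb]
  constructor
  · intro h S hS ha hb hx hy
    have hsub : S ⊆ openArc a b ∪ openArc b (a + 1) := fun z hz =>
      mem_openArc_or (by rintro rfl; exact ha hz) (by rintro rfl; exact hb hz)
    rcases hS.subset_or_subset (isOpen_openArc _ _) (isOpen_openArc _ _)
      (disjoint_openArc h1 h2) hsub with k | k
    · exact h (iff_of_true (k hx) (k hy))
    · exact h (iff_of_false (fun h => hd h (k hx)) (fun h => hd h (k hy)))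
  · intro h hiff
    by_cases hx : x ∈ openArc a b
    · exact h _ (isPreconnected_openArc a b) (coe_notMem_openArc h1 h2).1
        (coe_notMem_openArc h1 h2).2 hx (hiff.1 hx)
    · have hx' := (mem_openArc_or hxa hxb).resolve_left hx
      have hy' := (mem_openArc_or hya hyb).resolve_left (fun h => hx (hiff.2 h))
      have h3 := coe_notMem_openArc h2 (show a + 1 < b + 1 by linarith)
      rw [coe_add_one_unitAddCircle] at h3
      exact h _ (isPreconnected_openArc b (a + 1)) h3.2 h3.1 hx' hy'

theorem crosses_map_homeomorph (h : UnitAddCircle ≃ₜ UnitAddCircle) {a b x y : UnitAddCircle}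
    (hab : a ≠ b) (hxa : x ≠ a) (hxb : x ≠ b) (hya : y ≠ a) (hyb : y ≠ b) :
    Crosses s(h a, h b) s(h x, h y) ↔ Crosses s(a, b) s(x, y) := by
  rw [crosses_iff_forall_not_isPreconnected hab hxa hxb hya hyb,
    crosses_iff_forall_not_isPreconnected (h.injective.ne hab) (h.injective.ne hxa)
      (h.injective.ne hxb) (h.injective.ne hya) (h.injective.ne hyb)]
  constructor
  · intro k S hS ha hb hx hy
    refine k (h '' S) (hS.image _ h.continuous.continuousOn) ?_ ?_ ⟨x, hx, rfl⟩ ⟨y, hy, rfl⟩ <;>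
      simpa [h.injective.mem_set_image]
  · intro k S hS ha hb hx hy
    refine k (h ⁻¹' S) ?_ ha hb hx hy
    rw [← h.image_symm]
    exact hS.image _ h.symm.continuous.continuousOn

/-! ### Two-colourings of the circle and parity -/

/-- The property `p` of real numbers changes its truth value at `t`. -/
def FlipsAt (p : ℝ → Prop) (t : ℝ) : Prop :=
  ((∀ᶠ u in 𝓝[<] t, p u) ∧ ∀ᶠ u in 𝓝[>] t, ¬ p u) ∨
    ((∀ᶠ u in 𝓝[<] t, ¬ p u) ∧ ∀ᶠ u in 𝓝[>] t, p u)

theorem eventually_ne_of_left_right {p : ℝ → Prop} {t : ℝ} (h1 : ∀ᶠ u in 𝓝[<] t, p u)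
    (h2 : ∀ᶠ u in 𝓝[>] t, p u) : ∀ᶠ u in 𝓝[≠] t, p u := by
  rw [← Set.Iio_union_Ioi, nhdsWithin_union]
  exact Filter.eventually_sup.2 ⟨h1, h2⟩

theorem FlipsAt.eventually_iff {p q : ℝ → Prop} {t : ℝ} (hp : FlipsAt p t) (hq : FlipsAt q t) :
    ∃ v : Prop, ∀ᶠ u in 𝓝[≠] t, ((p u ↔ q u) ↔ v) := by
  rcases hp with ⟨h1, h2⟩ | ⟨h1, h2⟩ <;> rcases hq with ⟨h3, h4⟩ | ⟨h3, h4⟩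
  · refine ⟨True, eventually_ne_of_left_right ?_ ?_⟩
    · filter_upwards [h1, h3] with u; tauto
    · filter_upwards [h2, h4] with u; tauto
  · refine ⟨False, eventually_ne_of_left_right ?_ ?_⟩
    · filter_upwards [h1, h3] with u; tauto
    · filter_upwards [h2, h4] with u; tauto
  · refine ⟨False, eventually_ne_of_left_right ?_ ?_⟩
    · filter_upwards [h1, h3] with u; tauto
    · filter_upwards [h2, h4] with u; tauto
  · refine ⟨True, eventually_ne_of_left_right ?_ ?_⟩
    · filter_upwards [h1, h3] with u; tauto
    · filter_upwards [h2, h4] with u; tauto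

/-- A property that is constant on a punctured neighbourhood of every real number has the same
truth value at any two points near which it is constant. -/
theorem iff_of_eventually_ne_const {q : ℝ → Prop}
    (h : ∀ t, ∃ v : Prop, ∀ᶠ u in 𝓝[≠] t, (q u ↔ v)) {x y : ℝ}
    (hx : ∀ᶠ u in 𝓝 x, (q u ↔ q x)) (hy : ∀ᶠ u in 𝓝 y, (q u ↔ q y)) : q x ↔ q y := by
  choose v hv using h
  have hval : ∀ z, (∀ᶠ u in 𝓝 z, (q u ↔ q z)) → (q z ↔ v z) := by
    intro z hz
    obtain ⟨u, h1, h2⟩ := ((hz.filter_mono nhdsWithin_le_nhds).and (hv z)).exists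
    rw [← h1, h2]
  have hloc : IsLocallyConstant v := by
    rw [IsLocallyConstant.iff_eventually_eq]
    intro t
    have h1 := eventually_eventually_nhdsWithin.2 (hv t)
    rw [eventually_nhdsWithin_iff] at h1
    filter_upwards [h1] with t' ht'
    by_cases htt : t' = t
    · rw [htt]
    · have h2 := ht' htt
      rw [(isOpen_compl_singleton.nhdsWithin_eq (show t' ∈ ({t}ᶜ : Set ℝ) from htt))] at h2
      obtain ⟨u, h3, h4⟩ := ((h2.filter_mono nhdsWithin_le_nhds).and (hv t')).exists
      exact propext (by rw [← h4, h3])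
  rw [hval x hx, hval y hy, hloc.apply_eq_of_preconnectedSpace x y]

theorem flipsAt_openArc_left {a b : ℝ} (hab : a < b) (hb : b < a + 1) :
    FlipsAt (fun u => (u : UnitAddCircle) ∈ openArc a b) a := by
  refine Or.inr ⟨?_, ?_⟩
  · filter_upwards [Ioo_mem_nhdsLT (show b - 1 < a by linarith)] with u hu h
    refine Set.disjoint_left.1 (disjoint_openArc hab hb) h
      ⟨u + 1, ⟨by linarith [hu.1], by linarith [hu.2]⟩, coe_add_one_unitAddCircle u⟩
  · filter_upwards [Ioo_mem_nhdsGT hab] with u hu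
    exact ⟨u, hu, rfl⟩

theorem flipsAt_openArc_right {a b : ℝ} (hab : a < b) (hb : b < a + 1) :
    FlipsAt (fun u => (u : UnitAddCircle) ∈ openArc a b) b := by
  refine Or.inl ⟨?_, ?_⟩
  · filter_upwards [Ioo_mem_nhdsLT hab] with u hu
    exact ⟨u, hu, rfl⟩
  · filter_upwards [Ioo_mem_nhdsGT hb] with u hu h
    exact Set.disjoint_left.1 (disjoint_openArc hab hb) h ⟨u, hu, rfl⟩

theorem flipsAt_openArc {a b t : ℝ} (hab : a < b) (hb : b < a + 1)
    (h : (t : UnitAddCircle) = a ∨ (t : UnitAddCircle) = b) :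
    FlipsAt (fun u => (u : UnitAddCircle) ∈ openArc a b) t := by
  rcases h with h | h <;> obtain ⟨n, hn⟩ := coe_unitAddCircle_eq_iff.1 h.symm <;> subst hn <;>
    rw [← openArc_add_intCast a b n]
  · exact flipsAt_openArc_left (by linarith) (by linarith)
  · exact flipsAt_openArc_right (by linarith) (by linarith)

theorem eventually_mem_openArc_iff {a b t : ℝ} (hab : a < b) (hb : b < a + 1)
    (ha : (t : UnitAddCircle) ≠ a) (hb' : (t : UnitAddCircle) ≠ b) :
    ∀ᶠ u : ℝ in 𝓝 t,
      ((u : UnitAddCircle) ∈ openArc a b ↔ (t : UnitAddCircle) ∈ openArc a b) := by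
  have hc : Filter.Tendsto (fun u : ℝ => (u : UnitAddCircle)) (𝓝 t) (𝓝 (t : UnitAddCircle)) :=
    (AddCircle.continuous_mk' 1).tendsto t
  have hd := Set.disjoint_left.1 (disjoint_openArc hab hb)
  rcases mem_openArc_or ha hb' with h | h
  · filter_upwards [hc ((isOpen_openArc a b).mem_nhds h)] with u hu
    exact iff_of_true hu h
  · filter_upwards [hc ((isOpen_openArc _ _).mem_nhds h)] with u hu
    exact iff_of_false (fun k => hd k hu) (fun k => hd k h)

/-- Suppose that a colouring of the circle changes its colour exactly at four points
`a`, `a'`, `b`, `b'`. Walking from `x` to `y` along the circle one passes an even number of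
these points if `x` and `y` have the same colour, so `{x, y}` is separated by `{a, a'}` iff it
is separated by `{b, b'}`. -/
theorem crosses_iff_crosses_of_colouring {a a' b b' x y : UnitAddCircle} {p : UnitAddCircle → Prop}
    (haa : a ≠ a') (hbb : b ≠ b') (hdis : ∀ z, (z = a ∨ z = a') → (z = b ∨ z = b') → False)
    (hflip : ∀ t : ℝ, ((t : UnitAddCircle) = a ∨ (t : UnitAddCircle) = a') ∨
      ((t : UnitAddCircle) = b ∨ (t : UnitAddCircle) = b') → FlipsAt (fun u => p u) t)
    (hconst : ∀ z, ¬ (z = a ∨ z = a') → ¬ (z = b ∨ z = b') → ∀ᶠ u in 𝓝 z, (p u ↔ p z))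
    (hx : ¬ (x = a ∨ x = a')) (hx' : ¬ (x = b ∨ x = b'))
    (hy : ¬ (y = a ∨ y = a')) (hy' : ¬ (y = b ∨ y = b')) (hxy : p x ↔ p y) :
    Crosses s(a, a') s(x, y) ↔ Crosses s(b, b') s(x, y) := by
  obtain ⟨a, a', h1, h2, rfl, rfl⟩ := exists_chord_lift haa
  obtain ⟨b, b', h3, h4, rfl, rfl⟩ := exists_chord_lift hbb
  rw [crosses_iff_openArc h1 h2 (by tauto) (by tauto) (by tauto) (by tauto),
    crosses_iff_openArc h3 h4 (by tauto) (by tauto) (by tauto) (by tauto), not_iff_not]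
  have hconst' : ∀ t : ℝ, ¬ ((t : UnitAddCircle) = a ∨ (t : UnitAddCircle) = a') →
      ¬ ((t : UnitAddCircle) = b ∨ (t : UnitAddCircle) = b') →
      ∀ᶠ u : ℝ in 𝓝 t, (p u ↔ p t) := fun t h h' =>
    (AddCircle.continuous_mk' 1).tendsto t (hconst t h h')
  obtain ⟨x, -, -, rfl⟩ := exists_unitAddCircle_lift 0 x
  obtain ⟨y, -, -, rfl⟩ := exists_unitAddCircle_lift 0 y
  have hperm : ∀ A P B v A' : Prop, ((B ↔ P) ↔ v) → (A ↔ A') → (((A ↔ P) ↔ B) ↔ (A' ↔ v)) := by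
    intro A P B v A' e1 e2
    rw [← e1, ← e2]
    by_cases A <;> by_cases P <;> by_cases B <;> simp [*]
  have hfinal : ∀ A P B A' P' B' : Prop, (((A ↔ P) ↔ B) ↔ ((A' ↔ P') ↔ B')) → (P ↔ P') →
      ((A ↔ A') ↔ (B ↔ B')) := by
    intro A P B A' P' B' e1 e2
    rw [← e2] at e1
    by_cases A <;> by_cases A' <;> by_cases P <;> by_cases B <;> by_cases B' <;> simp_all
  let q : ℝ → Prop := fun u => (((u : UnitAddCircle) ∈ openArc a a' ↔ p u) ↔
    (u : UnitAddCircle) ∈ openArc b b')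
  have hqc : ∀ t : ℝ, ¬ ((t : UnitAddCircle) = a ∨ (t : UnitAddCircle) = a') →
      ¬ ((t : UnitAddCircle) = b ∨ (t : UnitAddCircle) = b') → ∀ᶠ u in 𝓝 t, (q u ↔ q t) := by
    intro t h h'
    filter_upwards [hconst' t h h',
      eventually_mem_openArc_iff h1 h2 (fun e => h (Or.inl e)) (fun e => h (Or.inr e)),
      eventually_mem_openArc_iff h3 h4 (fun e => h' (Or.inl e)) (fun e => h' (Or.inr e))]
      with u e1 e2 e3
    exact iff_congr (iff_congr e2 e1) e3
  have main : q x ↔ q y := by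
    refine iff_of_eventually_ne_const ?_ (hqc x hx hx') (hqc y hy hy')
    intro t
    by_cases ht : (t : UnitAddCircle) = a ∨ (t : UnitAddCircle) = a'
    · have ht' : ¬ ((t : UnitAddCircle) = b ∨ (t : UnitAddCircle) = b') := fun h => hdis _ ht h
      obtain ⟨v, hv⟩ := (flipsAt_openArc h1 h2 ht).eventually_iff (hflip t (Or.inl ht))
      refine ⟨v ↔ (t : UnitAddCircle) ∈ openArc b b', ?_⟩
      filter_upwards [hv, (eventually_mem_openArc_iff h3 h4 (fun e => ht' (Or.inl e))
        (fun e => ht' (Or.inr e))).filter_mono nhdsWithin_le_nhds] with u e1 e2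
      exact iff_congr e1 e2
    · by_cases ht' : (t : UnitAddCircle) = b ∨ (t : UnitAddCircle) = b'
      · obtain ⟨v, hv⟩ := (flipsAt_openArc h3 h4 ht').eventually_iff (hflip t (Or.inr ht'))
        refine ⟨(t : UnitAddCircle) ∈ openArc a a' ↔ v, ?_⟩
        filter_upwards [hv, (eventually_mem_openArc_iff h1 h2 (fun e => ht (Or.inl e))
          (fun e => ht (Or.inr e))).filter_mono nhdsWithin_le_nhds] with u e1 e2
        exact hperm _ _ _ _ _ e1 e2
      · exact ⟨q t, (hqc t ht ht').filter_mono nhdsWithin_le_nhds⟩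
  exact hfinal _ _ _ _ _ _ main hxy

/-- A property that says on which side of `g t` the values of an injective continuous function
`g` lie changes its truth value at `t`. -/
theorem flipsAt_of_injOn {p : ℝ → Prop} {g : ℝ → ℝ} {t : ℝ} {U : Set ℝ} (hU : U ∈ 𝓝 t)
    (hc : ContinuousOn g U) (hi : Set.InjOn g U)
    (hp : (∀ u ∈ U, (p u ↔ g t < g u)) ∨ (∀ u ∈ U, (p u ↔ g u < g t))) : FlipsAt p t := by
  obtain ⟨l, r, htI, hIU⟩ := mem_nhds_iff_exists_Ioo_subset.1 hU
  have hL : ∀ᶠ u in 𝓝[<] t, u ∈ Set.Ioo l r ∧ u < t :=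
    (Filter.Eventually.filter_mono nhdsWithin_le_nhds (Ioo_mem_nhds htI.1 htI.2)).and
      self_mem_nhdsWithin
  have hR : ∀ᶠ u in 𝓝[>] t, u ∈ Set.Ioo l r ∧ t < u :=
    (Filter.Eventually.filter_mono nhdsWithin_le_nhds (Ioo_mem_nhds htI.1 htI.2)).and
      self_mem_nhdsWithin
  rcases ContinuousOn.strictMonoOn_of_injOn_Ioo (htI.1.trans htI.2) (hc.mono hIU) (hi.mono hIU)
    with hm | hm <;> rcases hp with hp | hp
  · refine Or.inr ⟨hL.mono fun u hu => ?_, hR.mono fun u hu => ?_⟩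
    · rw [hp u (hIU hu.1)]; exact (hm hu.1 htI hu.2).not_gt
    · rw [hp u (hIU hu.1)]; exact hm htI hu.1 hu.2
  · refine Or.inl ⟨hL.mono fun u hu => ?_, hR.mono fun u hu => ?_⟩
    · rw [hp u (hIU hu.1)]; exact hm hu.1 htI hu.2
    · rw [hp u (hIU hu.1)]; exact (hm htI hu.1 hu.2).not_gt
  · refine Or.inl ⟨hL.mono fun u hu => ?_, hR.mono fun u hu => ?_⟩
    · rw [hp u (hIU hu.1)]; exact hm hu.1 htI hu.2
    · rw [hp u (hIU hu.1)]; exact (hm htI hu.1 hu.2).not_gt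
  · refine Or.inr ⟨hL.mono fun u hu => ?_, hR.mono fun u hu => ?_⟩
    · rw [hp u (hIU hu.1)]; exact (hm hu.1 htI hu.2).not_gt
    · rw [hp u (hIU hu.1)]; exact hm htI hu.1 hu.2

/-! ### Crossings in a topological surface -/

section

variable {Y : Type*} [TopologicalSpace Y]

/-- Near the point `y` the set `K` is the union of the two axes in the chart `Φ` centred
at `y`. -/
structure IsAxesChart (K : Set Y) (y : Y) (Φ : OpenPartialHomeomorph Y (ℝ × ℝ)) : Prop where
  mem_source : y ∈ Φ.source
  map_eq_zero : Φ y = 0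
  mem_iff : ∀ᶠ z in 𝓝 y, (z ∈ K ↔ (Φ z).1 = 0 ∨ (Φ z).2 = 0)

/-- A sign as a real number. -/
def signOf (b : Bool) : ℝ := if b then 1 else -1

theorem exists_signOf_mul_pos {X : Type*} [TopologicalSpace X] {S : Set X} (hS : IsPreconnected S)
    {g : X → ℝ} (hg : ContinuousOn g S) (h0 : ∀ x ∈ S, g x ≠ 0) :
    ∃ b, ∀ x ∈ S, 0 < signOf b * g x := by
  have hT := hS.image g hg
  have hsub : g '' S ⊆ Set.Ioi 0 ∪ Set.Iio 0 := by
    rintro _ ⟨x, hx, rfl⟩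
    exact (lt_or_gt_of_ne (h0 x hx)).symm
  rcases hT.subset_or_subset isOpen_Ioi isOpen_Iio
    (Set.disjoint_left.2 fun x hx hx' => lt_asymm (Set.mem_Ioi.1 hx) (Set.mem_Iio.1 hx'))
    hsub with h | h
  · exact ⟨true, fun x hx => by simpa [signOf] using h ⟨x, hx, rfl⟩⟩
  · exact ⟨false, fun x hx => by simpa [signOf] using h ⟨x, hx, rfl⟩⟩

theorem signOf_eq_of_mul_pos {b b' : Bool} {x : ℝ} (h : 0 < signOf b * x)
    (h' : 0 < signOf b' * x) : b = b' := by
  cases b <;> cases b' <;> simp [signOf] at h h' ⊢ <;> linarith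

/-- The half of the interval `(-δ, δ)` with the given sign. -/
def halfInterval (δ : ℝ) (b : Bool) : Set ℝ := if b then Set.Ioo 0 δ else Set.Ioo (-δ) 0

theorem isPreconnected_halfInterval (δ : ℝ) (b : Bool) : IsPreconnected (halfInterval δ b) := by
  cases b <;> exact isPreconnected_Ioo

theorem mem_halfInterval {δ x : ℝ} (h1 : -δ < x) (h2 : x < δ) (h0 : x ≠ 0) :
    ∃ b, x ∈ halfInterval δ b := by
  rcases lt_or_gt_of_ne h0 with h | h
  · exact ⟨false, h1, h⟩
  · exact ⟨true, h, h2⟩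

theorem halfInterval_subset {δ x : ℝ} (hδ : 0 < δ) {b : Bool} (hx : x ∈ halfInterval δ b) :
    -δ < x ∧ x < δ ∧ x ≠ 0 := by
  cases b
  · exact ⟨hx.1, by linarith [hx.2], hx.2.ne⟩
  · exact ⟨by linarith [hx.1], hx.2, hx.1.ne'⟩

theorem zero_mem_closure_halfInterval {δ : ℝ} (hδ : 0 < δ) (b : Bool) :
    (0 : ℝ) ∈ closure (halfInterval δ b) := by
  cases b
  · simp only [halfInterval, Bool.false_eq_true, if_false]
    rw [closure_Ioo (by linarith)]
    exact ⟨by linarith, le_rfl⟩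
  · simp only [halfInterval, if_true]
    rw [closure_Ioo (by linarith)]
    exact ⟨le_rfl, hδ.le⟩

theorem nonempty_halfInterval {δ : ℝ} (hδ : 0 < δ) (b : Bool) : (halfInterval δ b).Nonempty := by
  cases b
  · exact ⟨-δ / 2, by constructor <;> linarith⟩
  · exact ⟨δ / 2, by constructor <;> linarith⟩

set_option synthInstance.maxSize 4000 in
set_option synthInstance.maxHeartbeats 400000 in
/-- A bijection of the four quadrants which keeps one of the two signs along each half-axis
matches opposite half-axes with opposite half-axes. -/
theorem quadrant_signs {σ : Bool × Bool → Bool × Bool} (hσ : Function.Injective σ)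
    (hx : ∀ s, (σ (s, true)).1 = (σ (s, false)).1 ∨ (σ (s, true)).2 = (σ (s, false)).2)
    (hy : ∀ s, (σ (true, s)).1 = (σ (false, s)).1 ∨ (σ (true, s)).2 = (σ (false, s)).2) :
    ((∀ s, (σ (s, true)).2 ≠ (σ (s, false)).2) ∧ ∀ s, (σ (true, s)).1 ≠ (σ (false, s)).1) ∨
      ((∀ s, (σ (s, true)).1 ≠ (σ (s, false)).1) ∧ ∀ s, (σ (true, s)).2 ≠ (σ (false, s)).2) := by
  have key : ∀ p q r s : Bool × Bool, p ≠ q → p ≠ r → p ≠ s → q ≠ r → q ≠ s → r ≠ s →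
      (p.1 = q.1 ∨ p.2 = q.2) → (r.1 = s.1 ∨ r.2 = s.2) → (p.1 = r.1 ∨ p.2 = r.2) →
      (q.1 = s.1 ∨ q.2 = s.2) →
      (((p.2 ≠ q.2 ∧ r.2 ≠ s.2) ∧ (p.1 ≠ r.1 ∧ q.1 ≠ s.1)) ∨
        ((p.1 ≠ q.1 ∧ r.1 ≠ s.1) ∧ (p.2 ≠ r.2 ∧ q.2 ≠ s.2))) := by decide
  simp only [Bool.forall_bool] at hx hy ⊢
  have := key (σ (true, true)) (σ (true, false)) (σ (false, true)) (σ (false, false))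
    (hσ.ne (by decide)) (hσ.ne (by decide)) (hσ.ne (by decide)) (hσ.ne (by decide))
    (hσ.ne (by decide)) (hσ.ne (by decide)) hx.2 hx.1 hy.2 hy.1
  tauto

/-- The planar form of the fact that the two branches of a crossing are determined by their
union: a local homeomorphism of the plane that fixes the origin and preserves the union of the
axes maps each axis into an axis. -/
theorem axes_preserved {θ : ℝ × ℝ → ℝ × ℝ} {δ : ℝ} (hδ : 0 < δ)
    (hc : ContinuousOn θ (Set.Ioo (-δ) δ ×ˢ Set.Ioo (-δ) δ))
    (h0 : ∀ w ∈ Set.Ioo (-δ) δ ×ˢ Set.Ioo (-δ) δ, (θ w = 0 ↔ w = 0))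
    (hax : ∀ w ∈ Set.Ioo (-δ) δ ×ˢ Set.Ioo (-δ) δ,
      ((w.1 = 0 ∨ w.2 = 0) ↔ ((θ w).1 = 0 ∨ (θ w).2 = 0)))
    (hsurj : ∀ b b', ∃ w ∈ Set.Ioo (-δ) δ ×ˢ Set.Ioo (-δ) δ,
      0 < signOf b * (θ w).1 ∧ 0 < signOf b' * (θ w).2) :
    (∀ w ∈ Set.Ioo (-δ) δ ×ˢ Set.Ioo (-δ) δ,
      (w.2 = 0 → (θ w).2 = 0) ∧ (w.1 = 0 → (θ w).1 = 0)) ∨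
    (∀ w ∈ Set.Ioo (-δ) δ ×ˢ Set.Ioo (-δ) δ,
      (w.2 = 0 → (θ w).1 = 0) ∧ (w.1 = 0 → (θ w).2 = 0)) := by
  set S : Set (ℝ × ℝ) := Set.Ioo (-δ) δ ×ˢ Set.Ioo (-δ) δ with hS
  have hSo : IsOpen S := isOpen_Ioo.prod isOpen_Ioo
  let Q : Bool × Bool → Set (ℝ × ℝ) := fun q => halfInterval δ q.1 ×ˢ halfInterval δ q.2
  have hQS : ∀ q, ∀ w ∈ Q q, w ∈ S ∧ w.1 ≠ 0 ∧ w.2 ≠ 0 := by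
    intro q w hw
    have h1 := halfInterval_subset hδ hw.1
    have h2 := halfInterval_subset hδ hw.2
    exact ⟨⟨⟨h1.1, h1.2.1⟩, ⟨h2.1, h2.2.1⟩⟩, h1.2.2, h2.2.2⟩
  have hQc : ∀ q, IsPreconnected (Q q) := fun q =>
    (isPreconnected_halfInterval δ q.1).prod (isPreconnected_halfInterval δ q.2)
  have hne : ∀ q, ∀ w ∈ Q q, (θ w).1 ≠ 0 ∧ (θ w).2 ≠ 0 := by
    intro q w hw
    obtain ⟨h1, h2, h3⟩ := hQS q w hw
    have := (hax w h1).not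
    tauto
  have hsign : ∀ q, ∃ s : Bool × Bool, ∀ w ∈ Q q,
      0 < signOf s.1 * (θ w).1 ∧ 0 < signOf s.2 * (θ w).2 := by
    intro q
    have hcq : ContinuousOn θ (Q q) := hc.mono fun w hw => (hQS q w hw).1
    obtain ⟨b, hb⟩ := exists_signOf_mul_pos (hQc q) (g := fun w => (θ w).1)
      (continuous_fst.comp_continuousOn hcq) (fun w hw => (hne q w hw).1)
    obtain ⟨b', hb'⟩ := exists_signOf_mul_pos (hQc q) (g := fun w => (θ w).2)
      (continuous_snd.comp_continuousOn hcq) (fun w hw => (hne q w hw).2)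
    exact ⟨(b, b'), fun w hw => ⟨hb w hw, hb' w hw⟩⟩
  choose σ hσ using hsign
  have hinj : Function.Injective σ := by
    refine Finite.injective_iff_surjective.2 ?_
    rintro ⟨b, b'⟩
    obtain ⟨w, hw, h1, h2⟩ := hsurj b b'
    have hθ : ¬ ((θ w).1 = 0 ∨ (θ w).2 = 0) := by
      rintro (h | h)
      · simp [h] at h1
      · simp [h] at h2
    rw [← hax w hw, not_or] at hθ
    obtain ⟨s, hs⟩ := mem_halfInterval hw.1.1 hw.1.2 hθ.1
    obtain ⟨s', hs'⟩ := mem_halfInterval hw.2.1 hw.2.2 hθ.2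
    have h3 := hσ (s, s') w ⟨hs, hs'⟩
    exact ⟨(s, s'), Prod.ext (signOf_eq_of_mul_pos h3.1 h1) (signOf_eq_of_mul_pos h3.2 h2)⟩
  -- two quadrants with a common boundary point at which a coordinate does not vanish
  have hclose : ∀ w ∈ S, ∀ q q', w ∈ closure (Q q) → w ∈ closure (Q q') →
      ((θ w).1 ≠ 0 → (σ q).1 = (σ q').1) ∧ ((θ w).2 ≠ 0 → (σ q).2 = (σ q').2) := by
    intro w hw q q' hq hq'
    have hcw : ContinuousAt θ w := hc.continuousAt (hSo.mem_nhds hw)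
    have aux : ∀ g : ℝ × ℝ → ℝ, ContinuousAt g w → g w ≠ 0 → ∀ b b' : Bool,
        (∀ v ∈ Q q, 0 < signOf b * g v) → (∀ v ∈ Q q', 0 < signOf b' * g v) → b = b' := by
      intro g hg hgw b b' hb hb'
      obtain ⟨c, hcpos⟩ : ∃ c, 0 < signOf c * g w := by
        rcases lt_or_gt_of_ne hgw with h | h
        · exact ⟨false, by simpa [signOf] using h⟩
        · exact ⟨true, by simpa [signOf] using h⟩
      have hev : ∀ᶠ v in 𝓝 w, 0 < signOf c * g v :=
        (continuousAt_const.mul hg).eventually (lt_mem_nhds hcpos)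
      obtain ⟨v, hv, hvq⟩ := mem_closure_iff_nhds.1 hq _ hev
      obtain ⟨v', hv', hvq'⟩ := mem_closure_iff_nhds.1 hq' _ hev
      rw [signOf_eq_of_mul_pos (hb v hvq) hv, signOf_eq_of_mul_pos (hb' v' hvq') hv']
    exact ⟨fun h => aux (fun v => (θ v).1) (continuousAt_fst.comp hcw) h _ _
        (fun v hv => (hσ q v hv).1) (fun v hv => (hσ q' v hv).1),
      fun h => aux (fun v => (θ v).2) (continuousAt_snd.comp hcw) h _ _
        (fun v hv => (hσ q v hv).2) (fun v hv => (hσ q' v hv).2)⟩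
  -- a half-axis is connected, so it is mapped into one axis
  have harm : ∀ A : Set (ℝ × ℝ), IsPreconnected A → A ⊆ S →
      (∀ w ∈ A, w ≠ 0 ∧ (w.1 = 0 ∨ w.2 = 0)) →
      (∀ w ∈ A, (θ w).1 ≠ 0 ∧ (θ w).2 = 0) ∨ (∀ w ∈ A, (θ w).2 ≠ 0 ∧ (θ w).1 = 0) := by
    intro A hA hAS hA0
    have hvals : ∀ w ∈ A, θ w ≠ 0 ∧ ((θ w).1 = 0 ∨ (θ w).2 = 0) := fun w hw =>
      ⟨(h0 w (hAS hw)).not.2 (hA0 w hw).1, (hax w (hAS hw)).1 (hA0 w hw).2⟩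
    have himg := hA.image θ (hc.mono hAS)
    rw [isPreconnected_iff_subset_of_disjoint] at himg
    have hor : ∀ w ∈ A, (θ w).1 ≠ 0 ∨ (θ w).2 ≠ 0 := by
      intro w hw
      by_contra h
      push Not at h
      exact (hvals w hw).1 (Prod.ext h.1 h.2)
    rcases himg {p | p.1 ≠ 0} {p | p.2 ≠ 0} (isOpen_ne_fun continuous_fst continuous_const)
      (isOpen_ne_fun continuous_snd continuous_const)
      (by rintro _ ⟨w, hw, rfl⟩; exact hor w hw)
      (by
        rw [Set.eq_empty_iff_forall_notMem]
        rintro _ ⟨⟨w, hw, rfl⟩, h1, h2⟩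
        exact (hvals w hw).2.elim h1 h2) with h | h
    · refine Or.inl fun w hw => ?_
      have h1 : (θ w).1 ≠ 0 := h ⟨w, hw, rfl⟩
      exact ⟨h1, (hvals w hw).2.resolve_left h1⟩
    · refine Or.inr fun w hw => ?_
      have h1 : (θ w).2 ≠ 0 := h ⟨w, hw, rfl⟩
      exact ⟨h1, (hvals w hw).2.resolve_right h1⟩
  have hX : ∀ s, (∀ x ∈ halfInterval δ s, (θ (x, 0)).2 = 0) ∧ (σ (s, true)).1 = (σ (s, false)).1 ∨
      (∀ x ∈ halfInterval δ s, (θ (x, 0)).1 = 0) ∧ (σ (s, true)).2 = (σ (s, false)).2 := by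
    intro s
    have hAS : (fun x : ℝ => (x, (0 : ℝ))) '' halfInterval δ s ⊆ S := by
      rintro _ ⟨x, hx, rfl⟩
      have := halfInterval_subset hδ hx
      exact ⟨⟨this.1, this.2.1⟩, by constructor <;> linarith⟩
    have hcl : ∀ x ∈ halfInterval δ s, ∀ s', (x, (0 : ℝ)) ∈ closure (Q (s, s')) := by
      intro x hx s'
      rw [closure_prod_eq]
      exact ⟨subset_closure hx, zero_mem_closure_halfInterval hδ s'⟩
    obtain ⟨x, hx⟩ := nonempty_halfInterval hδ s
    have hcx := hclose (x, 0) (hAS ⟨x, hx, rfl⟩) (s, true) (s, false) (hcl x hx _) (hcl x hx _)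
    rcases harm _ ((isPreconnected_halfInterval δ s).image (fun x : ℝ => (x, (0 : ℝ)))
      (by fun_prop)) hAS (by
        rintro _ ⟨x, hx, rfl⟩
        exact ⟨fun h => (halfInterval_subset hδ hx).2.2 (congrArg Prod.fst h), Or.inr rfl⟩)
      with h | h
    · exact Or.inl ⟨fun x hx => (h _ ⟨x, hx, rfl⟩).2, hcx.1 (h _ ⟨x, hx, rfl⟩).1⟩
    · exact Or.inr ⟨fun x hx => (h _ ⟨x, hx, rfl⟩).2, hcx.2 (h _ ⟨x, hx, rfl⟩).1⟩
  have hY : ∀ s, (∀ x ∈ halfInterval δ s, (θ (0, x)).2 = 0) ∧ (σ (true, s)).1 = (σ (false, s)).1 ∨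
      (∀ x ∈ halfInterval δ s, (θ (0, x)).1 = 0) ∧ (σ (true, s)).2 = (σ (false, s)).2 := by
    intro s
    have hAS : (fun x : ℝ => ((0 : ℝ), x)) '' halfInterval δ s ⊆ S := by
      rintro _ ⟨x, hx, rfl⟩
      have := halfInterval_subset hδ hx
      exact ⟨by constructor <;> linarith, ⟨this.1, this.2.1⟩⟩
    have hcl : ∀ x ∈ halfInterval δ s, ∀ s', ((0 : ℝ), x) ∈ closure (Q (s', s)) := by
      intro x hx s'
      rw [closure_prod_eq]
      exact ⟨zero_mem_closure_halfInterval hδ s', subset_closure hx⟩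
    obtain ⟨x, hx⟩ := nonempty_halfInterval hδ s
    have hcx := hclose (0, x) (hAS ⟨x, hx, rfl⟩) (true, s) (false, s) (hcl x hx _) (hcl x hx _)
    rcases harm _ ((isPreconnected_halfInterval δ s).image (fun x : ℝ => ((0 : ℝ), x))
      (by fun_prop)) hAS (by
        rintro _ ⟨x, hx, rfl⟩
        exact ⟨fun h => (halfInterval_subset hδ hx).2.2 (congrArg Prod.snd h), Or.inl rfl⟩)
      with h | h
    · exact Or.inl ⟨fun x hx => (h _ ⟨x, hx, rfl⟩).2, hcx.1 (h _ ⟨x, hx, rfl⟩).1⟩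
    · exact Or.inr ⟨fun x hx => (h _ ⟨x, hx, rfl⟩).2, hcx.2 (h _ ⟨x, hx, rfl⟩).1⟩
  have hzero : θ 0 = 0 := (h0 0 ⟨by constructor <;> simpa, by constructor <;> simpa⟩).2 rfl
  have hgood : ∀ g : ℝ × ℝ → ℝ, g 0 = 0 →
      ((∀ s, ∀ x ∈ halfInterval δ s, g (θ (x, 0)) = 0) → ∀ w ∈ S, w.2 = 0 → g (θ w) = 0) ∧
      ((∀ s, ∀ x ∈ halfInterval δ s, g (θ (0, x)) = 0) → ∀ w ∈ S, w.1 = 0 → g (θ w) = 0) := by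
    intro g hg
    refine ⟨fun h w hw hw2 => ?_, fun h w hw hw1 => ?_⟩
    · obtain ⟨x, y⟩ := w
      obtain rfl : y = 0 := hw2
      by_cases hx : x = 0
      · subst hx; rw [← Prod.zero_eq_mk, hzero, hg]
      · obtain ⟨s, hs⟩ := mem_halfInterval hw.1.1 hw.1.2 hx
        exact h s x hs
    · obtain ⟨x, y⟩ := w
      obtain rfl : x = 0 := hw1
      by_cases hy : y = 0
      · subst hy; rw [← Prod.zero_eq_mk, hzero, hg]
      · obtain ⟨s, hs⟩ := mem_halfInterval hw.2.1 hw.2.2 hy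
        exact h s y hs
  rcases quadrant_signs hinj (fun s => (hX s).imp And.right And.right)
    (fun s => (hY s).imp And.right And.right) with ⟨h1, h2⟩ | ⟨h1, h2⟩
  · exact Or.inl fun w hw =>
      ⟨(hgood Prod.snd rfl).1 (fun s => ((hX s).resolve_right fun h => h1 s h.2).1) w hw,
        (hgood Prod.fst rfl).2 (fun s => ((hY s).resolve_left fun h => h2 s h.2).1) w hw⟩
  · exact Or.inr fun w hw =>
      ⟨(hgood Prod.fst rfl).1 (fun s => ((hX s).resolve_left fun h => h1 s h.2).1) w hw,
        (hgood Prod.snd rfl).2 (fun s => ((hY s).resolve_right fun h => h2 s h.2).1) w hw⟩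

/-- Two charts in which `K` is the union of the axes agree, near their centre, on which points
lie on the same axis. -/
theorem IsAxesChart.eventually_axes {K : Set Y} {y : Y} {Φ Ψ : OpenPartialHomeomorph Y (ℝ × ℝ)}
    (hΦ : IsAxesChart K y Φ) (hΨ : IsAxesChart K y Ψ) :
    ((∀ᶠ z in 𝓝 y, (Φ z).2 = 0 → (Ψ z).2 = 0) ∧ ∀ᶠ z in 𝓝 y, (Φ z).1 = 0 → (Ψ z).1 = 0) ∨
      ((∀ᶠ z in 𝓝 y, (Φ z).2 = 0 → (Ψ z).1 = 0) ∧
        ∀ᶠ z in 𝓝 y, (Φ z).1 = 0 → (Ψ z).2 = 0) := by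
  have hN : ∀ᶠ z in 𝓝 y, z ∈ Ψ.source ∧
      (((Φ z).1 = 0 ∨ (Φ z).2 = 0) ↔ ((Ψ z).1 = 0 ∨ (Ψ z).2 = 0)) := by
    filter_upwards [hΦ.mem_iff, hΨ.mem_iff, Ψ.open_source.mem_nhds hΨ.mem_source] with z h1 h2 h3
    exact ⟨h3, by rw [← h1, h2]⟩
  have h0t : (0 : ℝ × ℝ) ∈ Φ.target := hΦ.map_eq_zero ▸ Φ.map_source hΦ.mem_source
  have hsymm0 : Φ.symm 0 = y := by rw [← hΦ.map_eq_zero, Φ.left_inv hΦ.mem_source]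
  have hN' : ∀ᶠ w in 𝓝 (0 : ℝ × ℝ), w ∈ Φ.target ∧ (Φ.symm w ∈ Ψ.source ∧
      (((Φ (Φ.symm w)).1 = 0 ∨ (Φ (Φ.symm w)).2 = 0) ↔
        ((Ψ (Φ.symm w)).1 = 0 ∨ (Ψ (Φ.symm w)).2 = 0))) := by
    have hc : Filter.Tendsto Φ.symm (𝓝 0) (𝓝 y) := by
      have := (Φ.symm.continuousAt h0t).tendsto
      rwa [hsymm0] at this
    exact Filter.Eventually.and (Φ.open_target.mem_nhds h0t) (hc.eventually hN)
  obtain ⟨δ, hδ, hball⟩ := Metric.eventually_nhds_iff.1 hN'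
  have hsq : ∀ w ∈ Set.Ioo (-δ) δ ×ˢ Set.Ioo (-δ) δ, dist w 0 < δ := by
    intro w hw
    rw [Prod.dist_eq, max_lt_iff]
    simp only [Prod.fst_zero, Prod.snd_zero, Real.dist_0_eq_abs]
    exact ⟨abs_lt.2 hw.1, abs_lt.2 hw.2⟩
  have hSo : IsOpen (Set.Ioo (-δ) δ ×ˢ Set.Ioo (-δ) δ) := isOpen_Ioo.prod isOpen_Ioo
  have h0S : (0 : ℝ × ℝ) ∈ Set.Ioo (-δ) δ ×ˢ Set.Ioo (-δ) δ :=
    ⟨by constructor <;> simpa, by constructor <;> simpa⟩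
  have hev : ∀ᶠ z in 𝓝 y, z ∈ Φ.source ∧ Φ z ∈ Set.Ioo (-δ) δ ×ˢ Set.Ioo (-δ) δ := by
    refine Filter.Eventually.and (Φ.open_source.mem_nhds hΦ.mem_source) ?_
    refine (Φ.continuousAt hΦ.mem_source).eventually (hSo.mem_nhds ?_)
    rw [hΦ.map_eq_zero]
    exact h0S
  have hmain := axes_preserved (θ := fun w => Ψ (Φ.symm w)) hδ ?_ ?_ ?_ ?_
  · refine hmain.imp (fun h => ⟨?_, ?_⟩) (fun h => ⟨?_, ?_⟩) <;>
      filter_upwards [hev] with z hz <;> have h1 := h (Φ z) hz.2 <;>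
      rw [Φ.left_inv hz.1] at h1
    exacts [h1.1, h1.2, h1.1, h1.2]
  · refine Ψ.continuousOn.comp (Φ.symm.continuousOn.mono ?_) ?_
    · exact fun w hw => (hball (hsq w hw)).1
    · exact fun w hw => (hball (hsq w hw)).2.1
  · intro w hw
    have h1 := hball (hsq w hw)
    constructor
    · intro h
      have h2 : Φ.symm w = y := Ψ.injOn h1.2.1 hΨ.mem_source (by rw [hΨ.map_eq_zero]; exact h)
      rw [← Φ.right_inv h1.1, h2, hΦ.map_eq_zero]
    · rintro rfl
      rw [hsymm0, hΨ.map_eq_zero]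
  · intro w hw
    have h1 := hball (hsq w hw)
    rw [← h1.2.2, Φ.right_inv h1.1]
  · intro b b'
    have h0t' : (0 : ℝ × ℝ) ∈ Ψ.target := hΨ.map_eq_zero ▸ Ψ.map_source hΨ.mem_source
    have hsymm0' : Ψ.symm 0 = y := by rw [← hΨ.map_eq_zero, Ψ.left_inv hΨ.mem_source]
    have hc : Filter.Tendsto Ψ.symm (𝓝 0) (𝓝 y) := by
      have := (Ψ.symm.continuousAt h0t').tendsto
      rwa [hsymm0'] at this
    have hp : Filter.Tendsto (fun η : ℝ => (signOf b * η, signOf b' * η)) (𝓝[>] 0) (𝓝 0) := by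
      have : Continuous fun η : ℝ => (signOf b * η, signOf b' * η) := by fun_prop
      have h := this.tendsto 0
      simp only [mul_zero] at h
      exact h.mono_left nhdsWithin_le_nhds
    obtain ⟨η, ⟨hη1, hη2⟩, hη3⟩ := (((hc.comp hp).eventually hev).and
      (hp.eventually (Ψ.open_target.mem_nhds h0t'))).and
      (self_mem_nhdsWithin : ∀ᶠ η : ℝ in 𝓝[>] 0, 0 < η) |>.exists
    refine ⟨Φ (Ψ.symm (signOf b * η, signOf b' * η)), hη1.2, ?_⟩
    have h1 : Φ.symm (Φ (Ψ.symm (signOf b * η, signOf b' * η))) =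
        Ψ.symm (signOf b * η, signOf b' * η) := Φ.left_inv hη1.1
    rw [h1, Ψ.right_inv hη2]
    have hs : ∀ b, signOf b * signOf b = 1 := by intro b; cases b <;> simp [signOf]
    simp only [← mul_assoc, hs, one_mul]
    exact ⟨hη3, hη3⟩

theorem IsAxesChart.transfer {Z : Type*} [TopologicalSpace Z] {K : Set Y} {K' : Set Z} {y : Y}
    {Φ : OpenPartialHomeomorph Y (ℝ × ℝ)} (hΦ : IsAxesChart K y Φ) (L : OpenPartialHomeomorph Y Z)
    (hy : y ∈ L.source) (hK : ∀ᶠ z in 𝓝 y, (z ∈ K ↔ L z ∈ K')) :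
    IsAxesChart K' (L y) (L.symm.trans Φ) := by
  refine ⟨?_, ?_, ?_⟩
  · rw [OpenPartialHomeomorph.trans_source]
    exact ⟨L.map_source hy, by simpa [L.left_inv hy] using hΦ.mem_source⟩
  · simp [L.left_inv hy, hΦ.map_eq_zero]
  · have hc : Filter.Tendsto L.symm (𝓝 (L y)) (𝓝 y) := by
      have := (L.symm.continuousAt (L.map_source hy)).tendsto
      rwa [L.left_inv hy] at this
    filter_upwards [hc.eventually hK, hc.eventually hΦ.mem_iff,
      L.open_target.mem_nhds (L.map_source hy)] with z h1 h2 h3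
    rw [L.right_inv h3] at h1
    simp [← h1, h2]

end

/-! ### Generic closed curves and their reparametrisation -/

/-- The branches of the curve `α` at the parameters `a` and `b` cross at `α a = α b`: in some
chart the image of `α` is the union of the two axes, the branch at `a` runs in the horizontal
axis and the branch at `b` runs in the vertical axis. -/
def IsCrossingAt {Y : Type*} [TopologicalSpace Y] (α : UnitAddCircle → Y)
    (a b : UnitAddCircle) : Prop :=
  ∃ Φ : OpenPartialHomeomorph Y (ℝ × ℝ), IsAxesChart (Set.range α) (α a) Φ ∧
    (∀ᶠ s in 𝓝 a, (Φ (α s)).2 = 0) ∧ ∀ᶠ s in 𝓝 b, (Φ (α s)).1 = 0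

/-- The parameters at which a curve passes through a multiple point. -/
def multipleParameters {Y : Type*} (α : UnitAddCircle → Y) : Set UnitAddCircle :=
  {s | ∃ t, s ≠ t ∧ α s = α t}

/-- A topological generic closed curve: it is continuous, and its only multiple points are
finitely many double points, at each of which the two branches cross. -/
structure IsGenericCurve {Y : Type*} [TopologicalSpace Y] (α : UnitAddCircle → Y) : Prop where
  continuous : Continuous α
  no_triple : ∀ a b c, a ≠ b → α a = α b → α a = α c → c = a ∨ c = b
  finite : (multipleParameters α).Finite
  crossing : ∀ a b, a ≠ b → α a = α b → IsCrossingAt α a b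

/-- Two injective continuous real functions with the same value at `0` have a common value
elsewhere. -/
theorem exists_common_value_real {U : Set ℝ} (hU : U ∈ 𝓝 0) {f g : ℝ → ℝ} (hf : ContinuousOn f U)
    (hfi : Set.InjOn f U) (hg : ContinuousOn g U) (hgi : Set.InjOn g U) (h0 : f 0 = g 0) :
    ∃ u ∈ U, ∃ v ∈ U, u ≠ 0 ∧ v ≠ 0 ∧ f u = g v := by
  obtain ⟨l, r, h0I, hIU⟩ := mem_nhds_iff_exists_Ioo_subset.1 hU
  have key : ∀ f : ℝ → ℝ, ContinuousOn f U → Set.InjOn f U → f '' U ∈ 𝓝 (f 0) := by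
    intro f hf hfi
    have hl : l / 2 ∈ Set.Ioo l r := ⟨by linarith [h0I.1], by linarith [h0I.1, h0I.2]⟩
    have hr : r / 2 ∈ Set.Ioo l r := ⟨by linarith [h0I.1, h0I.2], by linarith [h0I.2]⟩
    have hsub : Set.uIcc (l / 2) (r / 2) ⊆ U := by
      rw [Set.uIcc_of_le (by linarith [h0I.1, h0I.2])]
      exact fun x hx => hIU ⟨by linarith [hx.1, h0I.1], by linarith [hx.2, h0I.2]⟩
    have hivt := (intermediate_value_uIcc (hf.mono hsub)).trans (Set.image_mono hsub)
    refine Filter.mem_of_superset ?_ hivt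
    rcases ContinuousOn.strictMonoOn_of_injOn_Ioo (h0I.1.trans h0I.2) (hf.mono hIU)
      (hfi.mono hIU) with hm | hm
    · have h1 := hm hl h0I (by linarith [h0I.1])
      have h2 := hm h0I hr (by linarith [h0I.2])
      rw [Set.uIcc_of_le (by linarith)]
      exact Icc_mem_nhds h1 h2
    · have h1 := hm hl h0I (by linarith [h0I.1])
      have h2 := hm h0I hr (by linarith [h0I.2])
      rw [Set.uIcc_of_ge (by linarith)]
      exact Icc_mem_nhds h2 h1
  have h1 := key f hf hfi
  have h2 := key g hg hgi
  rw [← h0] at h2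
  obtain ⟨y, ⟨⟨u, hu, rfl⟩, ⟨v, hv, hvu⟩⟩, hne⟩ :=
    ((Filter.Eventually.and h1 h2).filter_mono nhdsWithin_le_nhds |>.and
      (self_mem_nhdsWithin : ∀ᶠ y in 𝓝[≠] (f 0), y ∈ ({f 0}ᶜ : Set ℝ))).exists
  refine ⟨u, hu, v, hv, ?_, ?_, hvu.symm⟩
  · rintro rfl; exact hne rfl
  · rintro rfl; exact hne (by rw [← hvu, ← h0]; rfl)

theorem exists_common_value_circle {U : Set ℝ} (hU : U ∈ 𝓝 0) {f g : ℝ → UnitAddCircle}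
    (hf : ContinuousOn f U) (hfi : Set.InjOn f U) (hg : ContinuousOn g U) (hgi : Set.InjOn g U)
    (h0 : f 0 = g 0) : ∃ u ∈ U, ∃ v ∈ U, u ≠ 0 ∧ v ≠ 0 ∧ f u = g v := by
  obtain ⟨t, -, -, ht⟩ := exists_unitAddCircle_lift 0 (f 0)
  let χ := AddCircle.openPartialHomeomorphCoe (1 : ℝ) (t - 1 / 2)
  have htt : f 0 ∈ χ.target := by
    rw [← ht]
    exact χ.map_source ⟨by linarith, by linarith⟩
  have hUf : f ⁻¹' χ.target ∈ 𝓝 0 :=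
    (hf.continuousAt hU).preimage_mem_nhds (χ.open_target.mem_nhds htt)
  have hUg : g ⁻¹' χ.target ∈ 𝓝 0 :=
    (hg.continuousAt hU).preimage_mem_nhds (χ.open_target.mem_nhds (h0 ▸ htt))
  obtain ⟨u, hu, v, hv, h1, h2, h3⟩ := exists_common_value_real
    (Filter.inter_mem hU (Filter.inter_mem hUf hUg)) (f := χ.symm ∘ f) (g := χ.symm ∘ g)
    (χ.symm.continuousOn.comp (hf.mono Set.inter_subset_left) fun u hu => hu.2.1)
    (χ.symm.injOn.comp (hfi.mono Set.inter_subset_left) fun u hu => hu.2.1)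
    (χ.symm.continuousOn.comp (hg.mono Set.inter_subset_left) fun u hu => hu.2.2)
    (χ.symm.injOn.comp (hgi.mono Set.inter_subset_left) fun u hu => hu.2.2)
    (congrArg χ.symm h0)
  exact ⟨u, hu.1, v, hv.1, h1, h2, χ.symm.injOn hu.2.1 hv.2.2 h3⟩

theorem IsGenericCurve.exists_injOn_nhds {Y : Type*} [TopologicalSpace Y]
    {α : UnitAddCircle → Y} (hα : IsGenericCurve α) (a : UnitAddCircle) : ∃ W ∈ 𝓝 a, Set.InjOn α W ∧
      ∀ s ∈ W, s ∈ multipleParameters α → s = a := by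
  have hfin : (multipleParameters α \ {a}).Finite := hα.finite.subset Set.sdiff_subset
  refine ⟨(multipleParameters α \ {a})ᶜ,
    hfin.isClosed.isOpen_compl.mem_nhds (fun h => h.2 rfl), ?_, ?_⟩
  · intro s hs t ht hst
    by_contra hne
    have h1 : s = a := by_contra fun h => hs ⟨⟨t, hne, hst⟩, h⟩
    have h2 : t = a := by_contra fun h => ht ⟨⟨s, Ne.symm hne, hst.symm⟩, h⟩
    exact hne (h1.trans h2.symm)
  · exact fun s hs hm => by_contra fun h => hs ⟨hm, h⟩

theorem continuous_comp_coe_add {Y : Type*} [TopologicalSpace Y]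
    {α : UnitAddCircle → Y} (hα : Continuous α) (a : ℝ) :
    Continuous fun u : ℝ => α (a + u : ℝ) :=
  hα.comp ((AddCircle.continuous_mk' 1).comp (continuous_const.add continuous_id))

/-- Two branches of a generic curve that pass through the same double point, as paths. -/
theorem IsGenericCurve.exists_branches {Y : Type*} [TopologicalSpace Y]
    {α : UnitAddCircle → Y} (hα : IsGenericCurve α) {a b : ℝ} (hab : (a : UnitAddCircle) ≠ b) :
    ∃ U ∈ 𝓝 (0 : ℝ), Set.InjOn (fun u : ℝ => α (a + u : ℝ)) U ∧
      Set.InjOn (fun u : ℝ => α (b + u : ℝ)) U ∧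
      ∀ u ∈ U, ∀ v ∈ U, α (a + u : ℝ) = α (b + v : ℝ) → u = 0 ∨ v = 0 := by
  obtain ⟨W, hW, hWi, hWm⟩ := hα.exists_injOn_nhds a
  obtain ⟨W', hW', hWi', -⟩ := hα.exists_injOn_nhds b
  obtain ⟨O, O', hO, hO', haO, hbO', hdis⟩ := t2_separation hab
  have hca : ∀ a : ℝ, Filter.Tendsto (fun u : ℝ => ((a + u : ℝ) : UnitAddCircle)) (𝓝 0)
      (𝓝 (a : UnitAddCircle)) := by
    intro a
    have : Continuous fun u : ℝ => ((a + u : ℝ) : UnitAddCircle) :=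
      (AddCircle.continuous_mk' 1).comp (continuous_const.add continuous_id)
    have h := this.tendsto 0
    rwa [add_zero] at h
  have hci : ∀ a u v : ℝ, u ∈ Set.Ioo (-1 / 2 : ℝ) (1 / 2) → v ∈ Set.Ioo (-1 / 2 : ℝ) (1 / 2) →
      ((a + u : ℝ) : UnitAddCircle) = ((a + v : ℝ) : UnitAddCircle) → u = v := by
    intro a u v hu hv h
    have := coe_unitAddCircle_injOn (r := a - 1 / 2) (by linarith [hu.1]) (by linarith [hu.2])
      (by linarith [hv.1]) (by linarith [hv.2]) h
    linarith
  have hI : Set.Ioo (-1 / 2 : ℝ) (1 / 2) ∈ 𝓝 (0 : ℝ) := Ioo_mem_nhds (by norm_num) (by norm_num)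
  refine ⟨_, Filter.inter_mem hI (Filter.inter_mem
    (Filter.inter_mem (hca a hW) (hca a (hO.mem_nhds haO)))
    (Filter.inter_mem (hca b hW') (hca b (hO'.mem_nhds hbO')))), ?_, ?_, ?_⟩
  · exact fun u hu v hv h => hci a u v hu.1 hv.1 (hWi hu.2.1.1 hv.2.1.1 h)
  · exact fun u hu v hv h => hci b u v hu.1 hv.1 (hWi' hu.2.2.1 hv.2.2.1 h)
  · intro u hu v hv h
    have hne : ((a + u : ℝ) : UnitAddCircle) ≠ ((b + v : ℝ) : UnitAddCircle) := fun he =>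
      Set.disjoint_left.1 hdis hu.2.1.2 (by
        change ((a + u : ℝ) : UnitAddCircle) ∈ O'
        rw [he]
        exact hv.2.2.2)
    have h1 : ((a + u : ℝ) : UnitAddCircle) = a := hWm _ hu.2.1.1 ⟨_, hne, h⟩
    exact Or.inl (hci a u 0 hu.1 (by norm_num) (by rw [h1, add_zero]))

section
variable {Y : Type*} [TopologicalSpace Y] [T2Space Y]

/-- Near `α a`, every parameter of a point of a closed curve is close to one of the parameters of
`α a`. -/
theorem eventually_fiber {α : UnitAddCircle → Y} (hα : Continuous α) (y : Y)
    {p : UnitAddCircle → Prop} (hp : ∀ t, α t = y → ∀ᶠ s in 𝓝 t, p s) :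
    ∀ᶠ z in 𝓝 y, ∀ t, α t = z → p t :=
  hα.isClosedMap.eventually_nhds_fiber y hp

/-- Two arcs in the image of a generic curve that meet only at `y` force `y` to be a double
point. -/
theorem IsGenericCurve.exists_ne_of_arcs {β : UnitAddCircle → Y} (hβ : IsGenericCurve β) {y : Y}
    (t : UnitAddCircle) {U : Set ℝ} (hU : U ∈ 𝓝 0) {γ₁ γ₂ : ℝ → Y}
    (h₁ : ContinuousOn γ₁ U) (h₁i : Set.InjOn γ₁ U) (h₁0 : γ₁ 0 = y)
    (h₁r : ∀ u ∈ U, γ₁ u ∈ Set.range β)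
    (h₂ : ContinuousOn γ₂ U) (h₂i : Set.InjOn γ₂ U) (h₂0 : γ₂ 0 = y)
    (h₂r : ∀ u ∈ U, γ₂ u ∈ Set.range β)
    (hmeet : ∀ u ∈ U, ∀ v ∈ U, γ₁ u = γ₂ v → u = 0 ∨ v = 0) : ∃ t', t' ≠ t ∧ β t' = y := by
  by_contra! hcon
  have huniq : ∀ t', β t' = y → t' = t := fun t' h => by_contra fun hne => hcon t' hne h
  set D : Set Y := β '' multipleParameters β
  have hDc : IsOpen Dᶜ := (hβ.finite.image β).isClosed.isOpen_compl
  have hyD : y ∈ Dᶜ := by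
    rintro ⟨s, ⟨s', hne, hs⟩, hsy⟩
    exact hne ((huniq s hsy).trans (huniq s' (hs ▸ hsy)).symm)
  have key : ∀ γ : ℝ → Y, ContinuousOn γ U → Set.InjOn γ U → γ 0 = y →
      (∀ u ∈ U, γ u ∈ Set.range β) → ∃ f : ℝ → UnitAddCircle, (∀ u ∈ U, β (f u) = γ u) ∧
        f 0 = t ∧ Set.InjOn f U ∧ ∃ V ∈ 𝓝 (0 : ℝ), ContinuousOn f V := by
    intro γ hγ hγi hγ0 hγr
    have : ∀ u, ∃ s, u ∈ U → β s = γ u := by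
      intro u
      by_cases hu : u ∈ U
      · obtain ⟨s, hs⟩ := hγr u hu
        exact ⟨s, fun _ => hs⟩
      · exact ⟨t, fun h => absurd h hu⟩
    choose f hf using this
    refine ⟨f, hf, huniq _ ((hf 0 (mem_of_mem_nhds hU)).trans hγ0), ?_, ?_⟩
    · intro u hu v hv huv
      exact hγi hu hv (by rw [← hf u hu, ← hf v hv, huv])
    · refine ⟨interior U ∩ γ ⁻¹' Dᶜ, Filter.inter_mem (interior_mem_nhds.2 hU)
        ((hγ.continuousAt hU).preimage_mem_nhds (hDc.mem_nhds (hγ0 ▸ hyD))), ?_⟩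
      intro u hu
      refine ContinuousAt.continuousWithinAt ?_
      have huU : U ∈ 𝓝 u := mem_interior_iff_mem_nhds.1 hu.1
      intro V hV
      have h1 : ∀ᶠ z in 𝓝 (γ u), ∀ s, β s = z → s ∈ V := by
        refine eventually_fiber hβ.continuous _ fun s hs => ?_
        have : s = f u := by
          by_contra hne
          exact hu.2 ⟨s, ⟨f u, hne, by rw [hs, hf u (mem_of_mem_nhds huU)]⟩, hs⟩
        rw [this]
        exact hV
      change ∀ᶠ v in 𝓝 u, f v ∈ V
      filter_upwards [(hγ.continuousAt huU).eventually h1, huU] with v hv hvU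
      exact hv _ (hf v hvU)
  obtain ⟨f, hf, hf0, hfi, V, hV, hfc⟩ := key γ₁ h₁ h₁i h₁0 h₁r
  obtain ⟨g, hg, hg0, hgi, V', hV', hgc⟩ := key γ₂ h₂ h₂i h₂0 h₂r
  obtain ⟨u, hu, v, hv, hu0, hv0, huv⟩ := exists_common_value_circle
    (Filter.inter_mem hU (Filter.inter_mem hV hV')) (hfc.mono fun u hu => hu.2.1)
    (hfi.mono Set.inter_subset_left) (hgc.mono fun u hu => hu.2.2)
    (hgi.mono Set.inter_subset_left) (hf0.trans hg0.symm)
  rcases hmeet u hu.1 v hv.1 (by rw [← hf u hu.1, ← hg v hv.1, huv]) with h | h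
  · exact hu0 h
  · exact hv0 h

/-- Generic curves with the same image have the same double points. -/
theorem IsGenericCurve.exists_ne_of_range_eq {α β : UnitAddCircle → Y} (hα : IsGenericCurve α)
    (hβ : IsGenericCurve β) (hr : Set.range α = Set.range β) {a b : UnitAddCircle} (hab : a ≠ b)
    (h : α a = α b) (t : UnitAddCircle) : ∃ t', t' ≠ t ∧ β t' = α a := by
  obtain ⟨a, -, -, rfl⟩ := exists_unitAddCircle_lift 0 a
  obtain ⟨b, -, -, rfl⟩ := exists_unitAddCircle_lift 0 b
  obtain ⟨U, hU, h1, h2, h3⟩ := hα.exists_branches hab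
  exact hβ.exists_ne_of_arcs t hU (continuous_comp_coe_add hα.continuous a).continuousOn h1
    (by simp) (fun u _ => hr ▸ ⟨_, rfl⟩) (continuous_comp_coe_add hα.continuous b).continuousOn h2
    (by simp [h]) (fun u _ => hr ▸ ⟨_, rfl⟩) h3

/-- The parameter `t` of `β` corresponds to the parameter `s` of `α`: they have the same image,
and near this point the branch of `α` at `s` is the branch of `β` at `t`. -/
def SameBranch (α β : UnitAddCircle → Y) (s t : UnitAddCircle) : Prop :=
  β t = α s ∧ ∀ V ∈ 𝓝 t, ∀ᶠ s' in 𝓝 s, ∀ t', β t' = α s' → t' ∈ V ∨ s' = s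

/-- If a condition `G` on points of the surface holds along the branch of `α` at `a`, and along the
branch of `β` at `b'` only at the double point itself, then the branch of `α` at `a` is the branch
of `β` at the other parameter `a'` of the double point. -/
theorem sameBranch_of_separates {α β : UnitAddCircle → Y} (hα : IsGenericCurve α)
    (hβ : IsGenericCurve β) {a a' b' : UnitAddCircle} (ha' : β a' = α a)
    (hb' : ∀ t, β t = α a → t = a' ∨ t = b') {G : Y → Prop} (h1 : ∀ᶠ s in 𝓝 a, G (α s))
    (h2 : ∀ᶠ t in 𝓝 b', G (β t) → β t = α a) : SameBranch α β a a' := by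
  refine ⟨ha', fun V hV => ?_⟩
  obtain ⟨W, hW, hWi, -⟩ := hα.exists_injOn_nhds a
  have h3 : ∀ᶠ z in 𝓝 (α a), ∀ t, β t = z → t ∈ V ∨ (G (β t) → β t = α a) := by
    refine eventually_fiber hβ.continuous _ fun t ht => ?_
    rcases hb' t ht with rfl | rfl
    · exact Filter.mem_of_superset hV fun s hs => Or.inl hs
    · exact h2.mono fun s hs => Or.inr hs
  filter_upwards [hα.continuous.continuousAt.eventually h3, h1, hW] with s hs hG hsW t ht
  refine (hs t ht).imp id fun k => ?_
  exact hWi hsW (mem_of_mem_nhds hW) (ht.symm.trans (k (ht ▸ hG)))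

/-- At a double point, the charts of the two crossings have the same axes up to exchange, and so
`β` has a branch that runs in the axis of the branch of `α` at `s`. -/
theorem exists_sameBranch {α β : UnitAddCircle → Y} (hα : IsGenericCurve α)
    (hβ : IsGenericCurve β) (hr : Set.range α = Set.range β) (s : UnitAddCircle) :
    ∃ t, SameBranch α β s t := by
  obtain ⟨t, ht⟩ : α s ∈ Set.range β := hr ▸ ⟨s, rfl⟩
  by_cases hs : ∃ b, s ≠ b ∧ α s = α b
  · obtain ⟨b, hsb, hb⟩ := hs
    obtain ⟨t', hne, ht'⟩ := hα.exists_ne_of_range_eq hβ hr hsb hb t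
    obtain ⟨Φ, hΦ, hΦ1, -⟩ := hα.crossing s b hsb hb
    obtain ⟨Ψ, hΨ, hΨ1, hΨ2⟩ := hβ.crossing t t' hne.symm (ht.trans ht'.symm)
    have hfib : ∀ u, β u = α s → u = t ∨ u = t' := fun u hu =>
      hβ.no_triple t t' u hne.symm (ht.trans ht'.symm) (ht.trans hu.symm)
    rw [ht, ← hr] at hΨ
    have hzero : ∀ᶠ z in 𝓝 (α s), (Ψ z).1 = 0 → (Ψ z).2 = 0 → z = α s := by
      filter_upwards [Ψ.open_source.mem_nhds hΨ.mem_source] with z hz h1 h2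
      exact Ψ.injOn hz hΨ.mem_source (by rw [hΨ.map_eq_zero]; exact Prod.ext h1 h2)
    have hct := hβ.continuous.tendsto t
    have hct' := hβ.continuous.tendsto t'
    rw [ht] at hct
    rw [ht'] at hct'
    rcases hΦ.eventually_axes hΨ with ⟨h1, -⟩ | ⟨h1, -⟩
    · refine ⟨t, sameBranch_of_separates hα hβ (b' := t') (G := fun z => (Ψ z).2 = 0)
        ht hfib ?_ ?_⟩
      · filter_upwards [hα.continuous.continuousAt.eventually h1, hΦ1] with u k1 k2
        exact k1 k2
      · filter_upwards [hΨ2, hct'.eventually hzero] with u k1 k2 k3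
        exact k2 k1 k3
    · refine ⟨t', sameBranch_of_separates hα hβ (b' := t) (G := fun z => (Ψ z).1 = 0)
        ht' (fun u hu => (hfib u hu).symm) ?_ ?_⟩
      · filter_upwards [hα.continuous.continuousAt.eventually h1, hΦ1] with u k1 k2
        exact k1 k2
      · filter_upwards [hΨ1, hct.eventually hzero] with u k1 k2 k3
        exact k2 k3 k1
  · -- the point is a simple point of both curves, and the condition on `b'` is void
    have hfib : ∀ u, β u = α s → u = t := by
      intro u hu
      by_contra hne
      obtain ⟨s', h1, h2⟩ := hβ.exists_ne_of_range_eq hα hr.symm (Ne.symm hne)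
        (ht.trans hu.symm) s
      exact hs ⟨s', h1.symm, by rw [h2, ht]⟩
    refine ⟨t, ht, fun V hV => ?_⟩
    have h3 : ∀ᶠ z in 𝓝 (α s), ∀ t, β t = z → t ∈ V :=
      eventually_fiber hβ.continuous _ fun u hu => by rw [hfib u hu]; exact hV
    filter_upwards [hα.continuous.continuousAt.eventually h3] with u hu t' ht'
    exact Or.inl (hu t' ht')

/-- Generic curves with the same image differ by a homeomorphism of the circle: each parameter of
`α` is sent to the parameter of the same branch of `β`. -/
theorem IsGenericCurve.exists_homeomorph {α β : UnitAddCircle → Y} (hα : IsGenericCurve α)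
    (hβ : IsGenericCurve β) (hr : Set.range α = Set.range β) :
    ∃ h : UnitAddCircle ≃ₜ UnitAddCircle, ∀ s, β (h s) = α s := by
  choose h hh using exists_sameBranch hα hβ hr
  have hcont : Continuous h := by
    rw [continuous_iff_continuousAt]
    intro s V hV
    change ∀ᶠ s' in 𝓝 s, h s' ∈ V
    filter_upwards [(hh s).2 V hV] with s' hs'
    rcases hs' _ (hh s').1 with k | rfl
    · exact k
    · exact mem_of_mem_nhds hV
  have hinj : Function.Injective h := by
    intro a b hab
    by_contra hne
    have hval : α a = α b := by rw [← (hh a).1, ← (hh b).1, hab]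
    -- if both branches of `α` ran in one branch of `β`, nothing would cover the other one
    obtain ⟨t, htne, ht⟩ := hα.exists_ne_of_range_eq hβ hr hne hval (h a)
    obtain ⟨O, O', hO, hO', haO, htO', hdis⟩ := t2_separation htne.symm
    have h1 : ∀ᶠ z in 𝓝 (α a), ∀ s, α s = z → ∀ t', β t' = α s → t' ∈ O ∨ α s = α a := by
      refine eventually_fiber hα.continuous _ fun s hs => ?_
      rcases hα.no_triple a b s hne hval hs.symm with rfl | rfl
      · filter_upwards [(hh s).2 O (hO.mem_nhds haO)] with s' hs' t' ht'
        exact (hs' t' ht').imp id fun k => by rw [k]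
      · filter_upwards [(hh s).2 O (hO.mem_nhds (hab ▸ haO))] with s' hs' t' ht'
        exact (hs' t' ht').imp id fun k => by rw [k, hval]
    have hct := hβ.continuous.tendsto t
    rw [ht] at hct
    obtain ⟨W, hW, hWi, -⟩ := hβ.exists_injOn_nhds t
    have h2 : ∀ᶠ t' in 𝓝 t, t' = t := by
      filter_upwards [hct.eventually h1, hO'.mem_nhds htO', hW] with t' k1 k2 k3
      obtain ⟨s, hs⟩ : β t' ∈ Set.range α := hr ▸ ⟨t', rfl⟩
      rcases k1 s hs t' hs.symm with k | k
      · exact absurd k2 (Set.disjoint_left.1 hdis k)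
      · exact hWi k3 (mem_of_mem_nhds hW) (by rw [← hs, k, ht])
    -- the circle has no isolated points
    obtain ⟨u, -, -, rfl⟩ := exists_unitAddCircle_lift 0 t
    have h3 := ((AddCircle.continuous_mk' 1).tendsto u).eventually h2
    obtain ⟨l, r, hu, hlr⟩ := mem_nhds_iff_exists_Ioo_subset.1 h3
    have h4 : min ((u + r) / 2) (u + 1 / 2) ∈ Set.Ioo l r := by
      constructor
      · rw [lt_min_iff]; constructor <;> linarith [hu.1, hu.2]
      · rw [min_lt_iff]; left; linarith [hu.2]
    have h5 : u < min ((u + r) / 2) (u + 1 / 2) := by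
      rw [lt_min_iff]; constructor <;> linarith [hu.2]
    have h6 := coe_unitAddCircle_injOn (r := u) h5.le
      ((min_le_right _ _).trans_lt (by linarith)) le_rfl (by linarith) (hlr h4)
    exact h5.ne' h6
  have hsurj : Function.Surjective h := by
    intro t
    obtain ⟨s, hs⟩ : β t ∈ Set.range α := hr ▸ ⟨t, rfl⟩
    by_cases ht : h s = t
    · exact ⟨s, ht⟩
    · obtain ⟨s', hne, hs'⟩ := hβ.exists_ne_of_range_eq hα hr.symm (a := t) (Ne.symm ht)
        (by rw [(hh s).1, hs]) s
      refine ⟨s', ?_⟩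
      rcases hβ.no_triple (h s) t (h s') ht (by rw [(hh s).1, hs])
        (by rw [(hh s).1, (hh s').1, hs, hs']) with k | k
      · exact absurd (hinj k) hne
      · exact k
  exact ⟨Continuous.homeoOfEquivCompactToT2 (f := Equiv.ofBijective h ⟨hinj, hsurj⟩) hcont,
    fun s => (hh s).1⟩

end

theorem IsCrossingAt.transfer {Y Z : Type*} [TopologicalSpace Y] [TopologicalSpace Z]
    {α : UnitAddCircle → Y}
    {β : UnitAddCircle → Z} {a b : UnitAddCircle} (h : IsCrossingAt α a b)
    (L : OpenPartialHomeomorph Y Z) (hα : Continuous α) (hab : α a = α b) (ha : α a ∈ L.source)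
    (hβa : ∀ᶠ s in 𝓝 a, β s = L (α s)) (hβb : ∀ᶠ s in 𝓝 b, β s = L (α s))
    (hr : ∀ᶠ z in 𝓝 (α a), (z ∈ Set.range α ↔ L z ∈ Set.range β)) : IsCrossingAt β a b := by
  obtain ⟨Φ, hΦ, h1, h2⟩ := h
  refine ⟨L.symm.trans Φ, ?_, ?_, ?_⟩
  · rw [hβa.self_of_nhds]
    exact hΦ.transfer L ha hr
  · filter_upwards [hβa, h1, hα.continuousAt.eventually (L.open_source.mem_nhds ha)] with s k1 k2 k3
    have : L.symm (L (α s)) = α s := L.left_inv k3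
    simp [k1, this, k2]
  · filter_upwards [hβb, h2,
      hα.continuousAt.eventually (L.open_source.mem_nhds (hab ▸ ha))] with s k1 k2 k3
    have : L.symm (L (α s)) = α s := L.left_inv k3
    simp [k1, this, k2]

theorem IsGenericCurve.comp_homeomorph {Y Z : Type*} [TopologicalSpace Y]
    [TopologicalSpace Z] {α : UnitAddCircle → Y}
    (hα : IsGenericCurve α) (φ : Y ≃ₜ Z) : IsGenericCurve (φ ∘ α) := by
  refine ⟨φ.continuous.comp hα.continuous, ?_, ?_, ?_⟩
  · exact fun a b c hab h h' => hα.no_triple a b c hab (φ.injective h) (φ.injective h')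
  · refine hα.finite.subset ?_
    rintro s ⟨t, hst, h⟩
    exact ⟨t, hst, φ.injective h⟩
  · intro a b hab h
    have h' : α a = α b := φ.injective h
    refine (hα.crossing a b hab h').transfer φ.toOpenPartialHomeomorph hα.continuous h'
      trivial (Filter.Eventually.of_forall fun _ => rfl)
      (Filter.Eventually.of_forall fun _ => rfl) (Filter.Eventually.of_forall fun z => ?_)
    rw [Set.range_comp]
    exact (φ.injective.mem_set_image).symm

/-! ### Smooth generic immersions are generic curves -/

/-- A local parametrisation of Euclidean space in which the sphere is the slice on which the
third coordinate vanishes restricts to a chart of the sphere. -/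
noncomputable def sphereSliceChart (p : Sphere2)
    (G : OpenPartialHomeomorph (ℝ × ℝ × ℝ) (EuclideanSpace ℝ (Fin 3)))
    (hG : ∀ w ∈ G.source, (‖G w‖ = 1 ↔ w.2.2 = 0)) : OpenPartialHomeomorph Sphere2 (ℝ × ℝ) where
  toFun z := ((G.symm z).1, (G.symm z).2.1)
  invFun w := if h : ‖G (w.1, w.2, 0)‖ = 1 then ⟨G (w.1, w.2, 0), by simp [h]⟩ else p
  source := {z | (z : EuclideanSpace ℝ (Fin 3)) ∈ G.target}
  target := {w | (w.1, w.2, (0 : ℝ)) ∈ G.source}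
  map_source' z hz := by
    have h1 : ‖G (G.symm z)‖ = 1 := by rw [G.right_inv hz]; simp
    have h2 := (hG _ (G.map_target hz)).1 h1
    have h3 : ((G.symm z).1, (G.symm z).2.1, (0 : ℝ)) = G.symm z := by rw [← h2]
    change ((G.symm z).1, (G.symm z).2.1, (0 : ℝ)) ∈ G.source
    rw [h3]
    exact G.map_target hz
  map_target' w hw := by
    have h1 := (hG _ hw).2 rfl
    simp only [h1, dif_pos, Set.mem_ofPred_eq]
    exact G.map_source hw
  left_inv' z hz := by
    have h1 : ‖G (G.symm z)‖ = 1 := by rw [G.right_inv hz]; simp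
    have h2 := (hG _ (G.map_target hz)).1 h1
    have h3 : ((G.symm z).1, (G.symm z).2.1, (0 : ℝ)) = G.symm z := by rw [← h2]
    simp only [h3, h1, dif_pos]
    exact Subtype.ext (G.right_inv hz)
  right_inv' w hw := by
    have h1 := (hG _ hw).2 rfl
    simp only [h1, dif_pos]
    rw [G.left_inv hw]
  open_source := G.open_target.preimage continuous_subtype_val
  open_target := G.open_source.preimage (by fun_prop)
  continuousOn_toFun := by
    have h : ContinuousOn (fun z : Sphere2 => G.symm z) {z | (z : EuclideanSpace ℝ (Fin 3)) ∈
        G.target} := G.symm.continuousOn.comp continuous_subtype_val.continuousOn fun z hz => hz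
    exact (continuous_fst.comp_continuousOn h).prodMk
      ((continuous_fst.comp continuous_snd).comp_continuousOn h)
  continuousOn_invFun := by
    rw [Topology.IsInducing.subtypeVal.continuousOn_iff]
    have h : ContinuousOn (fun w : ℝ × ℝ => G (w.1, w.2, 0)) {w | (w.1, w.2, (0 : ℝ)) ∈ G.source} :=
      G.continuousOn.comp (by fun_prop) fun w hw => hw
    refine h.congr fun w hw => ?_
    have h1 := (hG _ hw).2 rfl
    simp [h1]

namespace KnotProjection

variable (P : KnotProjection)

/-- The lift of a knot projection to a periodic curve in Euclidean space. -/
def lift (t : ℝ) : EuclideanSpace ℝ (Fin 3) := P.toFun (t : UnitAddCircle)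

theorem norm_lift (t : ℝ) : ‖P.lift t‖ = 1 := by simp [lift]

theorem hasDerivAt_lift (t : ℝ) : HasDerivAt P.lift (deriv P.lift t) t :=
  (P.smooth.differentiable (by simp)).differentiableAt.hasDerivAt

theorem inner_lift_deriv (t : ℝ) : inner ℝ (P.lift t) (deriv P.lift t) = 0 := by
  have h1 := (P.hasDerivAt_lift t).norm_sq
  have h2 : (fun x => ‖P.lift x‖ ^ 2) = fun _ => (1 : ℝ) := by
    funext x; rw [P.norm_lift]; norm_num
  rw [h2] at h1
  have h3 := h1.unique (hasDerivAt_const t (1 : ℝ))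
  linarith

theorem continuous_toFun : Continuous P.toFun := by
  have h : Continuous fun t : ℝ => P.toFun (t : UnitAddCircle) :=
    Continuous.subtype_mk P.smooth.continuous _
  exact (QuotientAddGroup.isQuotientMap_mk _).continuous_iff.2 h

theorem lift_eq_of_crossing {a b : ℝ} (h : P.toFun a = P.toFun b) : P.lift a = P.lift b :=
  congrArg Subtype.val h

/-- The sum of the branches of the curve at `a` and at `b`. -/
def branchSum (a b : ℝ) (w : ℝ × ℝ × ℝ) : EuclideanSpace ℝ (Fin 3) :=
  P.lift (a + w.1) + P.lift (b + w.2.1) - P.lift a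

/-- The parametrisation of Euclidean space near a double point with parameters `a` and `b`: for a
vanishing third coordinate it runs in the sphere, and it maps the first two axes to the
two branches of the curve. -/
noncomputable def crossingMap (a b : ℝ) (w : ℝ × ℝ × ℝ) : EuclideanSpace ℝ (Fin 3) :=
  ((1 + w.2.2) * ‖P.branchSum a b w‖⁻¹) • P.branchSum a b w

theorem contDiff_branchSum (a b : ℝ) : ContDiff ℝ 1 (P.branchSum a b) := by
  have h : ContDiff ℝ 1 P.lift := P.smooth.of_le (by exact_mod_cast le_top)
  have h1 : ContDiff ℝ 1 fun w : ℝ × ℝ × ℝ => P.lift (a + w.1) :=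
    h.comp (contDiff_const.add contDiff_fst)
  have h2 : ContDiff ℝ 1 fun w : ℝ × ℝ × ℝ => P.lift (b + w.2.1) :=
    h.comp (contDiff_const.add (contDiff_fst.comp contDiff_snd))
  exact (h1.add h2).sub contDiff_const

theorem branchSum_fst {a b : ℝ} (h : P.lift a = P.lift b) (s r : ℝ) :
    P.branchSum a b (s, 0, r) = P.lift (a + s) := by
  simp [branchSum, h]

theorem branchSum_snd (a b s r : ℝ) : P.branchSum a b (0, s, r) = P.lift (b + s) := by
  simp [branchSum]

theorem crossingMap_fst {a b : ℝ} (h : P.lift a = P.lift b) (s : ℝ) :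
    P.crossingMap a b (s, 0, 0) = P.lift (a + s) := by
  simp [crossingMap, P.branchSum_fst h, P.norm_lift]

theorem crossingMap_snd (a b s : ℝ) : P.crossingMap a b (0, s, 0) = P.lift (b + s) := by
  simp [crossingMap, P.branchSum_snd, P.norm_lift]

theorem crossingMap_thd {a b : ℝ} (h : P.lift a = P.lift b) (r : ℝ) :
    P.crossingMap a b (0, 0, r) = (1 + r) • P.lift a := by
  simp [crossingMap, P.branchSum_fst h, P.norm_lift]

theorem branchSum_ne_zero {a b : ℝ} (h : P.lift a = P.lift b) : P.branchSum a b 0 ≠ 0 := by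
  have h1 := P.branchSum_fst h 0 0
  rw [add_zero] at h1
  have h2 : P.branchSum a b 0 = P.lift a := h1
  rw [h2, ← norm_ne_zero_iff, P.norm_lift]
  exact one_ne_zero

theorem contDiffAt_crossingMap {a b : ℝ} (h : P.lift a = P.lift b) :
    ContDiffAt ℝ 1 (P.crossingMap a b) 0 := by
  have h1 : ContDiffAt ℝ 1 (P.branchSum a b) 0 := (P.contDiff_branchSum a b).contDiffAt
  have h2 := h1.norm ℝ (P.branchSum_ne_zero h)
  have h3 := h2.inv (norm_ne_zero_iff.2 (P.branchSum_ne_zero h))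
  have h4 : ContDiffAt ℝ 1 (fun w : ℝ × ℝ × ℝ => 1 + w.2.2) 0 := by fun_prop
  exact (h4.mul h3).smul h1

/-- The derivative of the parametrisation at a double point: the tangent vectors of the two
branches and the radial direction. -/
theorem fderiv_crossingMap {a b : ℝ} (h : P.lift a = P.lift b) (w : ℝ × ℝ × ℝ) :
    fderiv ℝ (P.crossingMap a b) 0 w =
      w.1 • deriv P.lift a + w.2.1 • deriv P.lift b + w.2.2 • P.lift a := by
  have hd : HasFDerivAt (P.crossingMap a b) (fderiv ℝ (P.crossingMap a b) 0) 0 :=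
    ((P.contDiffAt_crossingMap h).differentiableAt (by norm_num)).hasFDerivAt
  set A := fderiv ℝ (P.crossingMap a b) 0
  have h1 : A (1, 0, 0) = deriv P.lift a := by
    have hc : HasDerivAt (fun s : ℝ => ((s, 0, 0) : ℝ × ℝ × ℝ)) (1, 0, 0) 0 :=
      (hasDerivAt_id 0).prodMk (hasDerivAt_const _ _)
    have k1 := HasFDerivAt.comp_hasDerivAt (0 : ℝ) hd hc
    have k2 : P.crossingMap a b ∘ (fun s : ℝ => ((s, 0, 0) : ℝ × ℝ × ℝ)) =
        fun s => P.lift (a + s) := funext fun s => P.crossingMap_fst h s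
    rw [k2] at k1
    have k3 := (P.hasDerivAt_lift a)
    rw [← add_zero a] at k3
    have k4 := k3.comp_const_add a 0
    rw [add_zero] at k4
    exact k1.unique k4
  have h2 : A (0, 1, 0) = deriv P.lift b := by
    have hc : HasDerivAt (fun s : ℝ => ((0, s, 0) : ℝ × ℝ × ℝ)) (0, 1, 0) 0 :=
      (hasDerivAt_const _ _).prodMk ((hasDerivAt_id 0).prodMk (hasDerivAt_const _ _))
    have k1 := HasFDerivAt.comp_hasDerivAt (0 : ℝ) hd hc
    have k2 : P.crossingMap a b ∘ (fun s : ℝ => ((0, s, 0) : ℝ × ℝ × ℝ)) =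
        fun s => P.lift (b + s) := funext fun s => P.crossingMap_snd a b s
    rw [k2] at k1
    have k3 := (P.hasDerivAt_lift b)
    rw [← add_zero b] at k3
    have k4 := k3.comp_const_add b 0
    rw [add_zero] at k4
    exact k1.unique k4
  have h3 : A (0, 0, 1) = P.lift a := by
    have hc : HasDerivAt (fun s : ℝ => ((0, 0, s) : ℝ × ℝ × ℝ)) (0, 0, 1) 0 :=
      (hasDerivAt_const _ _).prodMk ((hasDerivAt_const _ _).prodMk (hasDerivAt_id 0))
    have k1 := HasFDerivAt.comp_hasDerivAt (0 : ℝ) hd hc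
    have k2 : P.crossingMap a b ∘ (fun s : ℝ => ((0, 0, s) : ℝ × ℝ × ℝ)) =
        fun s => (1 + s) • P.lift a := funext fun s => P.crossingMap_thd h s
    rw [k2] at k1
    have k4 := ((hasDerivAt_id (0 : ℝ)).const_add 1).smul_const (P.lift a)
    rw [one_smul] at k4
    exact k1.unique k4
  have hw : w = w.1 • ((1, 0, 0) : ℝ × ℝ × ℝ) + w.2.1 • ((0, 1, 0) : ℝ × ℝ × ℝ) +
      w.2.2 • ((0, 0, 1) : ℝ × ℝ × ℝ) := by
    ext <;> simp
  conv_lhs => rw [hw]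
  rw [map_add, map_add, map_smul, map_smul, map_smul, h1, h2, h3]

theorem fderiv_crossingMap_injective {a b : ℝ} (h : P.lift a = P.lift b)
    (hab : (a : UnitAddCircle) ≠ b) :
    Function.Injective (fderiv ℝ (P.crossingMap a b) 0) := by
  rw [injective_iff_map_eq_zero]
  intro w hw
  rw [P.fderiv_crossingMap h] at hw
  -- the tangent vectors are orthogonal to the radial direction
  have h3 : w.2.2 = 0 := by
    have := congrArg (fun v => inner ℝ (P.lift a) v) hw
    simp only [inner_add_right, inner_smul_right, inner_zero_right, P.inner_lift_deriv a,
      real_inner_self_eq_norm_sq, P.norm_lift] at this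
    rw [show inner ℝ (P.lift a) (deriv P.lift b) = 0 by rw [h]; exact P.inner_lift_deriv b] at this
    linarith
  rw [h3, zero_smul, add_zero] at hw
  have hli := P.transverse a b hab (Subtype.ext h)
  obtain ⟨h1, h2⟩ := LinearIndependent.pair_iff.1 hli _ _ hw
  exact Prod.ext h1 (Prod.ext h2 h3)

/-- The derivative of the parametrisation at a double point as a linear isomorphism. -/
noncomputable def crossingEquiv {a b : ℝ} (h : P.lift a = P.lift b)
    (hab : (a : UnitAddCircle) ≠ b) : (ℝ × ℝ × ℝ) ≃L[ℝ] EuclideanSpace ℝ (Fin 3) :=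
  (LinearEquiv.ofInjectiveOfFinrankEq (fderiv ℝ (P.crossingMap a b) 0).toLinearMap
    (P.fderiv_crossingMap_injective h hab) (by simp)).toContinuousLinearEquiv

theorem hasFDerivAt_crossingMap {a b : ℝ} (h : P.lift a = P.lift b)
    (hab : (a : UnitAddCircle) ≠ b) :
    HasFDerivAt (P.crossingMap a b)
      (P.crossingEquiv h hab : (ℝ × ℝ × ℝ) →L[ℝ] EuclideanSpace ℝ (Fin 3)) 0 := by
  have hd : HasFDerivAt (P.crossingMap a b) (fderiv ℝ (P.crossingMap a b) 0) 0 :=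
    ((P.contDiffAt_crossingMap h).differentiableAt (by norm_num)).hasFDerivAt
  convert hd using 1
  exact ContinuousLinearMap.ext fun w => rfl

/-- The inverse function theorem turns the parametrisation at a double point into a chart of the
sphere in which the two branches are the axes. -/
theorem isCrossingAt {a b : UnitAddCircle} (hab : a ≠ b) (h : P.toFun a = P.toFun b) :
    IsCrossingAt P.toFun a b := by
  obtain ⟨a, -, -, rfl⟩ := exists_unitAddCircle_lift 0 a
  obtain ⟨b, -, -, rfl⟩ := exists_unitAddCircle_lift 0 b
  have hl := P.lift_eq_of_crossing h
  have hO : IsOpen {w : ℝ × ℝ × ℝ | -1 < w.2.2 ∧ P.branchSum a b w ≠ 0} :=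
    (isOpen_lt (f := fun _ : ℝ × ℝ × ℝ => (-1 : ℝ)) continuous_const
      (continuous_snd.comp continuous_snd)).inter
      (isOpen_ne_fun (P.contDiff_branchSum a b).continuous continuous_const)
  let G := ((P.contDiffAt_crossingMap hl).toOpenPartialHomeomorph _
    (P.hasFDerivAt_crossingMap hl hab) (by norm_num)).restrOpen _ hO
  have hGf : ∀ w, G w = P.crossingMap a b w := fun w => rfl
  have h0 : (0 : ℝ × ℝ × ℝ) ∈ G.source :=
    ⟨ContDiffAt.mem_toOpenPartialHomeomorph_source _ _ _, by simp, P.branchSum_ne_zero hl⟩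
  have hG : ∀ w ∈ G.source, (‖G w‖ = 1 ↔ w.2.2 = 0) := by
    intro w hw
    have h1 : -1 < w.2.2 := hw.2.1
    have h2 : ‖P.branchSum a b w‖ ≠ 0 := norm_ne_zero_iff.2 hw.2.2
    rw [hGf, crossingMap, norm_smul, norm_mul, norm_inv, norm_norm, mul_assoc,
      inv_mul_cancel₀ h2, mul_one, Real.norm_of_nonneg (by linarith)]
    constructor <;> intro h <;> linarith
  let Φ := sphereSliceChart (P.toFun a) G hG
  have hG0 : G 0 = P.lift a := by
    have h1 := P.crossingMap_fst hl 0
    rw [add_zero] at h1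
    exact h1
  have hsymm : G.symm (P.toFun a : EuclideanSpace ℝ (Fin 3)) = 0 := by
    have h1 : G.symm (G 0) = 0 := G.left_inv h0
    rw [hG0] at h1
    exact h1
  have hsrc : P.toFun a ∈ Φ.source := by
    change P.lift a ∈ G.target
    rw [← hG0]
    exact G.map_source h0
  have hΦ0 : Φ (P.toFun a) = 0 := by
    change ((G.symm (P.toFun a : EuclideanSpace ℝ (Fin 3))).1,
      (G.symm (P.toFun a : EuclideanSpace ℝ (Fin 3))).2.1) = 0
    rw [hsymm]
    rfl
  have hbranch : ∀ (c : ℝ) (ι : ℝ → ℝ × ℝ × ℝ), Continuous ι → ι 0 = 0 →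
      (∀ s, P.crossingMap a b (ι s) = P.lift (c + s)) →
      ∀ᶠ x in 𝓝 (c : UnitAddCircle), ∃ s : ℝ, x = ((c + s : ℝ) : UnitAddCircle) ∧
        G.symm (P.toFun x : EuclideanSpace ℝ (Fin 3)) = ι s := by
    intro c ι hι hι0 hs
    have h1 : ∀ᶠ s in 𝓝 (0 : ℝ), ι s ∈ G.source := by
      refine hι.continuousAt.eventually (G.open_source.mem_nhds ?_)
      rw [hι0]
      exact h0
    have h2 : ∀ᶠ u in 𝓝 c, ι (u - c) ∈ G.source := by
      have : Filter.Tendsto (fun u : ℝ => u - c) (𝓝 c) (𝓝 0) := by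
        have h : Continuous fun u : ℝ => u - c := by fun_prop
        simpa using h.tendsto c
      exact this.eventually h1
    have h3 : 𝓝 (c : UnitAddCircle) = Filter.map (fun u : ℝ => (u : UnitAddCircle)) (𝓝 c) :=
      (QuotientAddGroup.nhds_eq _ _)
    rw [h3, Filter.eventually_map]
    filter_upwards [h2] with u hu
    refine ⟨u - c, by rw [add_sub_cancel], ?_⟩
    have h4 : G (ι (u - c)) = P.lift u := by rw [hGf, hs, add_sub_cancel]
    have h5 := G.left_inv hu
    rw [h4] at h5
    exact h5
  have ha := hbranch a (fun s => (s, 0, 0)) (by fun_prop) rfl (P.crossingMap_fst hl)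
  have hb := hbranch b (fun s => (0, s, 0)) (by fun_prop) rfl (P.crossingMap_snd a b)
  have hΦa : ∀ᶠ x in 𝓝 (a : UnitAddCircle), (Φ (P.toFun x)).2 = 0 := by
    filter_upwards [ha] with x hx
    obtain ⟨s, -, hs⟩ := hx
    change (G.symm (P.toFun x : EuclideanSpace ℝ (Fin 3))).2.1 = 0
    rw [hs]
  have hΦb : ∀ᶠ x in 𝓝 (b : UnitAddCircle), (Φ (P.toFun x)).1 = 0 := by
    filter_upwards [hb] with x hx
    obtain ⟨s, -, hs⟩ := hx
    change (G.symm (P.toFun x : EuclideanSpace ℝ (Fin 3))).1 = 0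
    rw [hs]
  refine ⟨Φ, ⟨hsrc, hΦ0, ?_⟩, hΦa, hΦb⟩
  have h1 : ∀ᶠ z in 𝓝 (P.toFun a), ∀ x, P.toFun x = z →
      ((Φ (P.toFun x)).1 = 0 ∨ (Φ (P.toFun x)).2 = 0) := by
    refine eventually_fiber P.continuous_toFun _ fun t ht => ?_
    rcases P.no_triple a b t hab h ht.symm with rfl | rfl
    · exact hΦa.mono fun _ h => Or.inr h
    · exact hΦb.mono fun _ h => Or.inl h
  filter_upwards [h1, Φ.open_source.mem_nhds hsrc] with z hz hzs
  constructor
  · rintro ⟨x, rfl⟩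
    exact hz x rfl
  · have h2 : (z : EuclideanSpace ℝ (Fin 3)) ∈ G.target := hzs
    have h3 : G (G.symm z) = z := G.right_inv h2
    have h4 : (G.symm (z : EuclideanSpace ℝ (Fin 3))).2.2 = 0 :=
      (hG _ (G.map_target h2)).1 (by rw [h3]; simp)
    rintro (h5 | h5)
    · change (G.symm (z : EuclideanSpace ℝ (Fin 3))).1 = 0 at h5
      refine ⟨((b + (G.symm (z : EuclideanSpace ℝ (Fin 3))).2.1 : ℝ) : UnitAddCircle),
        Subtype.ext ?_⟩
      refine Eq.trans ?_ h3
      change P.lift _ = P.crossingMap a b _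
      rw [← P.crossingMap_snd a b]
      congr 1
      exact Prod.ext h5.symm (Prod.ext rfl h4.symm)
    · change (G.symm (z : EuclideanSpace ℝ (Fin 3))).2.1 = 0 at h5
      refine ⟨((a + (G.symm (z : EuclideanSpace ℝ (Fin 3))).1 : ℝ) : UnitAddCircle),
        Subtype.ext ?_⟩
      refine Eq.trans ?_ h3
      change P.lift _ = P.crossingMap a b _
      rw [← P.crossingMap_fst hl]
      congr 1
      exact Prod.ext rfl (Prod.ext h5.symm h4.symm)

theorem isGenericCurve : IsGenericCurve P.toFun := by
  refine ⟨P.continuous_toFun, fun a b c hab h h' => P.no_triple a b c hab h h', ?_,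
    fun a b hab h => P.isCrossingAt hab h⟩
  have h1 : (P.toFun ⁻¹' {p : Sphere2 | ∃ a b, a ≠ b ∧ P.toFun a = p ∧ P.toFun b = p}).Finite := by
    refine P.finite_double.preimage' ?_
    rintro _ ⟨a, b, hab, rfl, hb⟩
    refine (Set.toFinite {a, b}).subset fun c hc => ?_
    exact P.no_triple a b c hab hb.symm (Eq.symm hc)
  refine h1.subset ?_
  rintro s ⟨t, hst, h⟩
  exact ⟨s, t, hst, rfl, h.symm⟩

end KnotProjection

/-! ### The planar model of a flype -/

/-- The factor by which a flype stretches the vertical line over `x`: it is `1` outside the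
picture and `-1` in the tangle, it has a pole at the crossing on the left, which is resolved,
and a zero at `x = 2`, where the crossing on the right is created. (Division by zero gives the
value `0` at `x = -2`.) -/
noncomputable def flypeFactor (x : ℝ) : ℝ :=
  max (-1) (min 1 (x - 2)) / max (-1) (min 1 (x + 2))

theorem flypeFactor_of_le {x : ℝ} (h : x ≤ -3) : flypeFactor x = 1 := by
  rw [flypeFactor, min_eq_right (by linarith), min_eq_right (by linarith),
    max_eq_left (by linarith), max_eq_left (by linarith)]
  norm_num

theorem flypeFactor_left {x : ℝ} (h : -3 ≤ x) (h' : x ≤ -1) :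
    flypeFactor x = -(x + 2)⁻¹ := by
  rw [flypeFactor, min_eq_right (by linarith), min_eq_right (by linarith),
    max_eq_left (by linarith), max_eq_right (by linarith)]
  rw [neg_div, one_div]

theorem flypeFactor_mid {x : ℝ} (h : -1 ≤ x) (h' : x ≤ 1) : flypeFactor x = -1 := by
  rw [flypeFactor, min_eq_right (by linarith), min_eq_left (by linarith),
    max_eq_left (by linarith), max_eq_right (by linarith)]
  norm_num

theorem flypeFactor_right {x : ℝ} (h : 1 ≤ x) (h' : x ≤ 3) : flypeFactor x = x - 2 := by
  rw [flypeFactor, min_eq_right (by linarith), min_eq_left (by linarith),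
    max_eq_right (by linarith), max_eq_right (by linarith)]
  rw [div_one]

theorem flypeFactor_of_ge {x : ℝ} (h : 3 ≤ x) : flypeFactor x = 1 := by
  rw [flypeFactor, min_eq_left (by linarith), min_eq_left (by linarith),
    max_eq_right (by linarith)]
  norm_num

theorem flypeFactor_ne_zero {x : ℝ} (h : x ≠ -2) (h' : x ≠ 2) : flypeFactor x ≠ 0 := by
  rcases le_total x (-3) with h1 | h1
  · rw [flypeFactor_of_le h1]; norm_num
  rcases le_total x (-1) with h2 | h2
  · rw [flypeFactor_left h1 h2]
    exact neg_ne_zero.2 (inv_ne_zero fun h0 => h (by linarith))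
  rcases le_total x 1 with h3 | h3
  · rw [flypeFactor_mid h2 h3]; norm_num
  rcases le_total x 3 with h4 | h4
  · rw [flypeFactor_right h3 h4]
    exact fun h0 => h' (by linarith)
  · rw [flypeFactor_of_ge h4]; norm_num

theorem continuousAt_flypeFactor {x : ℝ} (h : x ≠ -2) : ContinuousAt flypeFactor x := by
  refine ContinuousAt.div (by fun_prop) (by fun_prop) ?_
  intro h0
  rcases max_cases (-1 : ℝ) (min 1 (x + 2)) with h1 | h1
  · rw [h1.1] at h0; norm_num at h0
  · rw [h1.1] at h0
    rcases min_cases (1 : ℝ) (x + 2) with h2 | h2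
    · rw [h2.1] at h0; norm_num at h0
    · exact h (by linarith [h2.1])

/-- The map of the plane that carries the picture before the flype to the picture after the
flype. -/
noncomputable def flypeMap (w : ℝ × ℝ) : ℝ × ℝ := (w.1, flypeFactor w.1 * w.2)

theorem flypeMap_outside {w : ℝ × ℝ} (h : w.1 ≤ -3 ∨ 3 ≤ w.1) : flypeMap w = w := by
  rcases h with h | h
  · simp [flypeMap, flypeFactor_of_le h]
  · simp [flypeMap, flypeFactor_of_ge h]

theorem continuousAt_flypeMap {w : ℝ × ℝ} (h : w.1 ≠ -2) : ContinuousAt flypeMap w :=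
  continuousAt_fst.prodMk
    ((ContinuousAt.comp (f := Prod.fst) (continuousAt_flypeFactor h) continuousAt_fst).mul
      continuousAt_snd)

/-- Away from the two vertical lines through the crossings, the map of the flype is a
homeomorphism. -/
noncomputable def flypeHomeomorph : OpenPartialHomeomorph (ℝ × ℝ) (ℝ × ℝ) where
  toFun := flypeMap
  invFun w := (w.1, (flypeFactor w.1)⁻¹ * w.2)
  source := {w | w.1 ≠ -2 ∧ w.1 ≠ 2}
  target := {w | w.1 ≠ -2 ∧ w.1 ≠ 2}
  map_source' _ h := h
  map_target' _ h := h
  left_inv' w h := by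
    have := flypeFactor_ne_zero h.1 h.2
    ext <;> simp [flypeMap, this]
  right_inv' w h := by
    have := flypeFactor_ne_zero h.1 h.2
    ext <;> simp [flypeMap, this]
  open_source := (isOpen_ne_fun continuous_fst continuous_const).inter
    (isOpen_ne_fun continuous_fst continuous_const)
  open_target := (isOpen_ne_fun continuous_fst continuous_const).inter
    (isOpen_ne_fun continuous_fst continuous_const)
  continuousOn_toFun w h := (continuousAt_flypeMap h.1).continuousWithinAt
  continuousOn_invFun w h := by
    have h1 : ContinuousAt (fun w : ℝ × ℝ => flypeFactor w.1) w :=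
      ContinuousAt.comp (f := Prod.fst) (continuousAt_flypeFactor h.1) continuousAt_fst
    exact (continuousAt_fst.prodMk
      ((h1.inv₀ (flypeFactor_ne_zero h.1 h.2)).mul continuousAt_snd)).continuousWithinAt

/-- Coordinates of the plane whose axes are the two diagonals through `(x₀, 0)`. -/
noncomputable def diagonalCoordinates (x₀ : ℝ) : (ℝ × ℝ) ≃ₜ (ℝ × ℝ) where
  toFun w := (w.2 - (w.1 - x₀), w.2 + (w.1 - x₀))
  invFun v := (x₀ + (v.2 - v.1) / 2, (v.1 + v.2) / 2)
  left_inv w := by ext <;> dsimp only <;> ring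
  right_inv v := by ext <;> dsimp only <;> ring
  continuous_toFun := by fun_prop
  continuous_invFun := by fun_prop

/-- The map `e` places in the surface a picture in which `K` consists of a crossing, the tangle `T`
and two parallel strands, and `K'` of two parallel strands, the flipped tangle and a crossing,
while `K` and `K'` agree outside the picture. -/
structure IsFlypePicture {Y : Type*} [TopologicalSpace Y] (e : ℝ × ℝ → Y) (T : Set (ℝ × ℝ))
    (K K' : Set Y) : Prop where
  emb : IsOpenEmbedding e
  bound : ∀ w ∈ T, |w.2| ≤ 2
  left : ∀ w ∈ flypeBox, w.1 ≤ -1 → (e w ∈ K ↔ |w.2| = |w.1 + 2|)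
  left' : ∀ w ∈ flypeBox, w.1 ≤ -1 → (e w ∈ K' ↔ |w.2| = 1)
  mid : ∀ w ∈ flypeBox, -1 ≤ w.1 → w.1 ≤ 1 → (e w ∈ K ↔ w ∈ T)
  mid' : ∀ w ∈ flypeBox, -1 ≤ w.1 → w.1 ≤ 1 → (e w ∈ K' ↔ tangleFlip w ∈ T)
  right : ∀ w ∈ flypeBox, 1 ≤ w.1 → (e w ∈ K ↔ |w.2| = 1)
  right' : ∀ w ∈ flypeBox, 1 ≤ w.1 → (e w ∈ K' ↔ |w.2| = |w.1 - 2|)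
  outside : ∀ z, z ∉ e '' flypeBox → (z ∈ K ↔ z ∈ K')

theorem mem_flypeBox {w : ℝ × ℝ} :
    w ∈ flypeBox ↔ -3 ≤ w.1 ∧ w.1 ≤ 3 ∧ |w.2| ≤ 3 := by
  rw [flypeBox, Set.mem_prod, Set.mem_Icc, Set.mem_Icc, abs_le]
  tauto

theorem isFlypePicture_of_isFlype {Y : Type*} [TopologicalSpace Y] {e : ℝ × ℝ → Y}
    {T : Set (ℝ × ℝ)} {K K' : Set Y} (emb : IsOpenEmbedding e) (hT : T ⊆ tangleBox)
    (hTf : T ∩ frontier tangleBox = tangleEnds)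
    (hK : e ⁻¹' K ∩ flypeBox = leftCrossing ∪ T ∪ rightParallel)
    (hK' : e ⁻¹' K' ∩ flypeBox = leftParallel ∪ tangleFlip '' T ∪ rightCrossing)
    (hout : K \ (e '' flypeBox) = K' \ (e '' flypeBox)) : IsFlypePicture e T K K' := by
  have hTb : ∀ w ∈ T, -1 ≤ w.1 ∧ w.1 ≤ 1 ∧ |w.2| ≤ 2 := fun w hw =>
    ⟨(hT hw).1.1, (hT hw).1.2, abs_le.2 (hT hw).2⟩
  have hends : ∀ w, |w.1| = 1 → (w ∈ T ↔ |w.2| = 1) := by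
    intro w hw
    have hfr : w ∈ tangleBox → w ∈ frontier tangleBox := by
      intro h
      refine ⟨subset_closure h, fun hint => ?_⟩
      rw [tangleBox, interior_prod_eq, interior_Icc, interior_Icc] at hint
      have h1 := abs_lt.2 ⟨hint.1.1, hint.1.2⟩
      linarith
    constructor
    · intro h
      have h1 : w ∈ tangleEnds := hTf ▸ (⟨h, hfr (hT h)⟩ : w ∈ T ∩ frontier tangleBox)
      exact h1.2
    · intro h
      have h1 : w ∈ T ∩ frontier tangleBox := hTf.symm ▸ (⟨hw, h⟩ : w ∈ tangleEnds)
      exact h1.1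
  have hflip : ∀ w, w ∈ tangleFlip '' T ↔ tangleFlip w ∈ T := by
    have hinv : ∀ w, tangleFlip (tangleFlip w) = w := fun w => by simp [tangleFlip]
    intro w
    constructor
    · rintro ⟨v, hv, rfl⟩
      rwa [hinv]
    · exact fun h => ⟨_, h, hinv w⟩
  have memK : ∀ w ∈ flypeBox, (e w ∈ K ↔ w ∈ leftCrossing ∨ w ∈ T ∨ w ∈ rightParallel) := by
    intro w hw
    have := Set.ext_iff.1 hK w
    simp only [Set.mem_inter_iff, Set.mem_preimage, hw, and_true, Set.mem_union] at this
    rw [this, or_assoc]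
  have memK' : ∀ w ∈ flypeBox, (e w ∈ K' ↔ w ∈ leftParallel ∨ tangleFlip w ∈ T ∨
      w ∈ rightCrossing) := by
    intro w hw
    have := Set.ext_iff.1 hK' w
    simp only [Set.mem_inter_iff, Set.mem_preimage, hw, and_true, Set.mem_union, hflip] at this
    rw [this, or_assoc]
  refine ⟨emb, fun w hw => (hTb w hw).2.2, ?_, ?_, ?_, ?_, ?_, ?_, ?_⟩
  · intro w hw h
    have hb := (mem_flypeBox.1 hw)
    rw [memK w hw]
    constructor
    · rintro (h1 | h1 | h1)
      · exact h1.2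
      · have h2 : w.1 = -1 := le_antisymm h (hTb w h1).1
        rw [(hends w (by rw [h2]; norm_num)).1 h1, h2]; norm_num
      · exact absurd h1.1.1 (by linarith)
    · exact fun h1 => Or.inl ⟨⟨hb.1, h⟩, h1⟩
  · intro w hw h
    have hb := (mem_flypeBox.1 hw)
    rw [memK' w hw]
    constructor
    · rintro (h1 | h1 | h1)
      · exact h1.2
      · have h2 : w.1 = -1 := le_antisymm h (hTb _ h1).1
        have h3 := (hends (tangleFlip w) (by simp [tangleFlip, h2])).1 h1
        simpa [tangleFlip] using h3
      · exact absurd h1.1.1 (by linarith)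
    · exact fun h1 => Or.inl ⟨⟨hb.1, h⟩, h1⟩
  · intro w hw h h'
    rw [memK w hw]
    constructor
    · rintro (h1 | h1 | h1)
      · have h2 : w.1 = -1 := le_antisymm h1.1.2 h
        refine (hends w (by rw [h2]; norm_num)).2 ?_
        rw [h1.2, h2]; norm_num
      · exact h1
      · have h2 : w.1 = 1 := le_antisymm h' h1.1.1
        exact (hends w (by rw [h2]; norm_num)).2 h1.2
    · exact fun h1 => Or.inr (Or.inl h1)
  · intro w hw h h'
    rw [memK' w hw]
    constructor
    · rintro (h1 | h1 | h1)
      · have h2 : w.1 = -1 := le_antisymm h1.1.2 h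
        refine (hends _ (by simp [tangleFlip, h2])).2 ?_
        simpa [tangleFlip] using h1.2
      · exact h1
      · have h2 : w.1 = 1 := le_antisymm h' h1.1.1
        refine (hends _ (by simp [tangleFlip, h2])).2 ?_
        have h3 := h1.2
        rw [h2] at h3
        simp only [tangleFlip, abs_neg]
        rw [h3]; norm_num
    · exact fun h1 => Or.inr (Or.inl h1)
  · intro w hw h
    have hb := (mem_flypeBox.1 hw)
    rw [memK w hw]
    constructor
    · rintro (h1 | h1 | h1)
      · exact absurd h1.1.2 (by linarith)
      · have h2 : w.1 = 1 := le_antisymm (hTb _ h1).2.1 h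
        exact (hends w (by rw [h2]; norm_num)).1 h1
      · exact h1.2
    · exact fun h1 => Or.inr (Or.inr ⟨⟨h, hb.2.1⟩, h1⟩)
  · intro w hw h
    have hb := (mem_flypeBox.1 hw)
    rw [memK' w hw]
    constructor
    · rintro (h1 | h1 | h1)
      · exact absurd h1.1.2 (by linarith)
      · have h2 : w.1 = 1 := le_antisymm (hTb _ h1).2.1 h
        have h3 := (hends _ (by simp [tangleFlip, h2])).1 h1
        simp only [tangleFlip, abs_neg] at h3
        rw [h3, h2]; norm_num
      · exact h1.2
    · exact fun h1 => Or.inr (Or.inr ⟨⟨h, hb.2.1⟩, h1⟩)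
  · intro z hz
    have := Set.ext_iff.1 hout z
    simpa only [Set.mem_sdiff, hz, not_false_iff, and_true] using this

/-! ### The flype as a map of the surface -/

namespace IsFlypePicture

variable {Y : Type*} [TopologicalSpace Y] {e : ℝ × ℝ → Y} {T : Set (ℝ × ℝ)} {K K' : Set Y}

theorem eventually_exists (hp : IsFlypePicture e T K K') {w : ℝ × ℝ} {p : ℝ × ℝ → Prop}
    (h : ∀ᶠ v in 𝓝 w, p v) : ∀ᶠ z in 𝓝 (e w), ∃ v, z = e v ∧ p v := by
  rw [← hp.emb.map_nhds_eq, Filter.eventually_map]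
  exact h.mono fun v hv => ⟨v, rfl, hv⟩

/-- The coordinates of the plane as a chart of the surface. -/
noncomputable def chart (hp : IsFlypePicture e T K K') : OpenPartialHomeomorph Y (ℝ × ℝ) :=
  (hp.emb.toOpenPartialHomeomorph e).symm

theorem chart_apply (hp : IsFlypePicture e T K K') (w : ℝ × ℝ) : hp.chart (e w) = w :=
  hp.emb.toOpenPartialHomeomorph_left_inv e

theorem mem_chart_source (hp : IsFlypePicture e T K K') (w : ℝ × ℝ) : e w ∈ hp.chart.source := by
  simp [chart]

theorem isAxesChart_diagonal (hp : IsFlypePicture e T K K') {S : Set Y} {x₀ : ℝ}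
    (h : ∀ᶠ w in 𝓝 (x₀, (0 : ℝ)), (e w ∈ S ↔ |w.2| = |w.1 - x₀|)) :
    IsAxesChart S (e (x₀, 0))
      (hp.chart.trans (diagonalCoordinates x₀).toOpenPartialHomeomorph) := by
  refine ⟨?_, ?_, ?_⟩
  · simp [hp.mem_chart_source]
  · simp [hp.chart_apply, diagonalCoordinates]
  · filter_upwards [hp.eventually_exists h] with z hz
    obtain ⟨w, rfl, hw⟩ := hz
    rw [hw, abs_eq_abs]
    simp only [OpenPartialHomeomorph.coe_trans, Function.comp_apply, hp.chart_apply,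
      Homeomorph.toOpenPartialHomeomorph_apply, diagonalCoordinates, Homeomorph.homeomorph_mk_coe,
      Equiv.coe_fn_mk]
    constructor
    · rintro (h | h)
      · left; linarith
      · right; linarith
    · rintro (h | h)
      · left; linarith
      · right; linarith

/-- Points of `K` in the picture that are not the crossing do not lie over `-2`. -/
theorem fst_ne (hp : IsFlypePicture e T K K') {w : ℝ × ℝ} (hw : w ∈ flypeBox) (hK : e w ∈ K)
    (hc : e w ≠ e (-2, 0)) : w.1 ≠ -2 := by
  intro h
  have h1 := (hp.left w hw (by linarith)).1 hK
  rw [h] at h1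
  norm_num at h1
  exact hc (congrArg e (Prod.ext h h1))

theorem abs_snd_le (hp : IsFlypePicture e T K K') {w : ℝ × ℝ} (hw : w ∈ flypeBox)
    (hK : e w ∈ K) : |w.2| ≤ 2 := by
  obtain ⟨b1, b2, -⟩ := mem_flypeBox.1 hw
  rcases le_total w.1 (-1) with h2 | h2
  · rw [(hp.left w hw h2).1 hK, abs_le]
    constructor <;> linarith
  rcases le_total w.1 1 with h3 | h3
  · exact hp.bound w ((hp.mid w hw h2 h3).1 hK)
  · rw [(hp.right w hw h3).1 hK]; norm_num

theorem flypeMap_mem (hp : IsFlypePicture e T K K') {w : ℝ × ℝ} (hw : w ∈ flypeBox) (hK : e w ∈ K)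
    (h2 : w.1 ≠ -2) : |(flypeMap w).2| ≤ 2 ∧ flypeMap w ∈ flypeBox ∧ e (flypeMap w) ∈ K' := by
  obtain ⟨b1, b2, b3⟩ := mem_flypeBox.1 hw
  have hbox : |(flypeMap w).2| ≤ 2 → flypeMap w ∈ flypeBox := fun h =>
    mem_flypeBox.2 ⟨b1, b2, by linarith⟩
  rcases le_total w.1 (-1) with i | i
  · have h0 : w.1 + 2 ≠ 0 := fun h => h2 (by linarith)
    have h1 : |(flypeMap w).2| = 1 := by
      rw [flypeMap, flypeFactor_left b1 i, abs_mul, abs_neg, abs_inv, (hp.left w hw i).1 hK]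
      exact inv_mul_cancel₀ (abs_ne_zero.2 h0)
    have h3 : |(flypeMap w).2| ≤ 2 := by rw [h1]; norm_num
    exact ⟨h3, hbox h3, (hp.left' _ (hbox h3) i).2 h1⟩
  rcases le_total w.1 1 with j | j
  · have h1 : flypeMap w = tangleFlip w := by
      simp [flypeMap, flypeFactor_mid i j, tangleFlip]
    have h3 : |(flypeMap w).2| ≤ 2 := by
      rw [h1, tangleFlip, abs_neg]
      exact hp.abs_snd_le hw hK
    refine ⟨h3, hbox h3, (hp.mid' _ (hbox h3) i j).2 ?_⟩
    rw [h1]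
    simpa [tangleFlip] using (hp.mid w hw i j).1 hK
  · have h1 : |(flypeMap w).2| = |w.1 - 2| := by
      rw [flypeMap, flypeFactor_right j b2, abs_mul, (hp.right w hw j).1 hK, mul_one]
    have h3 : |(flypeMap w).2| ≤ 2 := by
      rw [h1, abs_le]; constructor <;> linarith
    exact ⟨h3, hbox h3, (hp.right' _ (hbox h3) j).2 h1⟩

theorem exists_flypeMap_eq (hp : IsFlypePicture e T K K') {w : ℝ × ℝ} (hw : w ∈ flypeBox)
    (hK : e w ∈ K') (h2 : w.1 ≠ -2) : ∃ v ∈ flypeBox, e v ∈ K ∧ v.1 = w.1 ∧ flypeMap v = w := by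
  obtain ⟨b1, b2, b3⟩ := mem_flypeBox.1 hw
  rcases le_total w.1 (-1) with i | i
  · have h0 : w.1 + 2 ≠ 0 := fun h => h2 (by linarith)
    have h1 := (hp.left' w hw i).1 hK
    have h3 : |-(w.1 + 2) * w.2| = |w.1 + 2| := by rw [abs_mul, h1, abs_neg, mul_one]
    have hb : (w.1, -(w.1 + 2) * w.2) ∈ flypeBox := by
      refine mem_flypeBox.2 ⟨b1, b2, ?_⟩
      rw [h3, abs_le]; constructor <;> linarith
    refine ⟨_, hb, (hp.left _ hb i).2 h3, rfl, Prod.ext rfl ?_⟩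
    rw [flypeMap, flypeFactor_left b1 i]
    field_simp
  rcases le_total w.1 1 with j | j
  · have hb : tangleFlip w ∈ flypeBox :=
      mem_flypeBox.2 ⟨b1, b2, by rw [tangleFlip, abs_neg]; exact b3⟩
    refine ⟨_, hb, (hp.mid _ hb i j).2 ((hp.mid' w hw i j).1 hK), rfl, ?_⟩
    have h1 : flypeFactor (tangleFlip w).1 = -1 := flypeFactor_mid i j
    rw [flypeMap, h1]
    simp [tangleFlip]
  · have h1 := (hp.right' w hw j).1 hK
    by_cases h3 : w.1 = 2
    · have hb : (w.1, (1 : ℝ)) ∈ flypeBox := mem_flypeBox.2 ⟨b1, b2, by norm_num⟩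
      refine ⟨_, hb, (hp.right _ hb j).2 (by norm_num), rfl, Prod.ext rfl ?_⟩
      rw [h3] at h1
      norm_num at h1
      rw [flypeMap, flypeFactor_right j b2, h1, h3]
      norm_num
    · have h0 : w.1 - 2 ≠ 0 := sub_ne_zero.2 h3
      have h4 : |(w.1 - 2)⁻¹ * w.2| = 1 := by
        rw [abs_mul, abs_inv, h1]
        exact inv_mul_cancel₀ (abs_ne_zero.2 h0)
      have hb : (w.1, (w.1 - 2)⁻¹ * w.2) ∈ flypeBox :=
        mem_flypeBox.2 ⟨b1, b2, by rw [h4]; norm_num⟩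
      refine ⟨_, hb, (hp.right _ hb j).2 h4, rfl, Prod.ext rfl ?_⟩
      rw [flypeMap, flypeFactor_right j b2]
      field_simp

theorem mem_iff_flypeMap_mem (hp : IsFlypePicture e T K K') {w : ℝ × ℝ} (h2 : w.1 ≠ -2)
    (h2' : w.1 ≠ 2) (hy : |w.2| < 3) (hy' : |(flypeMap w).2| < 3) :
    e w ∈ K ↔ e (flypeMap w) ∈ K' := by
  by_cases hw : w ∈ flypeBox
  · constructor
    · exact fun h => (hp.flypeMap_mem hw h h2).2.2
    · intro h
      obtain ⟨b1, b2, -⟩ := mem_flypeBox.1 hw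
      obtain ⟨v, hv, hvK, h3, h4⟩ := hp.exists_flypeMap_eq (w := flypeMap w)
        (mem_flypeBox.2 ⟨b1, b2, hy'.le⟩) h h2
      have h5 : v = w := by
        refine flypeHomeomorph.injOn ⟨?_, ?_⟩ ⟨h2, h2'⟩ h4
        · exact h3.symm ▸ h2
        · exact h3.symm ▸ h2'
      rwa [← h5]
  · have hout : w.1 ≤ -3 ∨ 3 ≤ w.1 := by
      by_contra! h
      exact hw (mem_flypeBox.2 ⟨h.1.le, h.2.le, hy.le⟩)
    rw [flypeMap_outside hout]
    refine hp.outside _ ?_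
    rintro ⟨v, hv, hvw⟩
    exact hw (hp.emb.injective hvw ▸ hv)

open Classical in
/-- The map of the flype on the surface: the planar map inside the picture, the identity
outside. It is meaningful on `K` without the crossing. -/
noncomputable def move (hp : IsFlypePicture e T K K') (z : Y) : Y :=
  if z ∈ e '' flypeBox then e (flypeMap (hp.chart z)) else z

theorem move_apply (hp : IsFlypePicture e T K K') {w : ℝ × ℝ} (hw : w ∈ flypeBox) :
    hp.move (e w) = e (flypeMap w) := by
  rw [move, if_pos ⟨w, hw, rfl⟩, hp.chart_apply]

theorem move_of_notMem (hp : IsFlypePicture e T K K') {z : Y} (hz : z ∉ e '' flypeBox) :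
    hp.move z = z := if_neg hz

theorem eventually_move_eq (hp : IsFlypePicture e T K K') {w : ℝ × ℝ} (hw : |w.2| < 3) :
    ∀ᶠ z in 𝓝 (e w), hp.move z = e (flypeMap (hp.chart z)) := by
  have h : ∀ᶠ v : ℝ × ℝ in 𝓝 w, |v.2| < 3 :=
    (continuous_abs.comp continuous_snd).continuousAt.eventually (gt_mem_nhds hw)
  filter_upwards [hp.eventually_exists h] with z hz
  obtain ⟨v, rfl, hv⟩ := hz
  by_cases hb : v ∈ flypeBox
  · rw [hp.move_apply hb, hp.chart_apply]
  · have hout : v.1 ≤ -3 ∨ 3 ≤ v.1 := by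
      by_contra! h
      exact hb (mem_flypeBox.2 ⟨h.1.le, h.2.le, hv.le⟩)
    rw [hp.chart_apply, flypeMap_outside hout]
    refine hp.move_of_notMem ?_
    rintro ⟨u, hu, huv⟩
    exact hb (hp.emb.injective huv ▸ hu)

theorem isClosed_box [T2Space Y] (hp : IsFlypePicture e T K K') : IsClosed (e '' flypeBox) :=
  ((isCompact_Icc.prod isCompact_Icc).image hp.emb.continuous).isClosed

theorem eventually_notMem_box [T2Space Y] (hp : IsFlypePicture e T K K') {z : Y}
    (hz : z ∉ e '' flypeBox) :
    ∀ᶠ z' in 𝓝 z, z' ∉ e '' flypeBox := hp.isClosed_box.isOpen_compl.mem_nhds hz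

theorem continuousAt_move [T2Space Y] (hp : IsFlypePicture e T K K') {z : Y} (hz : z ∈ K)
    (hc : z ≠ e (-2, 0)) : ContinuousAt hp.move z := by
  by_cases hb : z ∈ e '' flypeBox
  · obtain ⟨w, hw, rfl⟩ := hb
    have h1 := hp.fst_ne hw hz hc
    have h2 := hp.eventually_move_eq (w := w) (by linarith [hp.abs_snd_le hw hz])
    refine ContinuousAt.congr_of_eventuallyEq ?_ h2
    have h3 : ContinuousAt hp.chart (e w) := hp.chart.continuousAt (hp.mem_chart_source w)
    have h4 : ContinuousAt flypeMap (hp.chart (e w)) := by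
      rw [hp.chart_apply]; exact continuousAt_flypeMap h1
    exact hp.emb.continuous.continuousAt.comp (ContinuousAt.comp (f := hp.chart) h4 h3)
  · exact continuousAt_id.congr_of_eventuallyEq
      ((hp.eventually_notMem_box hb).mono fun z' h => hp.move_of_notMem h)

theorem move_mem (hp : IsFlypePicture e T K K') {z : Y} (hz : z ∈ K) (hc : z ≠ e (-2, 0)) :
    hp.move z ∈ K' := by
  by_cases hb : z ∈ e '' flypeBox
  · obtain ⟨w, hw, rfl⟩ := hb
    rw [hp.move_apply hw]
    exact (hp.flypeMap_mem hw hz (hp.fst_ne hw hz hc)).2.2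
  · rw [hp.move_of_notMem hb]
    exact (hp.outside z hb).1 hz

/-- The map of the flype is injective on `K` without the crossing, except that it identifies the
two points of the parallel strands over `2`. -/
theorem eq_of_move_eq (hp : IsFlypePicture e T K K') {z z' : Y} (hz : z ∈ K)
    (hc : z ≠ e (-2, 0)) (hz' : z' ∈ K) (hc' : z' ≠ e (-2, 0)) (h : hp.move z = hp.move z') :
    z = z' ∨ ((z = e (2, 1) ∨ z = e (2, -1)) ∧ (z' = e (2, 1) ∨ z' = e (2, -1))) := by
  have hin : ∀ w ∈ flypeBox, e w ∈ K → e w ≠ e (-2, 0) → hp.move (e w) ∈ e '' flypeBox := by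
    intro w hw hK hc
    rw [hp.move_apply hw]
    exact ⟨_, (hp.flypeMap_mem hw hK (hp.fst_ne hw hK hc)).2.1, rfl⟩
  by_cases hb : z ∈ e '' flypeBox <;> by_cases hb' : z' ∈ e '' flypeBox
  · obtain ⟨w, hw, rfl⟩ := hb
    obtain ⟨w', hw', rfl⟩ := hb'
    rw [hp.move_apply hw, hp.move_apply hw'] at h
    have h1 := hp.emb.injective h
    have h2 : (flypeMap w).1 = (flypeMap w').1 := congrArg Prod.fst h1
    change w.1 = w'.1 at h2
    by_cases h3 : w.1 = 2
    · right
      have key : ∀ v ∈ flypeBox, e v ∈ K → v.1 = 2 → (e v = e (2, 1) ∨ e v = e (2, -1)) := by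
        intro v hv hvK hv2
        have := (hp.right v hv (by linarith)).1 hvK
        rcases (abs_eq (by norm_num)).1 this with h | h
        · left; exact congrArg e (Prod.ext hv2 h)
        · right; exact congrArg e (Prod.ext hv2 h)
      exact ⟨key w hw hz h3, key w' hw' hz' (h2 ▸ h3)⟩
    · left
      exact congrArg e (flypeHomeomorph.injOn ⟨hp.fst_ne hw hz hc, h3⟩
        ⟨hp.fst_ne hw' hz' hc', h2 ▸ h3⟩ h1)
  · obtain ⟨w, hw, rfl⟩ := hb
    have h1 := hin w hw hz hc
    rw [h, hp.move_of_notMem hb'] at h1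
    exact absurd h1 hb'
  · obtain ⟨w, hw, rfl⟩ := hb'
    have h1 := hin w hw hz' hc'
    rw [← h, hp.move_of_notMem hb] at h1
    exact absurd h1 hb
  · rw [hp.move_of_notMem hb, hp.move_of_notMem hb'] at h
    exact Or.inl h

theorem move_ne (hp : IsFlypePicture e T K K') {z : Y} (hz : z ∈ K) (hc : z ≠ e (-2, 0)) {y : ℝ}
    (hy : |y| = 1) : hp.move z ≠ e (-2, y) := by
  intro h
  by_cases hb : z ∈ e '' flypeBox
  · obtain ⟨w, hw, rfl⟩ := hb
    rw [hp.move_apply hw] at h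
    exact hp.fst_ne hw hz hc (congrArg Prod.fst (hp.emb.injective h))
  · rw [hp.move_of_notMem hb] at h
    exact hb ⟨_, mem_flypeBox.2 ⟨by norm_num, by norm_num, by rw [hy]; norm_num⟩, h.symm⟩

theorem exists_move_eq (hp : IsFlypePicture e T K K') {z : Y} (hz : z ∈ K')
    (h1 : z ≠ e (-2, 1)) (h1' : z ≠ e (-2, -1)) :
    ∃ y ∈ K, y ≠ e (-2, 0) ∧ hp.move y = z := by
  by_cases hb : z ∈ e '' flypeBox
  · obtain ⟨w, hw, rfl⟩ := hb
    have h2 : w.1 ≠ -2 := by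
      intro h
      have h3 := (hp.left' w hw (by linarith)).1 hz
      rcases (abs_eq (by norm_num)).1 h3 with h4 | h4
      · exact h1 (congrArg e (Prod.ext h h4))
      · exact h1' (congrArg e (Prod.ext h h4))
    obtain ⟨v, hv, hvK, h3, h4⟩ := hp.exists_flypeMap_eq hw hz h2
    refine ⟨e v, hvK, ?_, by rw [hp.move_apply hv, h4]⟩
    intro h
    exact h2 (h3 ▸ congrArg Prod.fst (hp.emb.injective h))
  · refine ⟨z, (hp.outside z hb).2 hz, ?_, hp.move_of_notMem hb⟩
    rintro rfl
    exact hb ⟨_, mem_flypeBox.2 ⟨by norm_num, by norm_num, by norm_num⟩, rfl⟩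

end IsFlypePicture

/-! ### The curve after the flype -/

theorem IsCrossingAt.symm {Y : Type*} [TopologicalSpace Y] {α : UnitAddCircle → Y}
    {a b : UnitAddCircle} (h : IsCrossingAt α a b) (hab : α a = α b) : IsCrossingAt α b a := by
  obtain ⟨Φ, hΦ, h1, h2⟩ := h
  refine ⟨Φ.trans (Homeomorph.prodComm ℝ ℝ).toOpenPartialHomeomorph, ⟨?_, ?_, ?_⟩, ?_, ?_⟩
  · rw [← hab]; simpa using hΦ.mem_source
  · rw [← hab]; simp [hΦ.map_eq_zero]
  · rw [← hab]
    filter_upwards [hΦ.mem_iff] with z hz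
    rw [hz, or_comm]
    rfl
  · exact h2
  · exact h1

/-- The parameters of a generic curve `α` that runs through the picture of a flype: `a` and `a'`
are the parameters of the crossing, on the rising and on the falling strand, and `b` and `b'` are
the parameters of the points of the upper and the lower parallel strand over which the new crossing
is created. -/
structure IsFlypeParameters {Y : Type*} (e : ℝ × ℝ → Y) (α : UnitAddCircle → Y)
    (a a' b b' : UnitAddCircle) : Prop where
  ne : a ≠ a'
  map_a : α a = e (-2, 0)
  map_a' : α a' = e (-2, 0)
  near_a : ∀ᶠ s in 𝓝 a, ∃ w : ℝ × ℝ, α s = e w ∧ w.2 = w.1 + 2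
  near_a' : ∀ᶠ s in 𝓝 a', ∃ w : ℝ × ℝ, α s = e w ∧ w.2 = -(w.1 + 2)
  map_b : α b = e (2, 1)
  map_b' : α b' = e (2, -1)
  eq_b : ∀ s, α s = e (2, 1) → s = b
  eq_b' : ∀ s, α s = e (2, -1) → s = b'

theorem IsFlypeParameters.eq_of_map_eq {Y : Type*} {e : ℝ × ℝ → Y} {α : UnitAddCircle → Y}
    {a a' b b' : UnitAddCircle} (hs : IsFlypeParameters e α a a' b b') {s t : UnitAddCircle}
    (h : s = b ∨ s = b') (hst : α s = α t) : s = t := by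
  rcases h with rfl | rfl
  · exact (hs.eq_b t (hst ▸ hs.map_b)).symm
  · exact (hs.eq_b' t (hst ▸ hs.map_b')).symm

namespace IsFlypePicture

variable {Y : Type*} [TopologicalSpace Y] {e : ℝ × ℝ → Y} {T : Set (ℝ × ℝ)} {K' : Set Y}
  {α : UnitAddCircle → Y}

theorem eventually_coord (hp : IsFlypePicture e T (Set.range α) K') (hα : Continuous α)
    {s : UnitAddCircle} {w : ℝ × ℝ} (hs : α s = e w) {p : ℝ × ℝ → Prop} (h : ∀ᶠ v in 𝓝 w, p v) :
    ∀ᶠ s' in 𝓝 s, ∃ v, α s' = e v ∧ p v :=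
  hα.continuousAt.eventually (hs ▸ hp.eventually_exists h)

/-- The two branches at the crossing of the picture run straight through it. -/
theorem exists_crossing_parameters [T2Space Y]
    (hp : IsFlypePicture e T (Set.range α) K') (hα : IsGenericCurve α) :
    ∃ a a' : UnitAddCircle, a ≠ a' ∧ α a = e (-2, 0) ∧ α a' = e (-2, 0) ∧ (∀ᶠ s in 𝓝 a, ∃ w : ℝ × ℝ, α s = e w ∧ w.2 = w.1 + 2) ∧
      ∀ᶠ s in 𝓝 a', ∃ w : ℝ × ℝ, α s = e w ∧ w.2 = -(w.1 + 2) := by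
  have hin : ∀ u ∈ Set.Ioo (-1 : ℝ) 1, ∀ v, |v| = |u| → e (-2 + u, v) ∈ Set.range α := by
    intro u hu v hv
    have h1 : |u| < 1 := abs_lt.2 hu
    refine (hp.left _ (mem_flypeBox.2 ⟨?_, ?_, ?_⟩) ?_).2 ?_
    · linarith [hu.1]
    · linarith [hu.2]
    · dsimp only; linarith
    · linarith [hu.2]
    · dsimp only; rw [hv]; congr 1; ring
  obtain ⟨t, ht⟩ : e (-2, 0) ∈ Set.range α := by
    have := hin 0 (by norm_num) 0 rfl
    simpa using this
  obtain ⟨t', hne, ht'⟩ := hα.exists_ne_of_arcs t (Ioo_mem_nhds (by norm_num) (by norm_num))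
    (y := e (-2, 0)) (U := Set.Ioo (-1 : ℝ) 1)
    (γ₁ := fun u => e (-2 + u, u)) (γ₂ := fun u => e (-2 + u, -u))
    (hp.emb.continuous.comp (by fun_prop)).continuousOn
    (fun u _ v _ h => congrArg Prod.snd (hp.emb.injective h)) (by simp)
    (fun u hu => hin u hu u rfl)
    (hp.emb.continuous.comp (by fun_prop)).continuousOn
    (fun u _ v _ h => by
      have : -u = -v := congrArg Prod.snd (hp.emb.injective h)
      linarith) (by simp)
    (fun u hu => hin u hu (-u) (abs_neg u)) (by
      intro u _ v _ h
      have h1 : u = -v := congrArg Prod.snd (hp.emb.injective h)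
      have h2 : -2 + u = -2 + v := congrArg Prod.fst (hp.emb.injective h)
      left; linarith)
  obtain ⟨Φ, hΦ, h1, h2⟩ := hα.crossing t t' hne.symm (ht.trans ht'.symm)
  rw [ht] at hΦ
  have hax := hp.isAxesChart_diagonal (S := Set.range α) (x₀ := -2) (by
    have h1 : ∀ᶠ w : ℝ × ℝ in 𝓝 (-2, 0), w ∈ Set.Ioo (-3 : ℝ) (-1) ×ˢ Set.Ioo (-3 : ℝ) 3 :=
      (isOpen_Ioo.prod isOpen_Ioo).mem_nhds (by constructor <;> norm_num)
    filter_upwards [h1] with w hw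
    have h2 := hp.left w (mem_flypeBox.2 ⟨hw.1.1.le, by linarith [hw.1.2], (abs_lt.2 hw.2).le⟩)
      hw.1.2.le
    rw [h2, sub_neg_eq_add])
  -- reading off the strand from the second chart
  have hread : ∀ s : UnitAddCircle, α s = e (-2, 0) → ∀ᶠ u in 𝓝 s,
      ((((hp.chart.trans (diagonalCoordinates (-2)).toOpenPartialHomeomorph) (α u)).1 = 0 →
        ∃ w : ℝ × ℝ, α u = e w ∧ w.2 = w.1 + 2) ∧
      (((hp.chart.trans (diagonalCoordinates (-2)).toOpenPartialHomeomorph) (α u)).2 = 0 →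
        ∃ w : ℝ × ℝ, α u = e w ∧ w.2 = -(w.1 + 2))) := by
    intro s hs
    filter_upwards [hp.eventually_coord hα.continuous hs (p := fun _ => True) (by simp)] with u hu
    obtain ⟨w, hw, -⟩ := hu
    rw [hw]
    simp only [OpenPartialHomeomorph.coe_trans, Function.comp_apply, hp.chart_apply,
      Homeomorph.toOpenPartialHomeomorph_apply, diagonalCoordinates, Homeomorph.homeomorph_mk_coe,
      Equiv.coe_fn_mk]
    exact ⟨fun h => ⟨w, rfl, by linarith⟩, fun h => ⟨w, rfl, by linarith⟩⟩
  have hct := hα.continuous.tendsto t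
  have hct' := hα.continuous.tendsto t'
  rw [ht] at hct
  rw [ht'] at hct'
  rcases hΦ.eventually_axes hax with ⟨h3, h4⟩ | ⟨h3, h4⟩
  · refine ⟨t', t, hne, ht', ht, ?_, ?_⟩
    · filter_upwards [hread t' ht', h2, hct'.eventually h4] with u k1 k2 k3
      exact k1.1 (k3 k2)
    · filter_upwards [hread t ht, h1, hct.eventually h3] with u k1 k2 k3
      exact k1.2 (k3 k2)
  · refine ⟨t, t', hne.symm, ht, ht', ?_, ?_⟩
    · filter_upwards [hread t ht, h1, hct.eventually h3] with u k1 k2 k3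
      exact k1.1 (k3 k2)
    · filter_upwards [hread t' ht', h2, hct'.eventually h4] with u k1 k2 k3
      exact k1.2 (k3 k2)

/-- Near a parameter of a point of a parallel strand, the curve runs in this strand. -/
theorem eventually_parallel (hp : IsFlypePicture e T (Set.range α) K') (hα : Continuous α)
    {y : ℝ} (hy : |y| = 1) {s : UnitAddCircle} (hs : α s = e (2, y)) :
    ∀ᶠ u in 𝓝 s, ∃ w : ℝ × ℝ, α u = e w ∧ 1 < w.1 ∧ w.1 < 3 ∧ w.2 = y := by
  have h1 : ∀ᶠ w : ℝ × ℝ in 𝓝 (2, y),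
      w ∈ Set.Ioo (1 : ℝ) 3 ×ˢ Set.Ioo (y - 1) (y + 1) := by
    refine (isOpen_Ioo.prod isOpen_Ioo).mem_nhds ⟨by constructor <;> norm_num, ?_⟩
    exact ⟨by linarith, by linarith⟩
  filter_upwards [hp.eventually_coord hα hs h1] with u hu
  obtain ⟨w, hw, hw1, hw2⟩ := hu
  refine ⟨w, hw, hw1.1, hw1.2, ?_⟩
  have hyb := abs_le.1 hy.le
  have hb : w ∈ flypeBox := mem_flypeBox.2 ⟨by linarith [hw1.1], hw1.2.le,
    abs_le.2 ⟨by linarith [hw2.1], by linarith [hw2.2]⟩⟩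
  have h2 := (hp.right w hb hw1.1.le).1 (hw ▸ ⟨u, rfl⟩)
  rcases (abs_eq (by norm_num)).1 h2 with h3 | h3 <;>
    rcases (abs_eq (by norm_num)).1 hy with h4 | h4
  · rw [h3, h4]
  · exfalso; linarith [hw2.2]
  · exfalso; linarith [hw2.1]
  · rw [h3, h4]

/-- The points of the parallel strands over `2` are simple points of the curve. -/
theorem eq_of_parallel (hp : IsFlypePicture e T (Set.range α) K') (hα : IsGenericCurve α)
    {y : ℝ} (hy : |y| = 1) {s t : UnitAddCircle} (hs : α s = e (2, y)) (ht : α t = e (2, y)) :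
    s = t := by
  by_contra hne
  obtain ⟨a, -, -, rfl⟩ := exists_unitAddCircle_lift 0 s
  obtain ⟨b, -, -, rfl⟩ := exists_unitAddCircle_lift 0 t
  obtain ⟨U, hU, h1, h2, h3⟩ := hα.exists_branches hne
  have hnear : ∀ c : ℝ, α c = e (2, y) → ∀ᶠ u in 𝓝 (0 : ℝ),
      ∃ w : ℝ × ℝ, α (c + u : ℝ) = e w ∧ w.2 = y := by
    intro c hc
    have hct : Filter.Tendsto (fun u : ℝ => ((c + u : ℝ) : UnitAddCircle)) (𝓝 0) (𝓝 c) := by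
      have : Continuous fun u : ℝ => ((c + u : ℝ) : UnitAddCircle) :=
        (AddCircle.continuous_mk' 1).comp (continuous_const.add continuous_id)
      have h := this.tendsto 0
      rwa [add_zero] at h
    filter_upwards [hct.eventually (hp.eventually_parallel hα.continuous hy hc)] with u hu
    obtain ⟨w, hw, -, -, hw2⟩ := hu
    exact ⟨w, hw, hw2⟩
  have hN := Filter.inter_mem hU (Filter.inter_mem (hnear a hs) (hnear b ht))
  -- the horizontal coordinates of the two branches
  have hcont : ∀ c : ℝ, (∀ u ∈ U ∩ ({u | ∃ w : ℝ × ℝ, α (a + u : ℝ) = e w ∧ w.2 = y} ∩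
      {u | ∃ w : ℝ × ℝ, α (b + u : ℝ) = e w ∧ w.2 = y}), ∃ w : ℝ × ℝ, α (c + u : ℝ) = e w) →
      ContinuousOn (fun u : ℝ => (hp.chart (α (c + u : ℝ))).1)
        (U ∩ ({u | ∃ w : ℝ × ℝ, α (a + u : ℝ) = e w ∧ w.2 = y} ∩
          {u | ∃ w : ℝ × ℝ, α (b + u : ℝ) = e w ∧ w.2 = y})) := by
    intro c hc
    refine continuous_fst.comp_continuousOn (hp.chart.continuousOn.comp
      (continuous_comp_coe_add hα.continuous c).continuousOn fun u hu => ?_)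
    obtain ⟨w, hw⟩ := hc u hu
    rw [hw]
    exact hp.mem_chart_source w
  have hval : ∀ z z' : Y, (∃ w : ℝ × ℝ, z = e w ∧ w.2 = y) → (∃ w : ℝ × ℝ, z' = e w ∧ w.2 = y) →
      (hp.chart z).1 = (hp.chart z').1 → z = z' := by
    rintro _ _ ⟨w, rfl, hw⟩ ⟨w', rfl, hw'⟩ h
    rw [hp.chart_apply, hp.chart_apply] at h
    exact congrArg e (Prod.ext h (hw.trans hw'.symm))
  obtain ⟨u, hu, v, hv, hu0, hv0, huv⟩ := exists_common_value_real hN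
    (f := fun u : ℝ => (hp.chart (α (a + u : ℝ))).1)
    (g := fun u : ℝ => (hp.chart (α (b + u : ℝ))).1)
    (hcont a fun u hu => hu.2.1.imp fun w hw => hw.1)
    (fun u hu v hv h => h1 hu.1 hv.1 (hval _ _ hu.2.1 hv.2.1 h))
    (hcont b fun u hu => hu.2.2.imp fun w hw => hw.1)
    (fun u hu v hv h => h2 hu.1 hv.1 (hval _ _ hu.2.2 hv.2.2 h))
    (by simp only [add_zero, hs, ht])
  rcases h3 u hu.1 v hv.1 (hval _ _ hu.2.1 hv.2.2 huv) with h | h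
  · exact hu0 h
  · exact hv0 h

theorem exists_parameters [T2Space Y] (hp : IsFlypePicture e T (Set.range α) K')
    (hα : IsGenericCurve α) :
    ∃ a a' b b', IsFlypeParameters e α a a' b b' := by
  obtain ⟨a, a', h1, h2, h3, h4, h5⟩ := hp.exists_crossing_parameters hα
  have hin : ∀ y : ℝ, |y| = 1 → e (2, y) ∈ Set.range α := fun y hy =>
    (hp.right _ (mem_flypeBox.2 ⟨by norm_num, by norm_num, by dsimp only; rw [hy]; norm_num⟩)
      (by norm_num)).2 hy
  obtain ⟨b, hb⟩ := hin 1 (by norm_num)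
  obtain ⟨b', hb'⟩ := hin (-1) (by norm_num)
  exact ⟨a, a', b, b', h1, h2, h3, h4, h5, hb, hb',
    fun s hs => hp.eq_of_parallel hα (by norm_num) hs hb,
    fun s hs => hp.eq_of_parallel hα (by norm_num) hs hb'⟩

open Classical in
/-- The curve after the flype. At the two parameters of the old crossing it takes the limit values
on the two parallel strands that replace the crossing. -/
noncomputable def flypeCurve (hp : IsFlypePicture e T (Set.range α) K') (a a' s : UnitAddCircle) :
    Y :=
  if s = a then e (-2, -1) else if s = a' then e (-2, 1) else hp.move (α s)

variable {a a' b b' : UnitAddCircle}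

theorem flypeCurve_a (hp : IsFlypePicture e T (Set.range α) K') :
    hp.flypeCurve a a' a = e (-2, -1) := if_pos rfl

theorem flypeCurve_a' (hp : IsFlypePicture e T (Set.range α) K')
    (hs : IsFlypeParameters e α a a' b b') : hp.flypeCurve a a' a' = e (-2, 1) := by
  rw [flypeCurve, if_neg hs.ne.symm, if_pos rfl]

theorem flypeCurve_of_ne (hp : IsFlypePicture e T (Set.range α) K') {s : UnitAddCircle}
    (h : s ≠ a) (h' : s ≠ a') : hp.flypeCurve a a' s = hp.move (α s) := by
  rw [flypeCurve, if_neg h, if_neg h']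

theorem eq_or_eq_of_map_eq (hα : IsGenericCurve α) (hs : IsFlypeParameters e α a a' b b')
    {s : UnitAddCircle} (h : α s = e (-2, 0)) : s = a ∨ s = a' :=
  hα.no_triple a a' s hs.ne (hs.map_a.trans hs.map_a'.symm) (hs.map_a.trans h.symm)

theorem flypeCurve_of_map_ne (hp : IsFlypePicture e T (Set.range α) K')
    (hs : IsFlypeParameters e α a a' b b') {s : UnitAddCircle}
    (h : α s ≠ e (-2, 0)) : hp.flypeCurve a a' s = hp.move (α s) :=
  hp.flypeCurve_of_ne (fun k => h (k ▸ hs.map_a)) (fun k => h (k ▸ hs.map_a'))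

theorem flypeCurve_b (hp : IsFlypePicture e T (Set.range α) K')
    (hs : IsFlypeParameters e α a a' b b') {s : UnitAddCircle} (h : s = b ∨ s = b') :
    hp.flypeCurve a a' s = e (2, 0) := by
  have key : ∀ y : ℝ, |y| = 1 → α s = e (2, y) → hp.flypeCurve a a' s = e (2, 0) := by
    intro y hy hsy
    rw [hp.flypeCurve_of_map_ne hs, hsy, hp.move_apply, flypeMap,
      flypeFactor_right (by norm_num) (by norm_num)]
    · norm_num
    · exact mem_flypeBox.2 ⟨by norm_num, by norm_num, by dsimp only; rw [hy]; norm_num⟩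
    · rw [hsy]
      intro h
      have : (2 : ℝ) = -2 := congrArg Prod.fst (hp.emb.injective h)
      norm_num at this
  rcases h with rfl | rfl
  · exact key 1 (by norm_num) hs.map_b
  · exact key (-1) (by norm_num) hs.map_b'

theorem b_ne (hp : IsFlypePicture e T (Set.range α) K')
    (hs : IsFlypeParameters e α a a' b b') : b ≠ b' := by
  rintro rfl
  have : (1 : ℝ) = -1 := congrArg Prod.snd (hp.emb.injective (hs.map_b.symm.trans hs.map_b'))
  norm_num at this

/-- Near the two parameters of the old crossing the new curve runs in the parallel strands. -/
theorem eventually_flypeCurve_a (hp : IsFlypePicture e T (Set.range α) K') (hα : IsGenericCurve α)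
    (hs : IsFlypeParameters e α a a' b b') :
    (∀ᶠ s in 𝓝 a, hp.flypeCurve a a' s = e ((hp.chart (α s)).1, -1)) ∧
      ∀ᶠ s in 𝓝 a', hp.flypeCurve a a' s = e ((hp.chart (α s)).1, 1) := by
  have hN : ∀ᶠ w : ℝ × ℝ in 𝓝 (-2, 0), w ∈ Set.Ioo (-3 : ℝ) (-1) ×ˢ Set.Ioo (-3 : ℝ) 3 :=
    (isOpen_Ioo.prod isOpen_Ioo).mem_nhds (by constructor <;> norm_num)
  have key : ∀ (s : UnitAddCircle) (σ : ℝ) (w : ℝ × ℝ), α s = e w → w.2 = σ * (w.1 + 2) →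
      w ∈ Set.Ioo (-3 : ℝ) (-1) ×ˢ Set.Ioo (-3 : ℝ) 3 → s ≠ a → s ≠ a' →
      hp.flypeCurve a a' s = e ((hp.chart (α s)).1, -σ) := by
    intro s σ w hw hw2 hwN h h'
    have hne : α s ≠ e (-2, 0) := fun k => (eq_or_eq_of_map_eq hα hs k).elim h h'
    have hwb : w ∈ flypeBox := mem_flypeBox.2 ⟨hwN.1.1.le, by linarith [hwN.1.2],
      (abs_lt.2 hwN.2).le⟩
    have h1 : w.1 + 2 ≠ 0 := by
      have := hp.fst_ne hwb ⟨s, hw⟩ (hw ▸ hne)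
      exact fun h0 => this (by linarith)
    rw [hp.flypeCurve_of_ne h h', hw, hp.move_apply hwb, hp.chart_apply, flypeMap,
      flypeFactor_left hwN.1.1.le hwN.1.2.le, hw2]
    congr 2
    field_simp
  constructor
  · filter_upwards [hs.near_a, hp.eventually_coord hα.continuous hs.map_a hN,
      isOpen_compl_singleton.mem_nhds (show a ∈ ({a'}ᶜ : Set UnitAddCircle) from hs.ne)]
      with s h1 h2 h3
    obtain ⟨w, hw, hw2⟩ := h1
    obtain ⟨v, hv, hvN⟩ := h2
    obtain rfl : w = v := hp.emb.injective (hw.symm.trans hv)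
    by_cases h : s = a
    · subst h
      rw [hp.flypeCurve_a, hs.map_a, hp.chart_apply]
    · exact key s 1 w hw (by rw [hw2, one_mul]) hvN h h3
  · filter_upwards [hs.near_a', hp.eventually_coord hα.continuous hs.map_a' hN,
      isOpen_compl_singleton.mem_nhds (show a' ∈ ({a}ᶜ : Set UnitAddCircle) from hs.ne.symm)]
      with s h1 h2 h3
    obtain ⟨w, hw, hw2⟩ := h1
    obtain ⟨v, hv, hvN⟩ := h2
    obtain rfl : w = v := hp.emb.injective (hw.symm.trans hv)
    by_cases h : s = a'
    · subst h
      rw [hp.flypeCurve_a' hs, hs.map_a', hp.chart_apply]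
    · have := key s (-1) w hw (by rw [hw2]; ring) hvN h3 h
      rwa [neg_neg] at this

theorem continuousAt_chart (hp : IsFlypePicture e T (Set.range α) K') (hα : Continuous α)
    {s : UnitAddCircle} {w : ℝ × ℝ} (h : α s = e w) :
    ContinuousAt (fun s => hp.chart (α s)) s :=
  ContinuousAt.comp (f := α) (hp.chart.continuousAt (h ▸ hp.mem_chart_source w)) hα.continuousAt

theorem continuous_flypeCurve [T2Space Y] (hp : IsFlypePicture e T (Set.range α) K')
    (hα : IsGenericCurve α) (hs : IsFlypeParameters e α a a' b b') :
    Continuous (hp.flypeCurve a a') := by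
  rw [continuous_iff_continuousAt]
  have hline : ∀ (s : UnitAddCircle) (y : ℝ), α s = e (-2, 0) →
      ContinuousAt (fun s => e ((hp.chart (α s)).1, y)) s := by
    intro s y h
    exact hp.emb.continuous.continuousAt.comp
      ((continuousAt_fst.comp (hp.continuousAt_chart hα.continuous h)).prodMk continuousAt_const)
  intro s
  by_cases h : s = a
  · subst h
    exact (hline s (-1) hs.map_a).congr_of_eventuallyEq (hp.eventually_flypeCurve_a hα hs).1
  by_cases h' : s = a'
  · subst h'
    exact (hline s 1 hs.map_a').congr_of_eventuallyEq (hp.eventually_flypeCurve_a hα hs).2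
  have hne : α s ≠ e (-2, 0) := fun k => (eq_or_eq_of_map_eq hα hs k).elim h h'
  have hc : ContinuousAt (fun s => hp.move (α s)) s :=
    ContinuousAt.comp (f := α) (hp.continuousAt_move ⟨s, rfl⟩ hne) hα.continuous.continuousAt
  refine hc.congr_of_eventuallyEq ?_
  filter_upwards [isOpen_compl_singleton.mem_nhds (show s ∈ ({a}ᶜ : Set UnitAddCircle) from h),
    isOpen_compl_singleton.mem_nhds (show s ∈ ({a'}ᶜ : Set UnitAddCircle) from h')] with u h1 h2
  exact hp.flypeCurve_of_ne h1 h2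

theorem range_flypeCurve (hp : IsFlypePicture e T (Set.range α) K') (hα : IsGenericCurve α)
    (hs : IsFlypeParameters e α a a' b b') : Set.range (hp.flypeCurve a a') = K' := by
  have hin : ∀ y : ℝ, |y| = 1 → e (-2, y) ∈ K' := fun y hy =>
    (hp.left' _ (mem_flypeBox.2 ⟨by norm_num, by norm_num, by dsimp only; rw [hy]; norm_num⟩)
      (by norm_num)).2 hy
  ext z
  constructor
  · rintro ⟨s, rfl⟩
    by_cases h : s = a
    · rw [h, hp.flypeCurve_a]; exact hin _ (by norm_num)
    by_cases h' : s = a'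
    · rw [h', hp.flypeCurve_a' hs]; exact hin _ (by norm_num)
    rw [hp.flypeCurve_of_ne h h']
    exact hp.move_mem ⟨s, rfl⟩ fun k => (eq_or_eq_of_map_eq hα hs k).elim h h'
  · intro hz
    by_cases h1 : z = e (-2, 1)
    · exact ⟨a', by rw [hp.flypeCurve_a' hs, h1]⟩
    by_cases h2 : z = e (-2, -1)
    · exact ⟨a, by rw [hp.flypeCurve_a, h2]⟩
    obtain ⟨_, ⟨s, rfl⟩, hc, hm⟩ := hp.exists_move_eq hz h1 h2
    exact ⟨s, by rw [hp.flypeCurve_of_map_ne hs hc, hm]⟩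

/-- The double points of the new curve: the crossing at `a`, `a'` is replaced by the crossing at
`b`, `b'`, and all others stay. -/
theorem flypeCurve_eq_iff (hp : IsFlypePicture e T (Set.range α) K') (hα : IsGenericCurve α)
    (hs : IsFlypeParameters e α a a' b b') {s t : UnitAddCircle} (hst : s ≠ t) :
    hp.flypeCurve a a' s = hp.flypeCurve a a' t ↔
      (α s = α t ∧ α s ≠ e (-2, 0)) ∨ (s = b ∧ t = b') ∨ (s = b' ∧ t = b) := by
  constructor
  · intro h
    have hcase : ∀ s, (s = a ∨ s = a') ∨ α s ≠ e (-2, 0) := fun s => by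
      by_cases h : α s = e (-2, 0)
      · exact Or.inl (eq_or_eq_of_map_eq hα hs h)
      · exact Or.inr h
    have hval : ∀ s, (s = a ∨ s = a') → ∃ y : ℝ, |y| = 1 ∧
        hp.flypeCurve a a' s = e (-2, y) := by
      rintro s (rfl | rfl)
      · exact ⟨-1, by norm_num, hp.flypeCurve_a⟩
      · exact ⟨1, by norm_num, hp.flypeCurve_a' hs⟩
    have haa : e (-2, -1) ≠ e (-2, 1) := fun h => by
      have : (-1 : ℝ) = 1 := congrArg Prod.snd (hp.emb.injective h)
      norm_num at this
    rcases hcase s with h1 | h1 <;> rcases hcase t with h2 | h2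
    · rcases h1 with rfl | rfl <;> rcases h2 with rfl | rfl
      · exact absurd rfl hst
      · rw [hp.flypeCurve_a, hp.flypeCurve_a' hs] at h
        exact absurd h haa
      · rw [hp.flypeCurve_a, hp.flypeCurve_a' hs] at h
        exact absurd h.symm haa
      · exact absurd rfl hst
    · obtain ⟨y, hy, hys⟩ := hval s h1
      rw [hys, hp.flypeCurve_of_map_ne hs h2] at h
      exact absurd h.symm (hp.move_ne ⟨t, rfl⟩ h2 hy)
    · obtain ⟨y, hy, hyt⟩ := hval t h2
      rw [hyt, hp.flypeCurve_of_map_ne hs h1] at h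
      exact absurd h (hp.move_ne ⟨s, rfl⟩ h1 hy)
    · rw [hp.flypeCurve_of_map_ne hs h1, hp.flypeCurve_of_map_ne hs h2] at h
      rcases hp.eq_of_move_eq ⟨s, rfl⟩ h1 ⟨t, rfl⟩ h2 h with h3 | ⟨h3, h4⟩
      · exact Or.inl ⟨h3, h1⟩
      · right
        rcases h3 with h3 | h3 <;> rcases h4 with h4 | h4
        · exact absurd ((hs.eq_b _ h3).trans (hs.eq_b _ h4).symm) hst
        · exact Or.inl ⟨hs.eq_b _ h3, hs.eq_b' _ h4⟩
        · exact Or.inr ⟨hs.eq_b' _ h3, hs.eq_b _ h4⟩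
        · exact absurd ((hs.eq_b' _ h3).trans (hs.eq_b' _ h4).symm) hst
  · rintro (⟨h1, h2⟩ | ⟨rfl, rfl⟩ | ⟨rfl, rfl⟩)
    · rw [hp.flypeCurve_of_map_ne hs h2, hp.flypeCurve_of_map_ne hs (h1 ▸ h2), h1]
    · rw [hp.flypeCurve_b hs (Or.inl rfl), hp.flypeCurve_b hs (Or.inr rfl)]
    · rw [hp.flypeCurve_b hs (Or.inl rfl), hp.flypeCurve_b hs (Or.inr rfl)]

/-- The branches of the new curve at `b` and `b'` cross. -/
theorem isCrossingAt_flypeCurve_b (hp : IsFlypePicture e T (Set.range α) K')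
    (hα : IsGenericCurve α) (hs : IsFlypeParameters e α a a' b b') :
    IsCrossingAt (hp.flypeCurve a a') b' b := by
  refine ⟨hp.chart.trans (diagonalCoordinates 2).toOpenPartialHomeomorph, ?_, ?_, ?_⟩
  · rw [hp.flypeCurve_b hs (Or.inr rfl), hp.range_flypeCurve hα hs]
    refine hp.isAxesChart_diagonal ?_
    have h1 : ∀ᶠ w : ℝ × ℝ in 𝓝 (2, 0), w ∈ Set.Ioo (1 : ℝ) 3 ×ˢ Set.Ioo (-3 : ℝ) 3 :=
      (isOpen_Ioo.prod isOpen_Ioo).mem_nhds (by constructor <;> norm_num)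
    filter_upwards [h1] with w hw
    exact hp.right' w (mem_flypeBox.2 ⟨by linarith [hw.1.1], hw.1.2.le, (abs_lt.2 hw.2).le⟩)
      hw.1.1.le
  all_goals
    have key : ∀ (s : UnitAddCircle) (w : ℝ × ℝ), α s = e w → 1 < w.1 → w.1 < 3 → |w.2| ≤ 1 →
        hp.flypeCurve a a' s = e (w.1, (w.1 - 2) * w.2) := by
      intro s w hw h1 h3 hy
      have hb : w ∈ flypeBox := mem_flypeBox.2 ⟨by linarith, h3.le, by linarith⟩
      rw [hp.flypeCurve_of_map_ne hs, hw, hp.move_apply hb, flypeMap,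
        flypeFactor_right h1.le h3.le]
      rw [hw]
      intro h
      have : w.1 = -2 := congrArg Prod.fst (hp.emb.injective h)
      linarith
  · filter_upwards [hp.eventually_parallel hα.continuous (by norm_num) hs.map_b'] with s h
    obtain ⟨w, hw, h1, h3, hy⟩ := h
    rw [key s w hw h1 h3 (by rw [hy]; norm_num), hy]
    simp [hp.chart_apply, diagonalCoordinates]
  · filter_upwards [hp.eventually_parallel hα.continuous (by norm_num) hs.map_b] with s h
    obtain ⟨w, hw, h1, h3, hy⟩ := h
    rw [key s w hw h1 h3 (by rw [hy]; norm_num), hy]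
    simp [hp.chart_apply, diagonalCoordinates]

/-- The crossings of the old curve other than the one in the picture persist. -/
theorem isCrossingAt_flypeCurve_of_ne [T2Space Y] (hp : IsFlypePicture e T (Set.range α) K')
    (hα : IsGenericCurve α) (hs : IsFlypeParameters e α a a' b b') {s t : UnitAddCircle}
    (hst : s ≠ t) (h : α s = α t) (hc : α s ≠ e (-2, 0)) :
    IsCrossingAt (hp.flypeCurve a a') s t := by
  have hcurve : ∀ s, α s ≠ e (-2, 0) → ∀ᶠ u in 𝓝 s,
      hp.flypeCurve a a' u = hp.move (α u) := by
    intro s hc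
    filter_upwards [hα.continuous.continuousAt.eventually (isOpen_compl_singleton.mem_nhds hc)]
      with u hu
    exact hp.flypeCurve_of_map_ne hs hu
  have hcont : ∀ {p : Y → Prop}, (∀ᶠ z in 𝓝 (α s), p z) →
      (∀ᶠ u in 𝓝 s, p (α u)) ∧ ∀ᶠ u in 𝓝 t, p (α u) := fun hp =>
    ⟨hα.continuous.continuousAt.eventually hp, hα.continuous.continuousAt.eventually (h ▸ hp)⟩
  by_cases hb : α s ∈ e '' flypeBox
  · obtain ⟨w, hw, hws⟩ := hb
    have hwK : e w ∈ Set.range α := ⟨s, hws.symm⟩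
    have h1 : w.1 ≠ -2 := hp.fst_ne hw hwK (hws ▸ hc)
    have h2 : w.1 ≠ 2 := by
      intro h2
      have := (hp.right w hw (by linarith)).1 hwK
      rcases (abs_eq (by norm_num)).1 this with h3 | h3
      · exact hst (hs.eq_of_map_eq (Or.inl (hs.eq_b s
          (hws.symm.trans (congrArg e (Prod.ext h2 h3))))) h)
      · exact hst (hs.eq_of_map_eq (Or.inr (hs.eq_b' s
          (hws.symm.trans (congrArg e (Prod.ext h2 h3))))) h)
    have hy := hp.abs_snd_le hw hwK
    have hmove := hp.eventually_move_eq (w := w) (by linarith)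
    rw [hws] at hmove
    let L : OpenPartialHomeomorph Y Y :=
      (hp.chart.trans flypeHomeomorph).trans (hp.emb.toOpenPartialHomeomorph e)
    have hL : ∀ z, L z = e (flypeMap (hp.chart z)) := fun z => rfl
    refine (hα.crossing s t hst h).transfer L hα.continuous h ?_ ?_ ?_ ?_
    · rw [← hws]
      simp only [L, OpenPartialHomeomorph.trans_source, Set.mem_inter_iff, Set.mem_preimage,
        hp.mem_chart_source, hp.chart_apply, true_and]
      exact ⟨⟨h1, h2⟩, trivial⟩
    · filter_upwards [hcurve s hc, (hcont hmove).1] with u k1 k2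
      rw [k1, k2, hL]
    · filter_upwards [hcurve t (h ▸ hc), (hcont hmove).2] with u k1 k2
      rw [k1, k2, hL]
    · rw [hp.range_flypeCurve hα hs, ← hws]
      have e1 : ∀ᶠ v : ℝ × ℝ in 𝓝 w, |v.2| < 3 :=
        (continuous_abs.comp continuous_snd).continuousAt.eventually
          (gt_mem_nhds (show |w.2| < 3 by linarith))
      have e2 : ∀ᶠ v : ℝ × ℝ in 𝓝 w, |(flypeMap v).2| < 3 :=
        (ContinuousAt.comp (f := flypeMap) (continuous_abs.comp continuous_snd).continuousAt
          (continuousAt_flypeMap h1)).eventually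
          (gt_mem_nhds (show |(flypeMap w).2| < 3 by linarith [(hp.flypeMap_mem hw hwK h1).1]))
      have e3 : ∀ᶠ v : ℝ × ℝ in 𝓝 w, v.1 ≠ -2 ∧ v.1 ≠ 2 :=
        flypeHomeomorph.open_source.mem_nhds ⟨h1, h2⟩
      filter_upwards [hp.eventually_exists (e1.and (e2.and e3))] with z hz
      obtain ⟨v, rfl, k1, k2, k3, k4⟩ := hz
      rw [hL, hp.chart_apply]
      exact hp.mem_iff_flypeMap_mem k3 k4 k1 k2
  · have hev := hp.eventually_notMem_box hb
    have hmove := hev.mono fun z hz => hp.move_of_notMem hz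
    refine (hα.crossing s t hst h).transfer (OpenPartialHomeomorph.refl Y) hα.continuous h
      trivial ?_ ?_ ?_
    · filter_upwards [hcurve s hc, (hcont hmove).1] with u k1 k2
      rw [k1, k2]; rfl
    · filter_upwards [hcurve t (h ▸ hc), (hcont hmove).2] with u k1 k2
      rw [k1, k2]; rfl
    · rw [hp.range_flypeCurve hα hs]
      filter_upwards [hev] with z hz
      exact hp.outside z hz

theorem isGenericCurve_flypeCurve [T2Space Y] (hp : IsFlypePicture e T (Set.range α) K')
    (hα : IsGenericCurve α) (hs : IsFlypeParameters e α a a' b b') :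
    IsGenericCurve (hp.flypeCurve a a') := by
  refine ⟨hp.continuous_flypeCurve hα hs, ?_, ?_, ?_⟩
  · intro x y z hxy h h'
    by_contra hcon
    push Not at hcon
    rw [hp.flypeCurve_eq_iff hα hs hxy] at h
    rw [hp.flypeCurve_eq_iff hα hs hcon.1.symm] at h'
    rcases h with ⟨h, -⟩ | h | h <;> rcases h' with ⟨h', -⟩ | h' | h'
    · exact (hα.no_triple x y z hxy h h').elim hcon.1 hcon.2
    · exact hxy (hs.eq_of_map_eq (Or.inl h'.1) h)
    · exact hxy (hs.eq_of_map_eq (Or.inr h'.1) h)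
    · exact hcon.1 (hs.eq_of_map_eq (Or.inl h.1) h').symm
    · exact hcon.2 (h'.2.trans h.2.symm)
    · exact hxy (h'.1.trans h.2.symm)
    · exact hcon.1 (hs.eq_of_map_eq (Or.inr h.1) h').symm
    · exact hxy (h'.1.trans h.2.symm)
    · exact hcon.2 (h'.2.trans h.2.symm)
  · refine (hα.finite.union (Set.toFinite {b, b'})).subset ?_
    rintro s ⟨t, hst, h⟩
    rcases (hp.flypeCurve_eq_iff hα hs hst).1 h with h | h | h
    · exact Or.inl ⟨t, hst, h.1⟩
    · exact Or.inr (Or.inl h.1)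
    · exact Or.inr (Or.inr h.1)
  · intro s t hst h
    rcases (hp.flypeCurve_eq_iff hα hs hst).1 h with h | ⟨rfl, rfl⟩ | ⟨rfl, rfl⟩
    · exact hp.isCrossingAt_flypeCurve_of_ne hα hs hst h.1 h.2
    · exact (hp.isCrossingAt_flypeCurve_b hα hs).symm h.symm
    · exact hp.isCrossingAt_flypeCurve_b hα hs

/-! ### The colouring by the middle of the picture -/

/-- The parameters at which the curve runs in the middle part of the picture, between the vertical
lines through the old and the new crossing. -/
def inMiddle (_ : IsFlypePicture e T (Set.range α) K') (s : UnitAddCircle) : Prop :=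
  ∃ w ∈ flypeBox, |w.1| < 2 ∧ α s = e w

theorem eventually_inMiddle_iff [T2Space Y] (hp : IsFlypePicture e T (Set.range α) K')
    (hα : IsGenericCurve α) (hs : IsFlypeParameters e α a a' b b') {s : UnitAddCircle}
    (h : ¬ (s = a ∨ s = a')) (h' : ¬ (s = b ∨ s = b')) :
    ∀ᶠ u in 𝓝 s, (hp.inMiddle u ↔ hp.inMiddle s) := by
  by_cases hb : α s ∈ e '' flypeBox
  · obtain ⟨w, hw, hws⟩ := hb
    have hwK : e w ∈ Set.range α := ⟨s, hws.symm⟩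
    have h1 : w.1 ≠ -2 := hp.fst_ne hw hwK
      (fun k => h (eq_or_eq_of_map_eq hα hs (hws.symm.trans k)))
    have h2 : w.1 ≠ 2 := by
      intro h2
      have := (hp.right w hw (by linarith)).1 hwK
      rcases (abs_eq (by norm_num)).1 this with h3 | h3
      · exact h' (Or.inl (hs.eq_b s (hws.symm.trans (congrArg e (Prod.ext h2 h3)))))
      · exact h' (Or.inr (hs.eq_b' s (hws.symm.trans (congrArg e (Prod.ext h2 h3)))))
    have h3 : |w.1| ≠ 2 := by
      intro h3
      rcases (abs_eq (by norm_num)).1 h3 with h4 | h4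
      · exact h2 h4
      · exact h1 h4
    have hy := hp.abs_snd_le hw hwK
    have e1 : ∀ᶠ v : ℝ × ℝ in 𝓝 w, |v.2| < 3 :=
      (continuous_abs.comp continuous_snd).continuousAt.eventually
        (gt_mem_nhds (show |w.2| < 3 by linarith))
    have hcabs : ContinuousAt (fun v : ℝ × ℝ => |v.1|) w :=
      (continuous_abs.comp continuous_fst).continuousAt
    rcases lt_or_gt_of_ne h3 with h4 | h4
    · have e2 := hcabs.eventually (gt_mem_nhds h4)
      filter_upwards [hp.eventually_coord hα.continuous hws.symm (e1.and e2)] with u hu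
      obtain ⟨v, hv, k1, k2⟩ := hu
      have k3 := abs_lt.1 k2
      exact iff_of_true ⟨v, mem_flypeBox.2 ⟨by linarith, by linarith, k1.le⟩, k2, hv⟩
        ⟨w, hw, h4, hws.symm⟩
    · have e2 := hcabs.eventually (lt_mem_nhds h4)
      filter_upwards [hp.eventually_coord hα.continuous hws.symm e2] with u hu
      obtain ⟨v, hv, k2⟩ := hu
      refine iff_of_false ?_ ?_
      · rintro ⟨v', -, k3, hv'⟩
        obtain rfl := hp.emb.injective (hv.symm.trans hv')
        exact lt_asymm k2 k3
      · rintro ⟨v', -, k3, hv'⟩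
        obtain rfl := hp.emb.injective (hws.trans hv')
        exact lt_asymm h4 k3
  · have hnot : ∀ u, α u ∉ e '' flypeBox → ¬ hp.inMiddle u := by
      rintro u hu ⟨w, hw, -, hwu⟩
      exact hu ⟨w, hw, hwu.symm⟩
    filter_upwards [hα.continuous.continuousAt.eventually (hp.eventually_notMem_box hb)] with u hu
    exact iff_of_false (hnot u hu) (hnot s hb)

/-- If the curve runs in the graph of a function of the horizontal coordinate near the parameter
`t`, then this coordinate is a continuous injective function of the parameter. -/
theorem exists_injOn_coordinate (hp : IsFlypePicture e T (Set.range α) K') (hα : IsGenericCurve α)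
    {t : ℝ} {ℓ : ℝ → ℝ} {p : ℝ × ℝ → Prop}
    (h : ∀ᶠ s in 𝓝 (t : UnitAddCircle), ∃ w : ℝ × ℝ, α s = e w ∧ w.2 = ℓ w.1 ∧ p w) :
    ∃ U ∈ 𝓝 t, ContinuousOn (fun u : ℝ => (hp.chart (α u)).1) U ∧
      Set.InjOn (fun u : ℝ => (hp.chart (α u)).1) U ∧
      ∀ u ∈ U, ∃ w : ℝ × ℝ, α u = e w ∧ w.2 = ℓ w.1 ∧ p w := by
  obtain ⟨W, hW, hWi, -⟩ := hα.exists_injOn_nhds t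
  have hct : Filter.Tendsto (fun u : ℝ => (u : UnitAddCircle)) (𝓝 t) (𝓝 (t : UnitAddCircle)) :=
    (AddCircle.continuous_mk' 1).tendsto t
  refine ⟨_, Filter.inter_mem (Ioo_mem_nhds (show t - 1 / 2 < t by linarith)
    (show t < t + 1 / 2 by linarith)) (Filter.inter_mem (hct hW) (hct h)), ?_, ?_, ?_⟩
  · intro u hu
    obtain ⟨w, hw, -⟩ := hu.2.2
    have h1 := hp.continuousAt_chart hα.continuous hw
    have h2 : ContinuousAt (fun u : ℝ => hp.chart (α u)) u :=
      ContinuousAt.comp (g := fun s => hp.chart (α s)) (f := fun u : ℝ => (u : UnitAddCircle)) h1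
        (AddCircle.continuous_mk' 1).continuousAt
    exact (continuousAt_fst.comp h2).continuousWithinAt
  · intro u hu v hv huv
    obtain ⟨w, hw, hw2, -⟩ := hu.2.2
    obtain ⟨w', hw', hw2', -⟩ := hv.2.2
    dsimp only at huv
    rw [hw, hw', hp.chart_apply, hp.chart_apply] at huv
    have h1 : α u = α v := by
      rw [hw, hw']
      exact congrArg e (Prod.ext huv (by rw [hw2, hw2', huv]))
    have h2 := hWi hu.2.1 hv.2.1 h1
    exact coe_unitAddCircle_injOn (r := t - 1 / 2) hu.1.1.le (by linarith [hu.1.2]) hv.1.1.le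
      (by linarith [hv.1.2]) h2
  · exact fun u hu => hu.2.2

/-- The curve enters or leaves the middle of the picture at the parameters of the old and of the
new crossing. -/
theorem flipsAt_inMiddle (hp : IsFlypePicture e T (Set.range α) K') (hα : IsGenericCurve α)
    (hs : IsFlypeParameters e α a a' b b') {t : ℝ}
    (ht : ((t : UnitAddCircle) = a ∨ (t : UnitAddCircle) = a') ∨
      ((t : UnitAddCircle) = b ∨ (t : UnitAddCircle) = b')) :
    FlipsAt (fun u : ℝ => hp.inMiddle u) t := by
  have hmid : ∀ (u : ℝ) (w : ℝ × ℝ), α u = e w → |w.2| ≤ 3 → (hp.inMiddle u ↔ |w.1| < 2) := by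
    intro u w hw hy
    constructor
    · rintro ⟨v, -, hv, hv'⟩
      rwa [hp.emb.injective (hw.symm.trans hv')]
    · intro h
      have := abs_lt.1 h
      exact ⟨w, mem_flypeBox.2 ⟨by linarith, by linarith, hy⟩, h, hw⟩
  have hleft : ∀ ℓ : ℝ → ℝ, α t = e (-2, 0) →
      (∀ᶠ s in 𝓝 (t : UnitAddCircle), ∃ w : ℝ × ℝ, α s = e w ∧ w.2 = ℓ w.1) →
      FlipsAt (fun u : ℝ => hp.inMiddle u) t := by
    intro ℓ h0 h
    have hN : ∀ᶠ w : ℝ × ℝ in 𝓝 (-2, 0), w ∈ Set.Ioo (-3 : ℝ) (-1) ×ˢ Set.Ioo (-3 : ℝ) 3 :=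
      (isOpen_Ioo.prod isOpen_Ioo).mem_nhds (by constructor <;> norm_num)
    have h2 : ∀ᶠ s in 𝓝 (t : UnitAddCircle), ∃ w : ℝ × ℝ, α s = e w ∧ w.2 = ℓ w.1 ∧
        w ∈ Set.Ioo (-3 : ℝ) (-1) ×ˢ Set.Ioo (-3 : ℝ) 3 := by
      filter_upwards [h, hp.eventually_coord hα.continuous h0 hN] with s h1 h2
      obtain ⟨w, hw, hw2⟩ := h1
      obtain ⟨v, hv, hvN⟩ := h2
      obtain rfl : w = v := hp.emb.injective (hw.symm.trans hv)
      exact ⟨w, hw, hw2, hvN⟩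
    obtain ⟨U, hU, hc, hi, hUw⟩ := hp.exists_injOn_coordinate hα h2
    refine flipsAt_of_injOn hU hc hi (Or.inl fun u hu => ?_)
    obtain ⟨w, hw, -, hwN⟩ := hUw u hu
    rw [hmid u w hw (abs_lt.2 hwN.2).le, h0, hw, hp.chart_apply, hp.chart_apply, abs_lt]
    exact ⟨fun h => h.1, fun h => ⟨h, by linarith [hwN.1.2]⟩⟩
  have hright : ∀ y : ℝ, |y| = 1 → α t = e (2, y) → FlipsAt (fun u : ℝ => hp.inMiddle u) t := by
    intro y hy h0
    have h2 : ∀ᶠ s in 𝓝 (t : UnitAddCircle), ∃ w : ℝ × ℝ, α s = e w ∧ w.2 = (fun _ => y) w.1 ∧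
        1 < w.1 := by
      filter_upwards [hp.eventually_parallel hα.continuous hy h0] with s h
      obtain ⟨w, hw, h1, -, h3⟩ := h
      exact ⟨w, hw, h3, h1⟩
    obtain ⟨U, hU, hc, hi, hUw⟩ := hp.exists_injOn_coordinate hα (ℓ := fun _ => y)
      (p := fun w => 1 < w.1) h2
    refine flipsAt_of_injOn hU hc hi (Or.inr fun u hu => ?_)
    obtain ⟨w, hw, hwy, hw1⟩ := hUw u hu
    rw [hmid u w hw (by rw [hwy, hy]; norm_num), h0, hw, hp.chart_apply, hp.chart_apply, abs_lt]
    exact ⟨fun h => h.2, fun h => ⟨by linarith, h⟩⟩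
  rcases ht with (rfl | rfl) | (rfl | rfl)
  · exact hleft (fun x => x + 2) hs.map_a hs.near_a
  · exact hleft (fun x => -(x + 2)) hs.map_a' hs.near_a'
  · exact hright 1 (by norm_num) hs.map_b
  · exact hright (-1) (by norm_num) hs.map_b'

/-- The old and the new crossing give chords that cross the same other chords: the end points of
a chord have the same colour, as the colour depends only on the point of the surface. -/
theorem crosses_iff_crosses [T2Space Y] (hp : IsFlypePicture e T (Set.range α) K')
    (hα : IsGenericCurve α) (hs : IsFlypeParameters e α a a' b b') {s t : UnitAddCircle}
    (hst : s ≠ t) (h : α s = α t) (hc : α s ≠ e (-2, 0)) :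
    Crosses s(a, a') s(s, t) ↔ Crosses s(b, b') s(s, t) := by
  have hnb : ∀ z, (z = b ∨ z = b') → α z ≠ e (-2, 0) := by
    rintro z (rfl | rfl) hz
    · have : (2 : ℝ) = -2 := congrArg Prod.fst (hp.emb.injective (hs.map_b.symm.trans hz))
      norm_num at this
    · have : (2 : ℝ) = -2 := congrArg Prod.fst (hp.emb.injective (hs.map_b'.symm.trans hz))
      norm_num at this
  have ha : ∀ z, (z = a ∨ z = a') → α z = e (-2, 0) := by
    rintro z (rfl | rfl)
    exacts [hs.map_a, hs.map_a']
  refine crosses_iff_crosses_of_colouring (p := hp.inMiddle) hs.ne (hp.b_ne hs)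
    (fun z h1 h2 => hnb z h2 (ha z h1)) (fun t ht => hp.flipsAt_inMiddle hα hs ht)
    (fun z h1 h2 => hp.eventually_inMiddle_iff hα hs h1 h2) (fun k => hc (ha s k))
    (fun k => hst (hs.eq_of_map_eq k h)) (fun k => hc (h ▸ ha t k))
    (fun k => hst (hs.eq_of_map_eq k h.symm).symm) ?_
  simp only [inMiddle, h]

end IsFlypePicture

/-! ### Chord diagrams under a flype -/

theorem ChordDiagram.ne_of_mem {D : ChordDiagram} {a b x y : UnitAddCircle}
    (hc : s(a, b) ∈ D.chords) (hd : s(x, y) ∈ D.chords) (h : s(a, b) ≠ s(x, y)) :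
    a ≠ b ∧ x ≠ a ∧ x ≠ b ∧ y ≠ a ∧ y ≠ b := by
  have key : ∀ z, z ∈ s(a, b) → z ∉ s(x, y) := fun z h1 h2 => h (D.disjoint _ hc _ hd z h1 h2)
  have ha := key a (Sym2.mem_mk_left _ _)
  have hb := key b (Sym2.mem_mk_right _ _)
  rw [Sym2.mem_iff] at ha hb
  push Not at ha hb
  exact ⟨fun k => D.not_isDiag _ hc (Sym2.mk_isDiag_iff.2 k), ha.1.symm, hb.1.symm, ha.2.symm,
    hb.2.symm⟩

theorem KnotProjection.mk_mem_chords {P : KnotProjection} {s t : UnitAddCircle} :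
    s(s, t) ∈ P.chordDiagram.chords ↔ s ≠ t ∧ P.toFun s = P.toFun t := by
  constructor
  · rintro ⟨x, y, hne, h, he⟩
    rcases Sym2.eq_iff.1 he with ⟨rfl, rfl⟩ | ⟨rfl, rfl⟩
    exacts [⟨hne, h⟩, ⟨hne.symm, h.symm⟩]
  · rintro ⟨hne, h⟩
    exact ⟨s, t, hne, h, rfl⟩

open Classical in
/-- The chord of the new projection that corresponds to the chord `c` of the old one, for the
homeomorphism `h` of the circle that carries the parameters of the new curve to those of the
new projection: the chord `s(a, a')` of the crossing that is flyped away is replaced by the chord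
`s(b, b')` of the crossing that is created. -/
noncomputable def flypeChord (h : UnitAddCircle ≃ₜ UnitAddCircle) (a a' b b' : UnitAddCircle)
    (c : Sym2 UnitAddCircle) : Sym2 UnitAddCircle :=
  if c = s(a, a') then s(h b, h b') else c.map h

theorem flypeChord_self {h : UnitAddCircle ≃ₜ UnitAddCircle} {a a' b b' : UnitAddCircle} :
    flypeChord h a a' b b' s(a, a') = s(h b, h b') := if_pos rfl

theorem flypeChord_of_ne {h : UnitAddCircle ≃ₜ UnitAddCircle} {a a' b b' s t : UnitAddCircle}
    (hne : s(s, t) ≠ s(a, a')) : flypeChord h a a' b b' s(s, t) = s(h s, h t) := if_neg hne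

section

variable {P P' : KnotProjection} {φ : Sphere2 ≃ₜ Sphere2} {e : ℝ × ℝ → Sphere2}
  {T : Set (ℝ × ℝ)} {K' : Set Sphere2} {a a' b b' : UnitAddCircle}
  {h : UnitAddCircle ≃ₜ UnitAddCircle}

/-- The only chord of the old projection over the crossing of the picture is `s(a, a')`. -/
theorem IsFlypeParameters.map_ne_of_mem_chords (hs : IsFlypeParameters e P.toFun a a' b b')
    {s t : UnitAddCircle} (hc : s(s, t) ∈ P.chordDiagram.chords) (hne : s(s, t) ≠ s(a, a')) :
    P.toFun s ≠ e (-2, 0) := by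
  intro k
  have haa : s(a, a') ∈ P.chordDiagram.chords :=
    KnotProjection.mk_mem_chords.2 ⟨hs.ne, hs.map_a.trans hs.map_a'.symm⟩
  obtain ⟨-, h1, h2, -⟩ := ChordDiagram.ne_of_mem haa hc hne.symm
  exact (IsFlypePicture.eq_or_eq_of_map_eq P.isGenericCurve hs k).elim h1 h2

theorem bijOn_flypeChord (hp : IsFlypePicture e T (Set.range P.toFun) K')
    (hs : IsFlypeParameters e P.toFun a a' b b')
    (hh : ∀ s, φ (P'.toFun (h s)) = hp.flypeCurve a a' s) :
    Set.BijOn (flypeChord h a a' b b') P.chordDiagram.chords P'.chordDiagram.chords := by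
  have haa : s(a, a') ∈ P.chordDiagram.chords :=
    KnotProjection.mk_mem_chords.2 ⟨hs.ne, hs.map_a.trans hs.map_a'.symm⟩
  have hmem : ∀ s t, s(h s, h t) ∈ P'.chordDiagram.chords ↔
      s ≠ t ∧ hp.flypeCurve a a' s = hp.flypeCurve a a' t := fun s t => by
    rw [KnotProjection.mk_mem_chords, h.injective.ne_iff, ← hh, ← hh, φ.injective.eq_iff]
  -- the points `b` and `b'` are not end points of a chord of the old projection
  have hb : ∀ s t, s(s, t) ∈ P.chordDiagram.chords → s(s, t) ≠ s(b, b') := by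
    intro s t hc he
    rw [he, KnotProjection.mk_mem_chords] at hc
    exact hc.1 (hs.eq_of_map_eq (Or.inl rfl) hc.2)
  refine ⟨fun c => ?_, fun c hc d hd hcd => ?_, fun c => ?_⟩
  · induction c with
    | _ s t =>
      intro hc
      by_cases hca : s(s, t) = s(a, a')
      · rw [hca, flypeChord_self, hmem]
        exact ⟨hp.b_ne hs, (hp.flypeCurve_eq_iff P.isGenericCurve hs (hp.b_ne hs)).2
          (Or.inr (Or.inl ⟨rfl, rfl⟩))⟩
      · have hst := KnotProjection.mk_mem_chords.1 hc
        rw [flypeChord_of_ne hca, hmem]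
        exact ⟨hst.1, (hp.flypeCurve_eq_iff P.isGenericCurve hs hst.1).2
          (Or.inl ⟨hst.2, hs.map_ne_of_mem_chords hc hca⟩)⟩
  · induction c with
    | _ s t =>
      induction d with
      | _ x y =>
        have hinj := Sym2.map.injective h.injective
        by_cases hca : s(s, t) = s(a, a') <;> by_cases hda : s(x, y) = s(a, a')
        · rw [hca, hda]
        · rw [hca, flypeChord_self, flypeChord_of_ne hda] at hcd
          exact absurd (@hinj s(b, b') s(x, y) hcd).symm (hb x y hd)
        · rw [hda, flypeChord_self, flypeChord_of_ne hca] at hcd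
          exact absurd (@hinj s(s, t) s(b, b') hcd) (hb s t hc)
        · rw [flypeChord_of_ne hda, flypeChord_of_ne hca] at hcd
          exact hinj hcd
  · induction c with
    | _ x y =>
      obtain ⟨s, rfl⟩ := h.surjective x
      obtain ⟨t, rfl⟩ := h.surjective y
      intro hc
      obtain ⟨hst, heq⟩ := (hmem s t).1 hc
      rcases (hp.flypeCurve_eq_iff P.isGenericCurve hs hst).1 heq with
        ⟨h1, h2⟩ | ⟨rfl, rfl⟩ | ⟨rfl, rfl⟩
      · refine ⟨s(s, t), KnotProjection.mk_mem_chords.2 ⟨hst, h1⟩, flypeChord_of_ne fun k => h2 ?_⟩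
        rcases Sym2.eq_iff.1 k with ⟨rfl, -⟩ | ⟨rfl, -⟩
        exacts [hs.map_a, hs.map_a']
      · exact ⟨_, haa, flypeChord_self⟩
      · exact ⟨_, haa, flypeChord_self.trans Sym2.eq_swap⟩

theorem crosses_flypeChord (hp : IsFlypePicture e T (Set.range P.toFun) K')
    (hs : IsFlypeParameters e P.toFun a a' b b') {c d : Sym2 UnitAddCircle}
    (hc : c ∈ P.chordDiagram.chords) (hd : d ∈ P.chordDiagram.chords) (hcd : c ≠ d) :
    Crosses (flypeChord h a a' b b' c) (flypeChord h a a' b b' d) ↔ Crosses c d := by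
  have hself : ∀ s t, s(s, t) ∈ P.chordDiagram.chords → s(s, t) ≠ s(a, a') →
      (Crosses s(h b, h b') s(h s, h t) ↔ Crosses s(a, a') s(s, t)) := by
    intro s t hst hne
    obtain ⟨h1, h2⟩ := KnotProjection.mk_mem_chords.1 hst
    have hbs : ∀ z, z = b ∨ z = b' → s ≠ z ∧ t ≠ z := fun z hz =>
      ⟨fun k => h1 (hs.eq_of_map_eq (k ▸ hz) h2),
        fun k => h1 (hs.eq_of_map_eq (k ▸ hz) h2.symm).symm⟩
    rw [crosses_map_homeomorph h (hp.b_ne hs) (hbs b (Or.inl rfl)).1 (hbs b' (Or.inr rfl)).1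
      (hbs b (Or.inl rfl)).2 (hbs b' (Or.inr rfl)).2]
    exact (hp.crosses_iff_crosses P.isGenericCurve hs h1 h2
      (hs.map_ne_of_mem_chords hst hne)).symm
  induction c with
  | _ s t =>
    induction d with
    | _ x y =>
      by_cases hca : s(s, t) = s(a, a')
      · rw [hca, flypeChord_self, flypeChord_of_ne fun k => hcd (hca.trans k.symm)]
        exact hself x y hd fun k => hcd (hca.trans k.symm)
      · by_cases hda : s(x, y) = s(a, a')
        · rw [hda, flypeChord_self, flypeChord_of_ne hca, crosses_comm, hself s t hc hca,
            crosses_comm]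
        · rw [flypeChord_of_ne hca, flypeChord_of_ne hda]
          obtain ⟨h1, h2, h3, h4, h5⟩ := ChordDiagram.ne_of_mem hc hd hcd
          exact crosses_map_homeomorph h h1 h2 h3 h4 h5

end

theorem mainTheorem4 (P P' : KnotProjection) (hflype : IsFlype P P') :
    P.cross = P'.cross ∧ P.triple = P'.triple ∧ P.h = P'.h ∧ P.three = P'.three ∧
      P.hh = P'.hh := by
  obtain ⟨e, φ, T, emb, hT, hTf, hK, hK', hout, -⟩ := hflype
  have himage : φ '' P'.image = Set.range (φ ∘ P'.toFun) := (Set.range_comp _ _).symm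
  rw [himage] at hK' hout
  have hp : IsFlypePicture e T (Set.range P.toFun) (Set.range (φ ∘ P'.toFun)) :=
    isFlypePicture_of_isFlype emb hT hTf hK hK' hout
  have hα := P.isGenericCurve
  obtain ⟨a, a', b, b', hs⟩ := hp.exists_parameters hα
  obtain ⟨h, hh⟩ := (hp.isGenericCurve_flypeCurve hα hs).exists_homeomorph
    (P'.isGenericCurve.comp_homeomorph φ) (hp.range_flypeCurve hα hs)
  exact ChordDiagram.counts_eq_of_bijOn (bijOn_flypeChord hp hs hh)
    fun c hc d hd hcd => crosses_flypeChord (h := h) hp hs hc hd hcd
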